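/- **Conventions.** Let $P$ be a left cancellative monoid with identity $e$ and group of invertible elements $P^*$. Write $p\le q$ if $q\in pP$. A right LCM $\vee U$ of $U\subset P$ is a common right multiple of the elements of $U$ that left-divides every other one (it is determined up to right multiplication by $P^*$); $\vee U=\infty$ if there is none. $P$ is a *right LCM monoid* if any two elements with a common right multiple have a right LCM. $P$ is *Noetherian* if there is no infinite descending sequence for the proper factor relation ($f$ is a proper factor of $g$ if $g=xfy$ with $x$ or $y$ not invertible). $P_a$ is the set of atoms. *Trees.* A list is a map $\lambda:\{1,\dots,n\}\to P\cup\{\infty\}$. It is a *leaf* if all its values lie in $P_a\cup\{\infty\}$ or if some value is invertible. If $\lambda$ is not a leaf, let $i$ be the first index for which $\lambda(i)=pq$ with $p,q\in P\setminus P^*$, choose such a factorisation, let $\lambda_1$ be $\lambda$ with $\lambda(i)$ replaced by $p$, and let $\lambda_2(j)=p^{-1}(p\vee\lambda(j))$ (for some choice of right LCM), with $\lambda_2(j)=\infty$ if $p\vee\lambda(j)=\infty$. Iterating $\lambda\mapsto\lambda_1,\lambda_2$ and stopping at leaves gives a binary tree rooted at $\lambda$. *Positivity.* Let $X=\{X_p\}_{p\in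 P}$ be a product system of $C^*$-correspondences over a $C^*$-algebra $A$ with $X_e=A$, let $N:P\to(0,\infty)$ be a homomorphism with $N|_{P^*}=1$, let $\beta\in\mathbb R$ and let $\tau$ be a tracial state of $A$. For $a\in A_+$ put $\operatorname{Tr}^p_\tau(a)=\sup_H\sum_{\xi\in H}\tau(\langle\xi,a\xi\rangle)\in[0,\infty]$, the supremum being over the finite $H\subset X_p$ with $\sum_{\xi\in H}\theta_{\xi,\xi}\le1$. For $R\subset P$ say that $\tau$ is *positive on $R$* if $$\tau(a)+\sum_{\emptyset\ne K\subset J}(-1)^{|K|}N(\vee K)^{-\beta}\operatorname{Tr}_\tau^{\vee K}(a)\ \ge\ 0\qquad\text{for all finite }J\subset R\text{ and all }a\in A_+,$$ where the terms with $\vee K=\infty$ are zero. When $P^*\neq\{e\}$ we assume that $\operatorname{Tr}_\tau^{pu}(a)=\operatorname{Tr}_\tau^{p}(a)$ for all $p\in P$, $u\in P^*$, $a\in A_+$, so that these sums do not depend on the choice of the right LCMs $\vee K$; this is void when $P^*=\{e\}$. **Theorem.** (1) Let $P$ be a Noetherian right LCM monoid in which any two elements have a common right multiple. Then every list $\lambda$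 in $P\cup\{\infty\}$ has a tree as above, and every such tree (for all choices of factorisations and right LCMs) is finite. Moreover positivity reduces to atoms: for all $A,X,N,\beta,\tau$ as above, $\tau$ is positive on $P\setminus\{e\}$ if and only if it is positive on $P_a$. (2) Let $A_M^+$ be an Artin monoid of finite type, i.e. the Coxeter group of the Coxeter matrix $M$ is finite, with canonical generating set $S$. Then reduction of positivity to generators holds: for all $A$, $X$, $N:A_M^+\to(0,\infty)$, $\beta$, $\tau$ as above, $\tau$ is positive on $A_M^+\setminus\{e\}$ if and only if it is positive on $S$. -/

import Mathlib

open scoped ENNReal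

/-! ### Monoids: right least common multiples, Noetherianity

In a monoid, Mathlib's `p ∣ q` means `∃ x, q = p * x`, i.e. `p` is a left divisor of `q`
(`q ∈ pP`). Atoms are Mathlib's `Irreducible` elements: non-invertible elements `s` such that
`s = x * y` forces `x` or `y` to be invertible. -/

/-- `r` is a right LCM of `U`: a right multiple of every element of `U` that left-divides every
other common right multiple. -/
def IsRightLCM {P : Type*} [Monoid P] (U : Set P) (r : P) : Prop :=
  (∀ p ∈ U, p ∣ r) ∧ ∀ r' : P, (∀ p ∈ U, p ∣ r') → r ∣ r'

/-- Any two elements with a common right multiple have a right LCM. (Together with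
left cancellation this is the definition of a right LCM monoid.) -/
def HasConditionalRightLCMs (P : Type*) [Monoid P] : Prop :=
  ∀ p q : P, (∃ r, p ∣ r ∧ q ∣ r) → ∃ r, IsRightLCM {p, q} r

/-- `f` is a proper factor of `g`. -/
def IsProperFactor {P : Type*} [Monoid P] (f g : P) : Prop :=
  ∃ x y : P, g = x * f * y ∧ (¬ IsUnit x ∨ ¬ IsUnit y)

/-- There is no infinite descending sequence for the proper factor relation. -/
def IsFactorNoetherian (P : Type*) [Monoid P] : Prop :=
  WellFounded (IsProperFactor (P := P))

/-- Any two elements have a common right multiple. -/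
def IsRightDirected (P : Type*) [Monoid P] : Prop :=
  ∀ x y : P, ∃ z, x ∣ z ∧ y ∣ z

/-! ### Lists in `P ∪ {∞}` and their trees -/

/-- An `n`-list in `P ∪ {∞}`. -/
abbrev ExtList (P : Type*) (n : ℕ) := Fin n → WithTop P

/-- A list is a leaf if all its entries are atoms or `∞`, or if some entry is invertible. -/
def IsLeaf {P : Type*} [Monoid P] {n : ℕ} (l : ExtList P n) : Prop :=
  (∀ j, l j = ⊤ ∨ ∃ s : P, Irreducible s ∧ l j = (s : WithTop P)) ∨
    ∃ (j : Fin n) (u : P), IsUnit u ∧ l j = (u : WithTop P)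

/-- `x = pq` for some non-invertible `p`, `q` in `P`. -/
def HasNontrivialFactorisation {P : Type*} [Monoid P] (x : WithTop P) : Prop :=
  ∃ p q : P, ¬ IsUnit p ∧ ¬ IsUnit q ∧ x = ((p * q : P) : WithTop P)

/-- `y` is a possible value of `p⁻¹ (p ∨ x)`, where `p ∨ x` is any choice of right LCM of `p` and
`x`; it is `∞` if there is none, and if `x = ∞`. -/
def IsResidual {P : Type*} [Monoid P] (p : P) (x y : WithTop P) : Prop :=
  (∃ x' y' : P, x = (x' : WithTop P) ∧ y = (y' : WithTop P) ∧ IsRightLCM {p, x'} (p * y')) ∨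
    (y = ⊤ ∧ ∀ x' : P, x = (x' : WithTop P) → ¬ ∃ m, IsRightLCM {p, x'} m)

/-- One iteration step: at the first index `i` where the entry has a nontrivial factorisation,
choose one, `l i = p * q`; the list `l₁` has `p` in place of `p * q`, and `l₂` is obtained by
applying `x ↦ p⁻¹ (p ∨ x)` to every entry. -/
def IsSplitting {P : Type*} [Monoid P] {n : ℕ} (l l₁ l₂ : ExtList P n) : Prop :=
  ∃ (i : Fin n) (p q : P), ¬ IsUnit p ∧ ¬ IsUnit q ∧ l i = ((p * q : P) : WithTop P) ∧
    (∀ j < i, ¬ HasNontrivialFactorisation (l j)) ∧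
    l₁ = Function.update l i (p : WithTop P) ∧
    ∀ j, IsResidual p (l j) (l₂ j)

/-- The nodes of a tree labelled by lists, as words in two symbols (`0`, `1` stand for the symbols
`1`, `2`): a word is a node when no proper initial subword of it carries a leaf. -/
def treeNodes {P : Type*} [Monoid P] {n : ℕ} (Λ : List (Fin 2) → ExtList P n) :
    Set (List (Fin 2)) :=
  {ω | ∀ ω', ω' <+: ω → ω' ≠ ω → ¬ IsLeaf (Λ ω')}

/-- `Λ` is a tree of the list `l` (for some choices of factorisations and of right LCMs):
the root carries `l`, and every node `ω` that is not a leaf is split into the two nodes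
`ω1`, `ω2`. The values of `Λ` at words that are not nodes are irrelevant. -/
def IsListTree {P : Type*} [Monoid P] {n : ℕ} (l : ExtList P n)
    (Λ : List (Fin 2) → ExtList P n) : Prop :=
  Λ [] = l ∧ ∀ ω ∈ treeNodes Λ, ¬ IsLeaf (Λ ω) →
    IsSplitting (Λ ω) (Λ (ω ++ [0])) (Λ (ω ++ [1]))

/-! ### C*-correspondences and product systems -/

/-- A C*-correspondence structure over `A` on a complex Banach space `E`: a right Hilbert
`A`-module (inner product `⟪x, y⟫` linear in `y`, whose norm is that of `E`) with a left action
of `A` by adjointable operators. (Mathlib's `CStarModule` is about left modules.) -/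
structure CStarCorrespondence (A : Type*) [NonUnitalCStarAlgebra A] [PartialOrder A]
    [StarOrderedRing A] (E : Type*) [NormedAddCommGroup E] [NormedSpace ℂ E]
    [CompleteSpace E] where
  /-- the `A`-valued inner product -/
  ip : E → E → A
  /-- the right action -/
  rsmul : E → A → E
  /-- the left action -/
  lsmul : A → E → E
  add_rsmul : ∀ x y a, rsmul (x + y) a = rsmul x a + rsmul y a
  rsmul_add : ∀ x a b, rsmul x (a + b) = rsmul x a + rsmul x b
  rsmul_mul : ∀ x a b, rsmul x (a * b) = rsmul (rsmul x a) b
  smul_rsmul : ∀ (c : ℂ) x a, rsmul (c • x) a = c • rsmul x a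
  rsmul_smul : ∀ (c : ℂ) x a, rsmul x (c • a) = c • rsmul x a
  ip_add : ∀ x y z, ip x (y + z) = ip x y + ip x z
  ip_smul : ∀ (c : ℂ) x y, ip x (c • y) = c • ip x y
  ip_rsmul : ∀ x y a, ip x (rsmul y a) = ip x y * a
  star_ip : ∀ x y, star (ip x y) = ip y x
  ip_self_nonneg : ∀ x, 0 ≤ ip x x
  norm_sq : ∀ x, ‖x‖ ^ 2 = ‖ip x x‖
  add_lsmul : ∀ a b x, lsmul (a + b) x = lsmul a x + lsmul b x
  smul_lsmul : ∀ (c : ℂ) a x, lsmul (c • a) x = c • lsmul a x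
  mul_lsmul : ∀ a b x, lsmul (a * b) x = lsmul a (lsmul b x)
  ip_lsmul : ∀ a x y, ip (lsmul a x) y = ip x (lsmul (star a) y)

/-- The induced trace `Tr_τ(T)` of a positive operator `T` on `E`: the supremum of
`∑_{ξ ∈ H} τ(⟪ξ, T ξ⟫)` over the finite subsets `H` of `E` with `∑_{ξ ∈ H} θ_{ξ,ξ} ≤ 1`, where
`θ_{ξ,ξ} η = ξ ⟪ξ, η⟫`; the operator inequality is `⟪η, (∑ θ_{ξ,ξ}) η⟫ ≤ ⟪η, η⟫` for all `η`. -/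
noncomputable def CStarCorrespondence.inducedTrace {A : Type*} [NonUnitalCStarAlgebra A]
    [PartialOrder A] [StarOrderedRing A] {E : Type*} [NormedAddCommGroup E] [NormedSpace ℂ E]
    [CompleteSpace E] (c : CStarCorrespondence A E) (τ : A →L[ℂ] ℂ) (T : E → E) : ℝ≥0∞ :=
  ⨆ (H : Finset E) (_ : ∀ η, ∑ ξ ∈ H, c.ip η (c.rsmul ξ (c.ip ξ η)) ≤ c.ip η η),
    ∑ ξ ∈ H, ENNReal.ofReal (τ (c.ip ξ (T ξ))).re

/-- A product system over `P` of C*-correspondences over `A`. The product of `ξ ∈ X_p` and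
`ζ ∈ X_q` is written `mul h ξ ζ ∈ X_r` for any proof `h` of `p * q = r`. -/
structure ProductSystem (P : Type*) [Monoid P] (A : Type*) [NonUnitalCStarAlgebra A]
    [PartialOrder A] [StarOrderedRing A] where
  /-- the fibres -/
  X : P → Type*
  [normedAddCommGroup : ∀ p, NormedAddCommGroup (X p)]
  [normedSpace : ∀ p, NormedSpace ℂ (X p)]
  [completeSpace : ∀ p, CompleteSpace (X p)]
  /-- each fibre is a C*-correspondence over `A` -/
  corr : ∀ p, CStarCorrespondence A (X p)
  /-- the multiplication `X_p × X_q → X_{pq}` -/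
  mul : ∀ {p q r : P}, p * q = r → X p → X q → X r
  mul_assoc' : ∀ {p q s pq qs r : P} (h₁ : p * q = pq) (h₂ : pq * s = r) (h₃ : q * s = qs)
    (h₄ : p * qs = r) (ξ : X p) (ζ : X q) (η : X s),
    mul h₂ (mul h₁ ξ ζ) η = mul h₄ ξ (mul h₃ ζ η)
  /-- the multiplication preserves the inner product of `X_p ⊗_A X_q` … -/
  ip_mul : ∀ {p q r : P} (h : p * q = r) (ξ ξ' : X p) (ζ ζ' : X q),
    (corr r).ip (mul h ξ ζ) (mul h ξ' ζ') = (corr q).ip ζ ((corr q).lsmul ((corr p).ip ξ ξ') ζ')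
  /-- … and, for `p ≠ e`, has dense linear span, so that it extends to an isometric isomorphism
  of `X_p ⊗_A X_q` onto `X_{pq}` -/
  dense_mul : ∀ {p q r : P} (h : p * q = r), p ≠ 1 →
    Dense (Submodule.span ℂ {x : X r | ∃ ξ ζ, x = mul h ξ ζ} : Set (X r))
  /-- the identification of `A` with `X_e` -/
  unitEquiv : A ≃ₗᵢ[ℂ] X 1
  ip_unit : ∀ a b, (corr 1).ip (unitEquiv a) (unitEquiv b) = star a * b
  lsmul_unit : ∀ a b, (corr 1).lsmul a (unitEquiv b) = unitEquiv (a * b)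
  rsmul_unit : ∀ a b, (corr 1).rsmul (unitEquiv a) b = unitEquiv (a * b)
  unit_mul : ∀ (p : P) (a : A) (ξ : X p), mul (one_mul p) (unitEquiv a) ξ = (corr p).lsmul a ξ
  mul_unit : ∀ (p : P) (ξ : X p) (a : A), mul (mul_one p) ξ (unitEquiv a) = (corr p).rsmul ξ a

attribute [instance] ProductSystem.normedAddCommGroup ProductSystem.normedSpace
  ProductSystem.completeSpace

/-- A tracial state: a positive linear functional of norm one with `τ(ab) = τ(ba)`. -/
structure IsTracialState {A : Type*} [NonUnitalCStarAlgebra A] [PartialOrder A]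
    (τ : A →L[ℂ] ℂ) : Prop where
  nonneg : ∀ a, 0 ≤ a → 0 ≤ (τ a).re ∧ (τ a).im = 0
  norm_eq_one : ‖τ‖ = 1
  map_mul_comm : ∀ a b, τ (a * b) = τ (b * a)

namespace ProductSystem

variable {P : Type*} [Monoid P] {A : Type*} [NonUnitalCStarAlgebra A] [PartialOrder A]
  [StarOrderedRing A]

/-- `Tr_τ^p(a)`, for `a ∈ A_+` acting on `X_p` from the left. -/
noncomputable def tr (X : ProductSystem P A) (τ : A →L[ℂ] ℂ) (p : P) (a : A) : ℝ≥0∞ :=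
  (X.corr p).inducedTrace τ ((X.corr p).lsmul a)

/-- `Tr_τ^p` on `A_+` depends only on the class `pP*`. This is what makes `Tr_τ^{∨K}` independent
of the choice of the right LCM `∨K`; it is void if `P* = {e}`. -/
def TraceUnitInvariant (X : ProductSystem P A) (τ : A →L[ℂ] ℂ) : Prop :=
  ∀ (p u : P), IsUnit u → ∀ a, 0 ≤ a → X.tr τ (p * u) a = X.tr τ p a

open Classical in
/-- The summand `(-1)^{|K|} N(∨K)^{-β} Tr_τ^{∨K}(a)`, which is `0` if `∨K = ∞`. -/
noncomputable def summand (X : ProductSystem P A) (N : P →* ℝ) (β : ℝ) (τ : A →L[ℂ] ℂ)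
    (K : Finset P) (a : A) : EReal :=
  if h : ∃ r, IsRightLCM (K : Set P) r then
    (((-1) ^ K.card * N h.choose ^ (-β) : ℝ) : EReal) * (X.tr τ h.choose a : EReal)
  else 0

/-- The positivity condition for all finite subsets `J` of `R`:
`τ(a) + ∑_{∅ ≠ K ⊆ J} (-1)^{|K|} N(∨K)^{-β} Tr_τ^{∨K}(a) ≥ 0` for all `a ∈ A_+`. The sum is taken
in the extended reals; for `J = {p}` the condition says that `Tr_τ^p(a) ≤ N(p)^β τ(a)`. -/
def PositivityOn (X : ProductSystem P A) (N : P →* ℝ) (β : ℝ) (τ : A →L[ℂ] ℂ)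
    (R : Set P) : Prop :=
  ∀ J : Finset P, (J : Set P) ⊆ R → ∀ a : A, 0 ≤ a →
    0 ≤ ((τ a).re : EReal) + ∑ K ∈ J.powerset with K.Nonempty, X.summand N β τ K a

end ProductSystem

/-! ### Artin monoids -/

/-- The alternating word `s t s ⋯` of length `m`. -/
def alternatingFrom {B : Type*} (s t : B) : ℕ → List B
  | 0 => []
  | m + 1 => s :: alternatingFrom t s m

/-- The defining relations `⟨st⟩^{m_{st}} = ⟨ts⟩^{m_{ts}}` for `m_{st} ≠ ∞` (in Mathlib's Coxeter
matrices the entry `∞` is written `0`). -/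
def CoxeterMatrix.artinRel {B : Type*} (M : CoxeterMatrix B) (v w : FreeMonoid B) : Prop :=
  ∃ s t : B, M s t ≠ 0 ∧ v = FreeMonoid.ofList (alternatingFrom s t (M s t)) ∧
    w = FreeMonoid.ofList (alternatingFrom t s (M t s))

/-- The Artin monoid of a Coxeter matrix. -/
abbrev CoxeterMatrix.ArtinMonoid {B : Type*} (M : CoxeterMatrix B) : Type _ :=
  PresentedMonoid M.artinRel

/-- The canonical generators of the Artin monoid. -/
def CoxeterMatrix.artinGenerators {B : Type*} (M : CoxeterMatrix B) : Set M.ArtinMonoid :=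
  Set.range (PresentedMonoid.of M.artinRel)

/-! ### Trees of lists -/

section Trees

variable {P : Type*} [Monoid P] {n : ℕ}

/-! Finiteness of trees. Let `m` be a common right multiple of the finite entries of a list. Passing
to `λ₁` replaces one entry by a proper factor and keeps `m`; passing to `λ₂` leaves entries that
divide `p⁻¹m`, a proper factor of `m`. Hence splitting is well founded (`acc_isSplittingChild`).

Reduction to atoms. Write `S_Φ(l) = ∑ (-1)^|K| Φ(⋁K)` over `K ⊆ l`, with `Φ(r) = N(r)^{-β}
Tr_τ^r(a)`. Inserting `±S` at `p` gives `S_Φ(pq, L) = S_Φ(p, L) + S_{Φ(p·)}(q, L')`, where `L'`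
consists of the complements `p⁻¹(p ∨ x)`: these are the two children of the list. By the same
well-founded induction (`altSum_nonneg_of_atoms`) everything comes down to lists of atoms, provided
that nonnegativity of `S_Φ` for all `a` passes to `Φ(p·)`. This is `altSum_mul_left_nonneg`. It
rests on the formula that `Tr_τ^{pq}(a)` is a limit of sums `∑ Tr_τ^q(⟪ξ, aξ⟫)` over finite families
`ξ` in `X_p` with contractive Gram matrix: `sum_tr_ip_le_tr` bounds these sums above, and
`exists_le_sum_tr_ip` approximates finitely many such traces from below with one family. Positivity
on atoms also makes every induced trace finite (`traceBounded_of_irreducible`), so the extended real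
sums are real.

Artin monoids. It remains to see that `A_M^+` is a directed Noetherian right LCM monoid with trivial
units and atoms `S`. Word length gives the Noetherian property, units and atoms. For the rest, a
finite Coxeter group is shown to be a lattice in the weak order (strong exchange, dihedral cosets,
`exists_lub_of_covers`), and Matsumoto's theorem lifts it to the monoid. The complements `u⁻¹(u ∨
v)` then define a transducer on which the monoid acts (`residueHom`). Running it yields left
cancellation, common multiples, and LCMs of generators; `exists_lub_of_covers` extends the latter to
all pairs. -/

theorem exists_hasNontrivialFactorisation_of_not_isLeaf {l : ExtList P n} (h : ¬ IsLeaf l) :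
    ∃ i, HasNontrivialFactorisation (l i) := by
  by_contra! hc
  refine h ?_
  by_cases hu : ∃ (j : Fin n) (u : P), IsUnit u ∧ l j = (u : WithTop P)
  · exact Or.inr hu
  refine Or.inl fun j => ?_
  rcases hx : l j with _ | x
  · exact Or.inl rfl
  refine Or.inr ⟨x, ⟨fun hxu => hu ⟨j, x, hxu, hx⟩, fun {a b} hab => ?_⟩, rfl⟩
  by_contra! hn
  exact hc j ⟨a, b, hn.1, hn.2, by rw [hx, hab]; rfl⟩

theorem exists_isResidual (p : P) (x : WithTop P) : ∃ y, IsResidual p x y := by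
  by_cases h : ∃ x' m : P, x = (x' : WithTop P) ∧ IsRightLCM {p, x'} m
  · obtain ⟨x', m, rfl, hm⟩ := h
    obtain ⟨y', rfl⟩ := hm.1 p (by simp)
    exact ⟨y', Or.inl ⟨x', y', rfl, rfl, hm⟩⟩
  · exact ⟨⊤, Or.inr ⟨rfl, fun x' hx' ⟨m, hm⟩ => h ⟨x', m, hx', hm⟩⟩⟩

theorem exists_isSplitting {l : ExtList P n} (h : ¬ IsLeaf l) :
    ∃ l₁ l₂, IsSplitting l l₁ l₂ := by
  obtain ⟨i, hi, hmin⟩ := WellFounded.has_min (wellFounded_lt (α := Fin n))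
    {i | HasNontrivialFactorisation (l i)} (exists_hasNontrivialFactorisation_of_not_isLeaf h)
  obtain ⟨p, q, hp, hq, hpq⟩ := hi
  choose l₂ hl₂ using fun j => exists_isResidual p (l j)
  exact ⟨_, l₂, i, p, q, hp, hq, hpq, fun j hj hf => hmin j hf hj, rfl, hl₂⟩

theorem exists_isListTree (l : ExtList P n) : ∃ Λ, IsListTree l Λ := by
  classical
  choose f g hfg using fun (l : {l : ExtList P n // ¬ IsLeaf l}) => exists_isSplitting l.2
  let step : ExtList P n → Fin 2 → ExtList P n := fun l b =>
    if h : IsLeaf l then l else if b = 0 then f ⟨l, h⟩ else g ⟨l, h⟩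
  refine ⟨fun ω => ω.foldl step l, rfl, fun ω _ hω => ?_⟩
  simp only [List.foldl_append, List.foldl_cons, List.foldl_nil]
  simpa [step, hω] using hfg ⟨_, hω⟩

/-- `l'` is one of the two lists obtained by splitting `l`. -/
def IsSplittingChild (l' l : ExtList P n) : Prop :=
  ∃ l₁ l₂, IsSplitting l l₁ l₂ ∧ (l' = l₁ ∨ l' = l₂)

theorem IsProperFactor.of_mul_right {p q : P} (hp : ¬ IsUnit p) : IsProperFactor q (p * q) :=
  ⟨p, 1, by simp, Or.inl hp⟩

theorem IsProperFactor.of_mul_left {p q : P} (hq : ¬ IsUnit q) : IsProperFactor p (p * q) :=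
  ⟨1, q, by simp, Or.inr hq⟩

/-- The outer induction is on the common multiple `m`, which becomes `p⁻¹m` in the second child. The
inner one is lexicographic on the entries: the first child keeps `m` and decreases at the split
index. -/
theorem acc_isSplittingChild [IsLeftCancelMul P] (hN : IsFactorNoetherian P) (m : P)
    (l : ExtList P n) (hl : ∀ j (x : P), l j = (x : WithTop P) → x ∣ m) :
    Acc IsSplittingChild l := by
  let s : WithTop P → WithTop P → Prop := fun x y =>
    ∃ a b : P, x = (a : WithTop P) ∧ y = (b : WithTop P) ∧ IsProperFactor a b
  -- The relation `s` compares finite entries only, so `⊤` has no predecessor and never interferes.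
  have hs : WellFounded s := by
    have key : ∀ a : P, Acc s (a : WithTop P) := fun a => by
      induction a using hN.induction with
      | _ a ih =>
        refine ⟨_, ?_⟩
        rintro _ ⟨x, y, rfl, hy, hxy⟩
        obtain rfl := WithTop.coe_injective hy
        exact ih x hxy
    refine ⟨fun x => ?_⟩
    rcases x with _ | x
    · refine ⟨_, ?_⟩
      rintro _ ⟨x, y, rfl, hy, hxy⟩
      cases hy
    · exact key x
  induction m using hN.induction generalizing l with
  | _ m ihm =>
    have hlex : WellFounded (Pi.Lex (ι := Fin n) (β := fun _ => WithTop P) (· < ·)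
        (fun {_} => s)) := Pi.Lex.wellFounded _ (fun _ => hs)
    induction l using hlex.induction with
    | _ l ihl =>
      refine ⟨_, ?_⟩
      rintro l' ⟨l₁, l₂, ⟨i, p, q, hp, hq, hpq, -, rfl, hres⟩, rfl | rfl⟩
      · refine ihl _ ⟨i, fun j hj => ?_, ?_⟩ fun j x hx => ?_
        · simp [Function.update_of_ne hj.ne]
        · rw [hpq]
          simpa using ⟨p, p * q, rfl, rfl, .of_mul_left hq⟩
        · by_cases hj : j = i
          · subst hj
            rw [Function.update_self] at hx
            obtain rfl := WithTop.coe_injective hx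
            exact (Dvd.intro q rfl).trans (hl j _ hpq)
          · rw [Function.update_of_ne hj] at hx
            exact hl j x hx
      · obtain ⟨m', rfl⟩ : p ∣ m := (Dvd.intro q rfl).trans (hl i _ hpq)
        refine ihm m' (.of_mul_right hp) _ fun j y hy => ?_
        rcases hres j with ⟨x', y', hx', hy', hlcm⟩ | ⟨hy', -⟩
        · rw [hy] at hy'
          obtain rfl := WithTop.coe_injective hy'
          obtain ⟨c, hc⟩ := hlcm.2 (p * m') (by
            rintro z (rfl | rfl)
            · exact Dvd.intro _ rfl
            · exact hl j _ hx')
          exact ⟨c, mul_left_cancel (a := p) (by rw [hc, mul_assoc])⟩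
        · rw [hy] at hy'
          cases hy'

/-- The part of a tree below either child of the root is again a tree, with fewer splittings left.
The nodes are the root and the nodes of these two subtrees. -/
theorem treeNodes_finite_of_acc {l : ExtList P n} (hl : Acc IsSplittingChild l)
    (Λ : List (Fin 2) → ExtList P n) (hΛ : IsListTree l Λ) : (treeNodes Λ).Finite := by
  induction hl generalizing Λ with
  | intro l _ ih =>
    by_cases hleaf : IsLeaf l
    · refine (Set.finite_singleton ([] : List (Fin 2))).subset fun ω hω => ?_
      by_contra hne
      exact hω [] List.nil_prefix (fun h => hne h.symm) (by rwa [hΛ.1])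
    have hroot : [] ∈ treeNodes Λ := fun ω' h hne => (hne (List.prefix_nil.mp h)).elim
    have hsplit := hΛ.2 [] hroot (by rwa [hΛ.1])
    rw [hΛ.1] at hsplit
    have hsub : ∀ b : Fin 2, IsListTree (Λ [b]) (fun ω => Λ (b :: ω)) := by
      refine fun b => ⟨rfl, fun ω hω hnl => ?_⟩
      refine hΛ.2 (b :: ω) (fun ω' hpre hne => ?_) hnl
      rcases ω' with _ | ⟨c, ω'⟩
      · rwa [hΛ.1]
      · obtain ⟨rfl, hpre'⟩ := List.cons_prefix_cons.mp hpre
        exact hω ω' hpre' (fun h => hne (by rw [h]))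
    have hfin : ∀ b : Fin 2, (treeNodes (fun ω => Λ (b :: ω))).Finite := by
      refine fun b => ih (Λ [b]) ⟨_, _, hsplit, ?_⟩ _ (hsub b)
      fin_cases b
      · exact Or.inl rfl
      · exact Or.inr rfl
    refine ((Set.finite_singleton ([] : List (Fin 2))).union
      (Set.finite_iUnion fun b => (hfin b).image (List.cons b))).subset fun ω hω => ?_
    rcases ω with _ | ⟨b, ω⟩
    · exact Or.inl rfl
    · refine Or.inr (Set.mem_iUnion.mpr ⟨b, ω, fun ω' hpre hne => ?_, rfl⟩)
      exact hω (b :: ω') (List.cons_prefix_cons.mpr ⟨rfl, hpre⟩) (fun h => hne (by simpa using h))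

theorem IsRightDirected.exists_dvd_of_finset (hD : IsRightDirected P) {ι : Type*}
    (s : Finset ι) (f : ι → P) : ∃ m, ∀ i ∈ s, f i ∣ m := by
  classical
  induction s using Finset.induction_on with
  | empty => exact ⟨1, by simp⟩
  | insert i s _ ih =>
    obtain ⟨m, hm⟩ := ih
    obtain ⟨z, hz₁, hz₂⟩ := hD (f i) m
    refine ⟨z, fun j hj => ?_⟩
    rcases Finset.mem_insert.mp hj with rfl | hj
    · exact hz₁
    · exact (hm j hj).trans hz₂

theorem treeNodes_finite [IsLeftCancelMul P] (hN : IsFactorNoetherian P) (hD : IsRightDirected P)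
    (l : ExtList P n) (Λ : List (Fin 2) → ExtList P n) (hΛ : IsListTree l Λ) :
    (treeNodes Λ).Finite := by
  -- Infinite entries get the default value `1`, which constrains nothing.
  obtain ⟨m, hm⟩ := hD.exists_dvd_of_finset Finset.univ (fun j => (l j).untopD 1)
  refine treeNodes_finite_of_acc (acc_isSplittingChild hN m l fun j x hx => ?_) Λ hΛ
  simpa [hx] using hm j (Finset.mem_univ j)

end Trees


/-! ### Alternating sums over right least common multiples -/

section AltSum

variable {P : Type*} [Monoid P]

theorem IsRightLCM.pair_dvd_iff {x y r z : P} (h : IsRightLCM {x, y} r) :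
    r ∣ z ↔ x ∣ z ∧ y ∣ z := by
  refine ⟨fun hz => ⟨(h.1 x (by simp)).trans hz, (h.1 y (by simp)).trans hz⟩, fun hz => ?_⟩
  refine h.2 z ?_
  rintro w (rfl | rfl)
  exacts [hz.1, hz.2]

/-- The elements `x` and `y` left-divide each other. -/
def LeftAssociated (x y : P) : Prop := x ∣ y ∧ y ∣ x

theorem leftAssociated_of_dvd_iff {x y : P} (h : ∀ z, x ∣ z ↔ y ∣ z) : LeftAssociated x y :=
  ⟨(h y).mpr dvd_rfl, (h x).mp dvd_rfl⟩

theorem LeftAssociated.dvd_iff {x y : P} (h : LeftAssociated x y) (z : P) : x ∣ z ↔ y ∣ z :=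
  ⟨h.2.trans, h.1.trans⟩

theorem LeftAssociated.exists_isUnit [IsLeftCancelMul P] {x y : P} (h : LeftAssociated x y) :
    ∃ u, IsUnit u ∧ y = x * u := by
  obtain ⟨⟨u, hu⟩, ⟨v, hv⟩⟩ := h
  have h₁ : u * v = 1 := mul_left_cancel (a := x) (by rw [← mul_assoc, ← hu, ← hv, mul_one])
  have h₂ : v * u = 1 := mul_left_cancel (a := y) (by rw [← mul_assoc, ← hv, ← hu, mul_one])
  exact ⟨u, ⟨⟨u, v, h₁, h₂⟩, rfl⟩, hu⟩

/-- The alternating sum `∑_K (-1)^|K| Φ(r ∨ ⋁ K)` over the sublists `K` of `l`. -/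
def altSum (j : P → P → P) (Φ : P → ℝ) : List P → P → ℝ
  | [], r => Φ r
  | x :: l, r => altSum j Φ l r - altSum j Φ l (j x r)

variable {j : P → P → P} {Φ : P → ℝ}

theorem altSum_congr (hj : ∀ x y, IsRightLCM {x, y} (j x y))
    (hΦ : ∀ x y, LeftAssociated x y → Φ x = Φ y) (l : List P) {r r' : P}
    (h : LeftAssociated r r') : altSum j Φ l r = altSum j Φ l r' := by
  induction l generalizing r r' with
  | nil => exact hΦ _ _ h
  | cons x l ih =>
    rw [altSum, altSum, ih h, ih (r := j x r) (r' := j x r')]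
    exact leftAssociated_of_dvd_iff fun z => by
      rw [(hj x r).pair_dvd_iff, (hj x r').pair_dvd_iff, h.dvd_iff]

/-- If `x ∣ r`, adding `x` to `K` or removing it does not change `r ∨ ⋁K` but flips the sign, so the
terms cancel in pairs. -/
theorem altSum_eq_zero (hj : ∀ x y, IsRightLCM {x, y} (j x y))
    (hΦ : ∀ x y, LeftAssociated x y → Φ x = Φ y) {l : List P} {x r : P} (hx : x ∈ l)
    (hxr : x ∣ r) : altSum j Φ l r = 0 := by
  induction l generalizing r with
  | nil => simp at hx
  | cons y l ih =>
    rcases List.mem_cons.mp hx with rfl | hx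
    · rw [altSum, sub_eq_zero]
      exact altSum_congr hj hΦ l (leftAssociated_of_dvd_iff fun z => by
        rw [(hj x r).pair_dvd_iff]
        exact ⟨fun h => ⟨hxr.trans h, h⟩, fun h => h.2⟩)
    · rw [altSum, ih hx hxr, ih hx (hxr.trans ((hj y r).1 r (by simp))), sub_zero]

theorem altSum_perm (hj : ∀ x y, IsRightLCM {x, y} (j x y))
    (hΦ : ∀ x y, LeftAssociated x y → Φ x = Φ y) {l l' : List P} (h : l.Perm l') (r : P) :
    altSum j Φ l r = altSum j Φ l' r := by
  induction h generalizing r with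
  | nil => rfl
  | cons x _ ih => rw [altSum, altSum, ih, ih]
  | swap x y l =>
    simp only [altSum]
    rw [altSum_congr hj hΦ l (r := j x (j y r)) (r' := j y (j x r))]
    · ring
    · exact leftAssociated_of_dvd_iff fun z => by
        simp only [(hj _ _).pair_dvd_iff]
        tauto
  | trans _ _ ih₁ ih₂ => rw [ih₁, ih₂]

theorem dvd_of_mul_dvd_mul_left' [IsLeftCancelMul P] {p x y : P} (h : p * x ∣ p * y) : x ∣ y := by
  obtain ⟨c, hc⟩ := h
  exact ⟨c, mul_left_cancel (a := p) (by rw [hc, mul_assoc])⟩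

/-- By left cancellation `x ∨ pr = p(x' ∨ r)` whenever `p ∨ x = px'`, so the factor `p` can be
pulled out of every join. -/
theorem altSum_mul_left [IsLeftCancelMul P] (hj : ∀ x y, IsRightLCM {x, y} (j x y))
    (hΦ : ∀ x y, LeftAssociated x y → Φ x = Φ y) (p : P) {l l' : List P}
    (h : List.Forall₂ (fun x x' => IsRightLCM {p, x} (p * x')) l l') (r : P) :
    altSum j Φ l (p * r) = altSum j (fun s => Φ (p * s)) l' r := by
  induction h generalizing r with
  | nil => rfl
  | @cons x x' l l' hx _ ih =>
    rw [altSum, altSum, ih r, ← ih (j x' r)]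
    congr 1
    refine altSum_congr hj hΦ l (leftAssociated_of_dvd_iff fun z => ?_)
    rw [(hj _ _).pair_dvd_iff]
    constructor
    · rintro ⟨hxz, hprz⟩
      obtain ⟨w, rfl⟩ : p ∣ z := (Dvd.intro r rfl).trans hprz
      refine mul_dvd_mul_left p ((hj _ _).pair_dvd_iff.mpr ⟨?_, dvd_of_mul_dvd_mul_left' hprz⟩)
      exact dvd_of_mul_dvd_mul_left' (hx.pair_dvd_iff.mpr ⟨Dvd.intro _ rfl, hxz⟩)
    · intro hz
      exact ⟨((hx.pair_dvd_iff.mp (mul_dvd_mul_left p ((hj x' r).1 x' (by simp)))).2).trans hz,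
        (mul_dvd_mul_left p ((hj x' r).1 r (by simp))).trans hz⟩

-- Repetitions in the list are harmless: a second occurrence of `x` only subtracts a sum that
-- vanishes by `altSum_eq_zero`.
open Classical in
theorem altSum_eq_sum_powerset (hj : ∀ x y, IsRightLCM {x, y} (j x y))
    (hΦ : ∀ x y, LeftAssociated x y → Φ x = Φ y) (l : List P) (r : P) (g : Finset P → P)
    (hg : ∀ K ⊆ l.toFinset, IsRightLCM (insert r (K : Set P)) (g K)) :
    altSum j Φ l r = ∑ K ∈ l.toFinset.powerset, (-1) ^ K.card * Φ (g K) := by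
  induction l generalizing r g with
  | nil =>
    simp only [List.toFinset_nil, Finset.powerset_empty, Finset.sum_singleton, altSum,
      Finset.card_empty, pow_zero, one_mul]
    have h := hg ∅ (by simp)
    refine hΦ _ _ ⟨h.1 r (by simp), h.2 r (by simp)⟩
  | cons x l ih =>
    by_cases hx : x ∈ l
    · rw [altSum, altSum_eq_zero hj hΦ hx ((hj x r).1 x (by simp)), sub_zero]
      have hl : (x :: l).toFinset = l.toFinset := by simp [hx]
      rw [hl] at hg ⊢
      exact ih r g hg
    · rw [altSum, ih r g fun K hK => hg K (hK.trans (by simp)),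
        ih (j x r) (fun K => g (insert x K)) fun K hK => ?_, List.toFinset_cons,
        Finset.sum_powerset_insert (by simpa using hx), sub_eq_add_neg, ← Finset.sum_neg_distrib]
      · congr 1
        refine Finset.sum_congr rfl fun K hK => ?_
        have hxK : x ∉ K := fun h => hx (by simpa using Finset.mem_powerset.mp hK h)
        rw [Finset.card_insert_of_notMem hxK]
        ring
      · have h := hg (insert x K) (by
          rw [List.toFinset_cons]; exact Finset.insert_subset_insert x hK)
        refine ⟨fun p hp => ?_, fun z hz => h.2 z fun p hp => ?_⟩
        · rcases hp with rfl | hp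
          · exact (hj x r).pair_dvd_iff.mpr ⟨h.1 x (by simp), h.1 r (by simp)⟩
          · exact h.1 p (by simp [Finset.mem_coe.mp hp])
        · have h₀ := (hj x r).pair_dvd_iff.mp (hz _ (Set.mem_insert _ _))
          simp only [Finset.coe_insert, Set.mem_insert_iff] at hp
          rcases hp with rfl | rfl | hp
          exacts [h₀.2, h₀.1, hz p (Set.mem_insert_of_mem _ hp)]

open Classical in
/-- Reduction of nonnegativity of the alternating sums to lists of atoms. -/
theorem altSum_nonneg_of_atoms [IsLeftCancelMul P] {𝒜 : Type*} {Φ : P → 𝒜 → ℝ}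
    (hN : IsFactorNoetherian P) (hD : IsRightDirected P)
    (hj : ∀ x y, IsRightLCM {x, y} (j x y))
    (hΦ : ∀ x y, LeftAssociated x y → Φ x = Φ y)
    (hshift : ∀ p : P, ¬ IsUnit p → ∀ l : List P, (∀ a, 0 ≤ altSum j (Φ · a) l 1) →
      ∀ a, 0 ≤ altSum j (fun r => Φ (p * r) a) l 1)
    (hatoms : ∀ l : List P, (∀ x ∈ l, Irreducible x) → ∀ a, 0 ≤ altSum j (Φ · a) l 1)
    (l : List P) (a : 𝒜) : 0 ≤ altSum j (Φ · a) l 1 := by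
  have hΦ' : ∀ a x y, LeftAssociated x y → Φ x a = Φ y a := fun a x y h => by rw [hΦ x y h]
  have key : ∀ m : P, ∀ l : List P, (∀ x ∈ l, x ∣ m) → ∀ a, 0 ≤ altSum j (Φ · a) l 1 := by
    intro m
    induction m using hN.induction with
    | _ m ihm =>
      -- The list `l₀` collects the entries already known to be atoms. For fixed `m` the induction
      -- is on the remaining list `l`, then on its head `x`; an atom is moved to `l₀`, and an
      -- invertible head makes the sum vanish.
      have main : ∀ l l₀ : List P, (∀ x ∈ l, x ∣ m) → (∀ x ∈ l₀, x ∣ m) →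
          (∀ x ∈ l₀, Irreducible x) → ∀ a, 0 ≤ altSum j (Φ · a) (l ++ l₀) 1 := by
        intro l
        induction l with
        | nil => exact fun l₀ _ _ h a => hatoms l₀ h a
        | cons x l ihl =>
          intro l₀ hl hl₀ hat a
          induction x using hN.induction generalizing a with
          | _ x ihx =>
            have hxm := hl x (by simp)
            have hlm : ∀ y ∈ l, y ∣ m := fun y hy => hl y (by simp [hy])
            by_cases hu : IsUnit x
            · rw [altSum_eq_zero hj (hΦ' a) (x := x) (by simp)
                (by obtain ⟨u, rfl⟩ := hu; exact ⟨↑u⁻¹, by simp⟩)]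
            by_cases hirr : Irreducible x
            · rw [List.cons_append, altSum_perm hj (hΦ' a) (l' := l ++ x :: l₀)
                List.perm_middle.symm]
              refine ihl (x :: l₀) hlm ?_ ?_ a
              · simpa using ⟨hxm, hl₀⟩
              · simpa using ⟨hirr, hat⟩
            obtain ⟨p, q, hp, hq, rfl⟩ : ∃ p q, ¬ IsUnit p ∧ ¬ IsUnit q ∧ x = p * q := by
              by_contra! hc
              exact hirr ⟨hu, fun {b c} h => by by_contra! h'; exact hc b c h'.1 h'.2 h⟩
            have hpm : p ∣ m := (Dvd.intro q rfl).trans hxm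
            obtain ⟨l', hl'⟩ : ∃ l', List.Forall₂ (fun x x' => IsRightLCM {p, x} (p * x'))
                (l ++ l₀) l' := by
              generalize l ++ l₀ = L
              induction L with
              | nil => exact ⟨[], .nil⟩
              | cons y L ih =>
                obtain ⟨L', hL'⟩ := ih
                obtain ⟨c, hc⟩ := (hj p y).1 p (by simp)
                exact ⟨c :: L', .cons (hc ▸ hj p y) hL'⟩
            obtain ⟨m', rfl⟩ := hpm
            have h₁ := ihx p (.of_mul_left hq) (fun y hy => by
              rcases List.mem_cons.mp hy with rfl | hy
              exacts [Dvd.intro _ rfl, hlm y hy]) a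
            have h₂ : 0 ≤ altSum j (fun r => Φ (p * r) a) (q :: l') 1 := by
              refine hshift p hp _ (ihm m' (.of_mul_right hp) _ fun y hy => ?_) a
              rcases List.mem_cons.mp hy with rfl | hy
              · exact dvd_of_mul_dvd_mul_left' hxm
              · have hL : ∀ z ∈ l ++ l₀, z ∣ p * m' := fun z hz => by
                  rcases List.mem_append.mp hz with hz | hz
                  exacts [hlm z hz, hl₀ z hz]
                obtain ⟨i, hi, rfl⟩ := List.mem_iff_getElem.mp hy
                have hi' : i < (l ++ l₀).length := by rwa [hl'.length_eq]
                have := (List.forall₂_iff_get.mp hl').2 i hi' hi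
                exact dvd_of_mul_dvd_mul_left' (this.pair_dvd_iff.mpr
                  ⟨Dvd.intro _ rfl, hL _ (List.getElem_mem hi')⟩)
            -- With `L = l ++ l₀`, the sum for `pq :: L` is `(S_L(1) - S_L(p)) + (S_L(p) -
            -- S_L(pq))`. The first bracket is `h₁`; `e₁` and `e₂` identify the second with `h₂`.
            have e₁ := altSum_mul_left hj (hΦ' a) p hl' 1
            have e₂ := altSum_mul_left hj (hΦ' a) p hl' q
            have e₃ : ∀ y, altSum j (Φ · a) (l ++ l₀) (j y 1) = altSum j (Φ · a) (l ++ l₀) y :=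
              fun y => altSum_congr hj (hΦ' a) _ (leftAssociated_of_dvd_iff fun z => by
                simp [(hj y 1).pair_dvd_iff])
            have e₄ : altSum j (fun r => Φ (p * r) a) l' (j q 1)
                = altSum j (fun r => Φ (p * r) a) l' q := by
              refine altSum_congr hj (fun x y h => hΦ' a _ _
                ⟨mul_dvd_mul_left p h.1, mul_dvd_mul_left p h.2⟩) _
                (leftAssociated_of_dvd_iff fun z => by simp [(hj q 1).pair_dvd_iff])
            simp only [List.cons_append, altSum, e₃] at h₁ ⊢
            rw [altSum, e₄] at h₂
            rw [mul_one] at e₁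
            linarith
      exact fun l hl a => by simpa using main l [] hl (by simp) (by simp) a
  obtain ⟨m, hm⟩ := hD.exists_dvd_of_finset l.toFinset.attach (fun x => x.1)
  exact key m l (fun x hx => hm ⟨x, by simpa using hx⟩ (Finset.mem_attach _ _)) a

end AltSum


/-! ### Hilbert modules and C*-correspondences -/

/-- A form of `1 - h = (1 - k)²` that avoids the unit: `k = 1 - √(1 - h)` vanishes at `0`, so it
lies in the non-unital functional calculus. -/
theorem exists_isSelfAdjoint_two_mul_sub_sq {A : Type*} [NonUnitalCStarAlgebra A] {h : A}
    (h₀ : IsSelfAdjoint h) (h₁ : ‖h‖ ≤ 1) :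
    ∃ k : A, IsSelfAdjoint k ∧ k + k - k * k = h := by
  let f : ℝ → ℝ := fun t => 1 - √(1 - t)
  have hf : Continuous f := by fun_prop
  have hf0 : f 0 = 0 := by simp [f]
  refine ⟨cfcₙ f h, cfcₙ_predicate f h, ?_⟩
  rw [← cfcₙ_add f f h hf.continuousOn hf0 hf.continuousOn hf0,
    ← cfcₙ_mul f f h hf.continuousOn hf0 hf.continuousOn hf0,
    ← cfcₙ_sub _ _ h (by fun_prop) (by simp [hf0]) (by fun_prop) (by simp [hf0])]
  conv_rhs => rw [← cfcₙ_id' ℝ h]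
  refine cfcₙ_congr fun t ht => ?_
  have ht1 : ‖t‖ ≤ ‖h‖ :=
    (NonUnitalIsometricContinuousFunctionalCalculus.isGreatest_norm_quasispectrum h h₀).2
      ⟨t, ht, rfl⟩
  have ht2 : t ≤ 1 := (le_abs_self t).trans (ht1.trans h₁)
  have := Real.mul_self_sqrt (sub_nonneg.mpr ht2)
  simp only [f]
  linarith

namespace CStarCorrespondence

variable {A : Type*} [NonUnitalCStarAlgebra A] [PartialOrder A] [StarOrderedRing A]
  {E : Type*} [NormedAddCommGroup E] [NormedSpace ℂ E] [CompleteSpace E]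
  (c : CStarCorrespondence A E)

/-- The inner product as an additive map in the second variable. -/
def ipHom (x : E) : E →+ A := AddMonoidHom.mk' (c.ip x) (c.ip_add x)

theorem ip_zero_right (x : E) : c.ip x 0 = 0 := (c.ipHom x).map_zero

theorem ip_sub_right (x y z : E) : c.ip x (y - z) = c.ip x y - c.ip x z := (c.ipHom x).map_sub y z

theorem ip_sum_right {ι : Type*} (s : Finset ι) (x : E) (f : ι → E) :
    c.ip x (∑ i ∈ s, f i) = ∑ i ∈ s, c.ip x (f i) := map_sum (c.ipHom x) f s

theorem ip_add_left (x y z : E) : c.ip (x + y) z = c.ip x z + c.ip y z := by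
  rw [← c.star_ip, c.ip_add, star_add, c.star_ip, c.star_ip]

theorem ip_sub_left (x y z : E) : c.ip (x - y) z = c.ip x z - c.ip y z := by
  rw [← c.star_ip, c.ip_sub_right, star_sub, c.star_ip, c.star_ip]

theorem ip_zero_left (x : E) : c.ip 0 x = 0 := by
  rw [← c.star_ip, c.ip_zero_right, star_zero]

theorem ip_sum_left {ι : Type*} (s : Finset ι) (x : E) (f : ι → E) :
    c.ip (∑ i ∈ s, f i) x = ∑ i ∈ s, c.ip (f i) x := by
  rw [← c.star_ip, c.ip_sum_right, star_sum]
  simp only [c.star_ip]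

theorem ip_smul_left (z : ℂ) (x y : E) : c.ip (z • x) y = star z • c.ip x y := by
  rw [← c.star_ip, c.ip_smul, star_smul, c.star_ip]

theorem ip_rsmul_left (x y : E) (a : A) : c.ip (c.rsmul x a) y = star a * c.ip x y := by
  rw [← c.star_ip, c.ip_rsmul, star_mul, c.star_ip]

theorem ip_lsmul_right (x y : E) (a : A) : c.ip x (c.lsmul a y) = c.ip (c.lsmul (star a) x) y := by
  rw [c.ip_lsmul, star_star]

theorem eq_zero_of_ip_self {x : E} (h : c.ip x x = 0) : x = 0 := by
  have := c.norm_sq x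
  rw [h, norm_zero] at this
  exact norm_eq_zero.mp (pow_eq_zero_iff two_ne_zero |>.mp this)

theorem ext_ip {x y : E} (h : ∀ z, c.ip z x = c.ip z y) : x = y := by
  rw [← sub_eq_zero]
  exact c.eq_zero_of_ip_self (by rw [c.ip_sub_right, h, sub_self])

theorem lsmul_smul (a : A) (z : ℂ) (x : E) : c.lsmul a (z • x) = z • c.lsmul a x :=
  c.ext_ip fun y => by simp only [c.ip_smul, c.ip_lsmul_right]

theorem sub_lsmul (a b : A) (x : E) : c.lsmul (a - b) x = c.lsmul a x - c.lsmul b x :=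
  (AddMonoidHom.mk' (fun a => c.lsmul a x) (fun a b => c.add_lsmul a b x)).map_sub a b

theorem sum_lsmul {ι : Type*} (s : Finset ι) (f : ι → A) (x : E) :
    c.lsmul (∑ i ∈ s, f i) x = ∑ i ∈ s, c.lsmul (f i) x :=
  map_sum (AddMonoidHom.mk' (fun a => c.lsmul a x) (fun a b => c.add_lsmul a b x)) f s

theorem rsmul_sum {ι : Type*} (s : Finset ι) (x : E) (f : ι → A) :
    c.rsmul x (∑ i ∈ s, f i) = ∑ i ∈ s, c.rsmul x (f i) :=
  map_sum (AddMonoidHom.mk' (c.rsmul x) (c.rsmul_add x)) f s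

theorem sum_rsmul {ι : Type*} (s : Finset ι) (f : ι → E) (a : A) :
    c.rsmul (∑ i ∈ s, f i) a = ∑ i ∈ s, c.rsmul (f i) a :=
  map_sum (AddMonoidHom.mk' (fun x => c.rsmul x a) (fun x y => c.add_rsmul x y a)) f s

/-- The Cauchy–Schwarz inequality, from expanding `⟪x - ya, x - ya⟫ ≥ 0` at `a = ⟪y, x⟫`. -/
theorem star_ip_mul_ip_le {x y : E} (hy : ‖y‖ ≤ 1) :
    star (c.ip y x) * c.ip y x ≤ c.ip x x := by
  set a := c.ip y x with ha
  have h₀ : 0 ≤ c.ip (x - c.rsmul y a) (x - c.rsmul y a) := c.ip_self_nonneg _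
  have h₁ : c.ip (x - c.rsmul y a) (x - c.rsmul y a)
      = c.ip x x - star a * a - star a * a + star a * c.ip y y * a := by
    simp only [c.ip_sub_left, c.ip_sub_right, c.ip_rsmul, c.ip_rsmul_left, ← ha]
    rw [← c.star_ip y x, ← ha]
    noncomm_ring
  have h₂ : star a * c.ip y y * a ≤ star a * a := by
    have hsa : IsSelfAdjoint (c.ip y y) := (c.star_ip y y)
    refine (CStarAlgebra.star_left_conjugate_le_norm_smul hsa).trans ?_
    have : ‖c.ip y y‖ ≤ 1 := by rw [← c.norm_sq]; exact pow_le_one₀ (norm_nonneg _) hy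
    simpa using smul_le_smul_of_nonneg_right this (star_mul_self_nonneg a)
  rw [h₁] at h₀
  have h₃ : c.ip x x - star a * a - star a * a + star a * c.ip y y * a ≤
      c.ip x x - star a * a := by
    calc _ ≤ c.ip x x - star a * a - star a * a + star a * a := by gcongr
      _ = _ := by abel
  exact sub_nonneg.mp (h₀.trans h₃)

theorem norm_ip_le (y x : E) : ‖c.ip y x‖ ≤ ‖y‖ * ‖x‖ := by
  rcases eq_or_ne y 0 with rfl | hy
  · simp [c.ip_zero_left]
  have hy' : 0 < ‖y‖ := norm_pos_iff.mpr hy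
  have key : ∀ y : E, ‖y‖ ≤ 1 → ‖c.ip y x‖ ≤ ‖x‖ := fun y hy => by
    have h := CStarAlgebra.norm_le_norm_of_nonneg_of_le (star_mul_self_nonneg _)
      (c.star_ip_mul_ip_le (x := x) hy)
    rw [CStarRing.norm_star_mul_self, ← c.norm_sq] at h
    nlinarith [norm_nonneg (c.ip y x), norm_nonneg x]
  have h := key (((‖y‖⁻¹ : ℝ) : ℂ) • y) (by
    rw [norm_smul]; simp [hy'.ne'])
  rw [c.ip_smul_left, norm_smul] at h
  simp only [norm_star, Complex.norm_real, norm_inv, norm_norm] at h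
  rwa [inv_mul_le_iff₀ hy'] at h

/-- Writing `1 - a*a = (1 - k)²` gives `⟪x, x⟫ - ⟪ax, ax⟫ = ⟪x - kx, x - kx⟫ ≥ 0`. -/
theorem norm_lsmul_le_of_le_one {a : A} (ha : ‖a‖ ≤ 1) (x : E) : ‖c.lsmul a x‖ ≤ ‖x‖ := by
  obtain ⟨k, hk, hka⟩ := exists_isSelfAdjoint_two_mul_sub_sq (h := star a * a)
    (IsSelfAdjoint.star_mul_self a) (by rw [CStarRing.norm_star_mul_self]; nlinarith [norm_nonneg a])
  have h₁ : c.ip (x - c.lsmul k x) (x - c.lsmul k x)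
      = c.ip x x - c.ip (c.lsmul a x) (c.lsmul a x) := by
    rw [c.ip_lsmul a, ← c.mul_lsmul, ← hka]
    simp only [c.ip_sub_left, c.ip_sub_right, c.sub_lsmul, c.add_lsmul, c.ip_add, c.mul_lsmul]
    rw [c.ip_lsmul, c.ip_lsmul, hk.star_eq]
    abel
  have h₂ : c.ip (c.lsmul a x) (c.lsmul a x) ≤ c.ip x x :=
    sub_nonneg.mp (h₁ ▸ c.ip_self_nonneg _)
  have h₃ := CStarAlgebra.norm_le_norm_of_nonneg_of_le (c.ip_self_nonneg _) h₂
  rw [← c.norm_sq, ← c.norm_sq] at h₃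
  exact (pow_le_pow_iff_left₀ (norm_nonneg _) (norm_nonneg _) two_ne_zero).mp h₃

theorem norm_lsmul_le (a : A) (x : E) : ‖c.lsmul a x‖ ≤ ‖a‖ * ‖x‖ := by
  rcases eq_or_ne a 0 with rfl | ha
  · have : c.lsmul 0 x = 0 := by simpa using c.sub_lsmul 0 0 x
    simp [this]
  have ha' : 0 < ‖a‖ := norm_pos_iff.mpr ha
  have h := c.norm_lsmul_le_of_le_one (a := ((‖a‖⁻¹ : ℝ) : ℂ) • a)
    (by rw [norm_smul]; simp [ha'.ne']) x
  rw [c.smul_lsmul, norm_smul] at h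
  simp only [Complex.norm_real, norm_inv, norm_norm] at h
  rwa [inv_mul_le_iff₀ ha'] at h

/-- The C*-algebra `A` as a correspondence over itself. -/
def self (A : Type*) [NonUnitalCStarAlgebra A] [PartialOrder A] [StarOrderedRing A] :
    CStarCorrespondence A A where
  ip x y := star x * y
  rsmul x a := x * a
  lsmul a x := a * x
  add_rsmul := add_mul
  rsmul_add := mul_add
  rsmul_mul x a b := (mul_assoc x a b).symm
  smul_rsmul := smul_mul_assoc
  rsmul_smul c x a := mul_smul_comm c x a
  ip_add x := mul_add (star x)
  ip_smul c x y := mul_smul_comm c (star x) y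
  ip_rsmul x y a := (mul_assoc (star x) y a).symm
  star_ip x y := by simp
  ip_self_nonneg := star_mul_self_nonneg
  norm_sq x := by rw [CStarRing.norm_star_mul_self, sq]
  add_lsmul := add_mul
  smul_lsmul := smul_mul_assoc
  mul_lsmul := mul_assoc
  ip_lsmul a x y := by simp [mul_assoc]

/-! #### Families of vectors with contractive Gram matrix -/

/-- The Gram matrix `G` of the family is at most `1`, in the form `1 - G = (1 - K)²`. -/
def IsContractiveFamily {n : ℕ} (ξ : Fin n → E) : Prop :=
  ∃ K : CStarMatrix (Fin n) (Fin n) A, IsSelfAdjoint K ∧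
    ∀ i j, c.ip (ξ i) (ξ j) = K i j + K i j - (K * K) i j

/-- With `w = Kv` the difference of the two sides is `∑ ⟪v i - w i, v i - w i⟫`, because `1 - (2K -
K²) = (1 - K)²`. -/
theorem sum_ip_lsmul_le {n : ℕ} {K : CStarMatrix (Fin n) (Fin n) A} (hK : IsSelfAdjoint K)
    (v : Fin n → E) :
    ∑ i, ∑ j, c.ip (v i) (c.lsmul (K i j + K i j - (K * K) i j) (v j)) ≤ ∑ i, c.ip (v i) (v i) := by
  let w : Fin n → E := fun i => ∑ j, c.lsmul (K i j) (v j)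
  have h₀ : 0 ≤ ∑ i, c.ip (v i - w i) (v i - w i) :=
    Finset.sum_nonneg fun i _ => c.ip_self_nonneg _
  have hKs : ∀ i j, star (K i j) = K j i := fun i j => CStarMatrix.star_apply_of_isSelfAdjoint hK
  have h₁ : ∑ i, c.ip (w i) (v i) = ∑ i, c.ip (v i) (w i) := by
    simp only [w, c.ip_sum_left, c.ip_sum_right]
    rw [Finset.sum_comm]
    refine Finset.sum_congr rfl fun i _ => Finset.sum_congr rfl fun j _ => ?_
    rw [c.ip_lsmul, hKs]
  have h₂ : ∑ i, c.ip (w i) (w i) = ∑ i, ∑ j, c.ip (v i) (c.lsmul ((K * K) i j) (v j)) := by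
    have : ∀ i, c.ip (w i) (w i)
        = ∑ k, ∑ j, c.ip (v k) (c.lsmul (K k i * K i j) (v j)) := fun i => by
      simp only [w, c.ip_sum_left]
      refine Finset.sum_congr rfl fun k _ => ?_
      rw [c.ip_sum_right]
      refine Finset.sum_congr rfl fun j _ => ?_
      rw [c.ip_lsmul, hKs, c.mul_lsmul]
    simp only [this]
    rw [Finset.sum_comm]
    refine Finset.sum_congr rfl fun k _ => ?_
    rw [Finset.sum_comm]
    refine Finset.sum_congr rfl fun j _ => ?_
    rw [CStarMatrix.mul_apply, c.sum_lsmul, c.ip_sum_right]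
  have h₃ : ∑ i, ∑ j, c.ip (v i) (c.lsmul (K i j + K i j - (K * K) i j) (v j))
      = ∑ i, c.ip (v i) (w i) + ∑ i, c.ip (v i) (w i) - ∑ i, c.ip (w i) (w i) := by
    rw [h₂, ← Finset.sum_add_distrib, ← Finset.sum_sub_distrib]
    refine Finset.sum_congr rfl fun i _ => ?_
    simp only [w, c.ip_sum_right]
    rw [← Finset.sum_add_distrib, ← Finset.sum_sub_distrib]
    refine Finset.sum_congr rfl fun j _ => ?_
    rw [c.sub_lsmul, c.add_lsmul, c.ip_sub_right, c.ip_add]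
  simp only [c.ip_sub_left, c.ip_sub_right, Finset.sum_sub_distrib, h₁] at h₀
  rw [h₃, ← sub_nonneg]
  convert h₀ using 1
  abel

/-- Bessel's inequality for a family of adjointable maps with contractive Gram matrix. -/
theorem sum_ip_adjoint_le {F : Type*} [NormedAddCommGroup F] [NormedSpace ℂ F] [CompleteSpace F]
    (d : CStarCorrespondence A F) {n : ℕ} {K : CStarMatrix (Fin n) (Fin n) A}
    (hK : IsSelfAdjoint K) (T : Fin n → F → E) (S : Fin n → E → F)
    (hTS : ∀ i y z, c.ip (T i y) z = d.ip y (S i z))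
    (hST : ∀ i j y, S i (T j y) = d.lsmul (K i j + K i j - (K * K) i j) y) (z : E) :
    ∑ i, d.ip (S i z) (S i z) ≤ c.ip z z := by
  let w : E := ∑ i, T i (S i z)
  have h₀ : 0 ≤ c.ip (z - w) (z - w) := c.ip_self_nonneg _
  have h₁ : c.ip w z = ∑ i, d.ip (S i z) (S i z) := by
    simp only [w, c.ip_sum_left, hTS]
  have h₂ : c.ip z w = ∑ i, d.ip (S i z) (S i z) := by
    rw [← c.star_ip, h₁, star_sum]
    simp only [d.star_ip]
  have h₃ : c.ip w w ≤ ∑ i, d.ip (S i z) (S i z) := by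
    refine le_trans (le_of_eq ?_) (d.sum_ip_lsmul_le hK fun i => S i z)
    simp only [w, c.ip_sum_left, c.ip_sum_right, hTS]
    simp only [hST]
  have h₄ : c.ip (z - w) (z - w) = c.ip z z - ∑ i, d.ip (S i z) (S i z)
      - (∑ i, d.ip (S i z) (S i z) - c.ip w w) := by
    rw [c.ip_sub_left, c.ip_sub_right, c.ip_sub_right, h₁, h₂]
  rw [h₄] at h₀
  exact sub_nonneg.mp ((sub_nonneg.mpr h₃).trans (sub_nonneg.mp h₀))

theorem IsContractiveFamily.sum_le {c : CStarCorrespondence A E} {n : ℕ} {ξ : Fin n → E}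
    (h : c.IsContractiveFamily ξ) (η : E) :
    ∑ i, c.ip η (c.rsmul (ξ i) (c.ip (ξ i) η)) ≤ c.ip η η := by
  obtain ⟨K, hK, hKG⟩ := h
  refine le_trans (le_of_eq ?_) (c.sum_ip_adjoint_le (CStarCorrespondence.self A) hK
    (fun i a => c.rsmul (ξ i) a) (fun i z => c.ip (ξ i) z) (fun i a z => ?_) (fun i j a => ?_) η)
  · refine Finset.sum_congr rfl fun i _ => ?_
    rw [c.ip_rsmul, ← c.star_ip (ξ i) η]
    rfl
  · exact c.ip_rsmul_left _ _ _
  · rw [c.ip_rsmul, hKG]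
    rfl

end CStarCorrespondence


/-- For a self-adjoint `G` there is an `F` for which `1 - FGF = (1 - K)²`, and
`G (1 - F² G)² = Y² - Z²` with `Y²` small. -/
theorem exists_approximate_inverse_sqrt {D : Type*} [NonUnitalCStarAlgebra D] {G : D}
    (hG : IsSelfAdjoint G) {ε : ℝ} (hε : 0 < ε) :
    ∃ F K Y Z : D, IsSelfAdjoint F ∧ IsSelfAdjoint K ∧ IsSelfAdjoint Y ∧ IsSelfAdjoint Z ∧
      F * G * F = K + K - K * K ∧ ‖Y * Y‖ ≤ ε ∧
      G - G * (F * F) * G - G * (F * F) * G + G * (F * F) * G * (F * F) * G = Y * Y - Z * Z := by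
  -- An approximation of `t^{-1/2}` that vanishes for `t ≤ 0`. Then `f t f = t₊²/(t₊+ε)² ≤ 1`, and
  -- `y²`, `z²` are the positive and negative parts of `t (1 - f t f)²`. Keeping `z` avoids having
  -- to know that `G` is positive.
  let f : ℝ → ℝ := fun t => √(max t 0) / (max t 0 + ε)
  let k : ℝ → ℝ := fun t => 1 - √(1 - f t * t * f t)
  let y : ℝ → ℝ := fun t => √(max t 0) * (1 - f t * t * f t)
  let z : ℝ → ℝ := fun t => √(max (-t) 0) * (1 - f t * t * f t)
  have hden : ∀ t : ℝ, max t 0 + ε ≠ 0 := fun t => by positivity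
  have hf : Continuous f := by
    refine Continuous.div (by fun_prop) (by fun_prop) hden
  have hk : Continuous k := by fun_prop
  have hy : Continuous y := by fun_prop
  have hz : Continuous z := by fun_prop
  have hf0 : f 0 = 0 := by simp [f]
  have hk0 : k 0 = 0 := by simp [k]
  have hy0 : y 0 = 0 := by simp [y]
  have hz0 : z 0 = 0 := by simp [z]
  have hff : ∀ t : ℝ, f t * t * f t = (max t 0) ^ 2 / (max t 0 + ε) ^ 2 := fun t => by
    simp only [f]
    rcases le_total t 0 with h | h
    · simp [max_eq_right h]
    · rw [max_eq_left h, div_mul_eq_mul_div, div_mul_div_comm, ← sq]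
      congr 1
      nlinarith [Real.mul_self_sqrt h]
  have hff1 : ∀ t : ℝ, f t * t * f t ≤ 1 := fun t => by
    rw [hff, div_le_one (by have := hden t; positivity)]
    gcongr
    linarith
  have hid : G = cfcₙ (fun t : ℝ => t) G := (cfcₙ_id' ℝ G).symm
  have mul : ∀ u v : ℝ → ℝ, Continuous u → Continuous v → u 0 = 0 → v 0 = 0 →
      cfcₙ u G * cfcₙ v G = cfcₙ (fun t => u t * v t) G := fun u v hu hv hu0 hv0 =>
    (cfcₙ_mul u v G hu.continuousOn hu0 hv.continuousOn hv0).symm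
  have add : ∀ u v : ℝ → ℝ, Continuous u → Continuous v → u 0 = 0 → v 0 = 0 →
      cfcₙ u G + cfcₙ v G = cfcₙ (fun t => u t + v t) G := fun u v hu hv hu0 hv0 =>
    (cfcₙ_add u v G hu.continuousOn hu0 hv.continuousOn hv0).symm
  have sub : ∀ u v : ℝ → ℝ, Continuous u → Continuous v → u 0 = 0 → v 0 = 0 →
      cfcₙ u G - cfcₙ v G = cfcₙ (fun t => u t - v t) G := fun u v hu hv hu0 hv0 =>
    (cfcₙ_sub u v G hu.continuousOn hu0 hv.continuousOn hv0).symm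
  have e₁ : cfcₙ f G * G = cfcₙ (fun t => f t * t) G := by
    have := mul f (fun t => t) hf (by fun_prop) hf0 rfl
    rwa [← hid] at this
  have e₂ : G * (cfcₙ f G * cfcₙ f G) * G = cfcₙ (fun t => f t * t * (f t * t)) G := by
    have : G * (cfcₙ f G * cfcₙ f G) * G = (G * cfcₙ f G) * (cfcₙ f G * G) := by
      simp only [mul_assoc]
    rw [this, e₁]
    have e₁' : G * cfcₙ f G = cfcₙ (fun t => f t * t) G := by
      have := mul (fun t => t) f (by fun_prop) hf rfl hf0
      rw [← hid] at this
      exact this.trans (cfcₙ_congr fun t _ => mul_comm _ _)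
    rw [e₁', mul _ _ (by fun_prop) (by fun_prop) (by simp) (by simp)]
  refine ⟨cfcₙ f G, cfcₙ k G, cfcₙ y G, cfcₙ z G, cfcₙ_predicate f G, cfcₙ_predicate k G,
    cfcₙ_predicate y G, cfcₙ_predicate z G, ?_, ?_, ?_⟩
  · rw [e₁, mul _ _ (by fun_prop) hf (by simp) hf0, mul k k hk hk hk0 hk0,
      add k k hk hk hk0 hk0, sub _ _ (by fun_prop) (by fun_prop) (by simp [hk0]) (by simp [hk0])]
    refine cfcₙ_congr fun t _ => ?_
    have := Real.mul_self_sqrt (sub_nonneg.mpr (hff1 t))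
    simp only [k]
    linarith
  · rw [mul y y hy hy hy0 hy0]
    refine norm_cfcₙ_le fun t _ => ?_
    rw [Real.norm_of_nonneg (mul_self_nonneg _)]
    simp only [y]
    rw [hff]
    generalize hs : max t 0 = s
    have hs0 : 0 ≤ s := hs ▸ le_max_right _ _
    have h1 : √s * (1 - s ^ 2 / (s + ε) ^ 2) * (√s * (1 - s ^ 2 / (s + ε) ^ 2))
        = s * ((2 * s + ε) * ε) ^ 2 / (s + ε) ^ 4 := by
      have hne : s + ε ≠ 0 := by positivity
      have := Real.mul_self_sqrt hs0
      field_simp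
      rw [Real.sq_sqrt hs0]
      ring
    rw [h1, div_le_iff₀ (by positivity)]
    have h2 : s * (2 * s + ε) ^ 2 * ε ≤ (s + ε) ^ 4 := by
      nlinarith [sq_nonneg (s ^ 2 - ε ^ 2), mul_nonneg hs0 hε.le, sq_nonneg (s ^ 2),
        sq_nonneg (s * ε), mul_nonneg (mul_nonneg hs0 hs0) (mul_nonneg hs0 hε.le),
        mul_nonneg (mul_nonneg hs0 hε.le) (mul_nonneg hε.le hε.le), sq_nonneg (ε ^ 2)]
    nlinarith
  · have e₃ : G * (cfcₙ f G * cfcₙ f G) * G * (cfcₙ f G * cfcₙ f G) * G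
        = cfcₙ (fun t => f t * t * (f t * t) * (f t * (f t * t))) G := by
      rw [e₂, mul_assoc, mul_assoc, e₁, mul _ _ hf (by fun_prop) hf0 (by simp),
        mul _ _ (by fun_prop) (by fun_prop) (by simp) (by simp)]
    rw [e₃, e₂, mul y y hy hy hy0 hy0, mul z z hz hz hz0 hz0,
      sub _ _ (by fun_prop) (by fun_prop) (by simp [hy0]) (by simp [hz0])]
    have h1 : G - cfcₙ (fun t => f t * t * (f t * t)) G
        = cfcₙ (fun t => t - f t * t * (f t * t)) G := by
      have := sub (fun t => t) (fun t => f t * t * (f t * t)) (by fun_prop) (by fun_prop) rfl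
        (by simp)
      rwa [← hid] at this
    rw [h1, sub _ _ (by fun_prop) (by fun_prop) (by simp) (by simp),
      add _ _ (by fun_prop) (by fun_prop) (by simp) (by simp)]
    refine cfcₙ_congr fun t _ => ?_
    have hp := Real.mul_self_sqrt (le_max_right t 0)
    have hm := Real.mul_self_sqrt (le_max_right (-t) 0)
    have ht : max t 0 - max (-t) 0 = t := by
      rcases le_total t 0 with h | h
      · simp [max_eq_right h, max_eq_left (neg_nonneg.mpr h)]
      · simp [max_eq_left h, max_eq_right (neg_nonpos.mpr h)]
    simp only [y, z]
    linear_combination (-(1 - f t * t * f t) ^ 2) * hp + (1 - f t * t * f t) ^ 2 * hm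
      - (1 - f t * t * f t) ^ 2 * ht


namespace CStarCorrespondence

variable {A : Type*} [NonUnitalCStarAlgebra A] [PartialOrder A] [StarOrderedRing A]
  {E : Type*} [NormedAddCommGroup E] [NormedSpace ℂ E] [CompleteSpace E]
  (c : CStarCorrespondence A E)

theorem ip_sum_rsmul_sum_rsmul {n : ℕ} (x : Fin n → E)
    (C D : CStarMatrix (Fin n) (Fin n) A) (i j : Fin n) :
    c.ip (∑ a, c.rsmul (x a) (C a i)) (∑ b, c.rsmul (x b) (D b j))
      = (star C * CStarMatrix.ofMatrix (fun a b => c.ip (x a) (x b)) * D) i j := by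
  simp only [CStarMatrix.mul_apply, c.ip_sum_left, c.ip_sum_right, c.ip_rsmul, c.ip_rsmul_left,
    CStarMatrix.star_apply, Finset.sum_mul]
  rw [Finset.sum_comm]
  rfl

theorem ip_sum_rsmul {n : ℕ} (x : Fin n → E) (C : CStarMatrix (Fin n) (Fin n) A) (i j : Fin n) :
    c.ip (∑ a, c.rsmul (x a) (C a i)) (x j)
      = (star C * CStarMatrix.ofMatrix (fun a b => c.ip (x a) (x b))) i j := by
  simp only [CStarMatrix.mul_apply, c.ip_sum_left, c.ip_rsmul_left, CStarMatrix.star_apply]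
  rfl

/-- Take `ξ = xF` with `F ≈ G^{-1/2}` for the Gram matrix `G` of `x`. The Gram matrix of `ξ` is
`FGF`, and that of the errors `x(1 - F²G)` is `Y² - Z²`. Since the diagonal entries of `Z²` are
positive, those of `Y²` bound the squared errors. -/
theorem exists_isContractiveFamily_fin {n : ℕ} (x : Fin n → E) {ε : ℝ} (hε : 0 < ε) :
    ∃ ξ : Fin n → E, c.IsContractiveFamily ξ ∧
      ∀ k, ‖x k - ∑ i, c.rsmul (ξ i) (c.ip (ξ i) (x k))‖ ≤ ε := by
  let G : CStarMatrix (Fin n) (Fin n) A := CStarMatrix.ofMatrix fun i j => c.ip (x i) (x j)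
  have hG : IsSelfAdjoint G := CStarMatrix.ext fun i j => by
    rw [CStarMatrix.star_apply]
    exact c.star_ip _ _
  obtain ⟨F, K, Y, Z, hF, hK, hY, hZ, hFGF, hYε, hYZ⟩ :=
    exists_approximate_inverse_sqrt hG (pow_pos hε 2)
  refine ⟨fun i => ∑ a, c.rsmul (x a) (F a i), ⟨K, hK, fun i j => ?_⟩, fun k => ?_⟩
  · rw [c.ip_sum_rsmul_sum_rsmul, hF.star_eq]
    change (F * G * F) i j = _
    rw [hFGF]
    rfl
  have hw : ∑ i, c.rsmul (∑ a, c.rsmul (x a) (F a i)) (c.ip (∑ a, c.rsmul (x a) (F a i)) (x k))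
      = ∑ a, c.rsmul (x a) ((F * F * G) a k) := by
    simp only [c.ip_sum_rsmul, hF.star_eq, c.sum_rsmul, ← c.rsmul_mul]
    rw [Finset.sum_comm]
    refine Finset.sum_congr rfl fun a _ => ?_
    rw [← c.rsmul_sum, mul_assoc, CStarMatrix.mul_apply]
  rw [hw]
  have hstar : star (F * F * G) = G * (F * F) := by
    simp only [star_mul, hF.star_eq, hG.star_eq]
  set w := ∑ a, c.rsmul (x a) ((F * F * G) a k) with hwdef
  have h₁ : c.ip w (x k) = (G * (F * F) * G) k k := by
    rw [hwdef, c.ip_sum_rsmul, hstar]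
  have h₂ : c.ip (x k) w = (G * (F * F) * G) k k := by
    rw [← c.star_ip, h₁, ← CStarMatrix.star_apply]
    simp only [star_mul, hF.star_eq, hG.star_eq, mul_assoc]
  have h₃ : c.ip w w = (G * (F * F) * G * (F * F) * G) k k := by
    rw [hwdef, c.ip_sum_rsmul_sum_rsmul, hstar]
    simp only [mul_assoc]
    rfl
  have h₄ : c.ip (x k - w) (x k - w) = (Y * Y - Z * Z) k k := by
    rw [← hYZ, c.ip_sub_left, c.ip_sub_right, c.ip_sub_right, h₁, h₂, h₃]
    simp only [CStarMatrix.add_apply, CStarMatrix.sub_apply]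
    change G k k - _ - _ = _
    abel
  have h₅ : 0 ≤ (Z * Z) k k := by
    rw [CStarMatrix.mul_apply]
    refine Finset.sum_nonneg fun j _ => ?_
    rw [← CStarMatrix.star_apply_of_isSelfAdjoint hZ]
    exact star_mul_self_nonneg _
  have h₆ : c.ip (x k - w) (x k - w) ≤ (Y * Y) k k := by
    rw [h₄, CStarMatrix.sub_apply]
    exact sub_le_self _ h₅
  have h₇ := (CStarAlgebra.norm_le_norm_of_nonneg_of_le (c.ip_self_nonneg _) h₆).trans
    (CStarMatrix.norm_entry_le_norm.trans hYε)
  rw [← c.norm_sq] at h₇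
  exact (pow_le_pow_iff_left₀ (norm_nonneg _) hε.le two_ne_zero).mp h₇

/-- Finitely many vectors are almost fixed by `∑ θ_{ξ,ξ}` for some contractive family `ξ`. -/
theorem exists_isContractiveFamily (s : Finset E) {ε : ℝ} (hε : 0 < ε) :
    ∃ (n : ℕ) (ξ : Fin n → E), c.IsContractiveFamily ξ ∧
      ∀ x ∈ s, ‖x - ∑ i, c.rsmul (ξ i) (c.ip (ξ i) x)‖ ≤ ε := by
  obtain ⟨ξ, hξ, h⟩ := c.exists_isContractiveFamily_fin (fun i => (s.equivFin.symm i : E)) hε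
  exact ⟨_, ξ, hξ, fun x hx => by simpa using h (s.equivFin ⟨x, hx⟩)⟩

/-! #### Induced traces -/

section Trace

variable {τ : A →L[ℂ] ℂ}

/-- The induced trace is a supremum over sets, whereas the families used later may repeat vectors.
Two copies of `x` can be replaced by the single vector `√2 x` without changing either sum; this
lowers the cardinality. -/
theorem multiset_sum_le_inducedTrace (a : A) (s : Multiset E)
    (hs : ∀ η, (s.map fun ξ => c.ip η (c.rsmul ξ (c.ip ξ η))).sum ≤ c.ip η η) :
    (s.map fun ξ => ENNReal.ofReal (τ (c.ip ξ (c.lsmul a ξ))).re).sum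
      ≤ c.inducedTrace τ (c.lsmul a) := by
  induction hn : s.card using Nat.strong_induction_on generalizing s with
  | _ n ih =>
    by_cases hnd : s.Nodup
    · refine le_iSup₂_of_le (⟨s, hnd⟩ : Finset E) hs ?_
      exact le_rfl
    · obtain ⟨x, t, rfl⟩ : ∃ x t, s = x ::ₘ x ::ₘ t := by
        by_contra! hc
        exact hnd (Multiset.nodup_iff_ne_cons_cons.mpr hc)
      have hsq : ((√2 : ℝ) : ℂ) * ((√2 : ℝ) : ℂ) = 2 := by
        rw [← Complex.ofReal_mul, Real.mul_self_sqrt zero_le_two]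
        simp
      have h2 : star ((√2 : ℝ) : ℂ) = ((√2 : ℝ) : ℂ) := Complex.conj_ofReal _
      have := ih (t.card + 1) (by rw [← hn]; simp) ((((√2 : ℝ) : ℂ) • x) ::ₘ t) (fun η => ?_)
        (by simp)
      · refine le_trans (le_of_eq ?_) this
        simp only [Multiset.map_cons, Multiset.sum_cons]
        rw [c.lsmul_smul, c.ip_smul, c.ip_smul_left, smul_smul, h2, hsq, map_smul, ← add_assoc]
        congr 1
        have h3 : ∀ z : ℂ, ((2 : ℂ) • z).re = 2 * z.re := fun z => by simp
        rw [h3, ENNReal.ofReal_mul zero_le_two]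
        simp [two_mul]
      · refine le_trans (le_of_eq ?_) (hs η)
        simp only [Multiset.map_cons, Multiset.sum_cons]
        rw [c.smul_rsmul, c.ip_smul_left, c.rsmul_smul, c.ip_smul, c.ip_smul, smul_smul, h2, hsq,
          two_smul, add_assoc]

theorem sum_le_inducedTrace (a : A) {ι : Type*} [Fintype ι] (ξ : ι → E)
    (hξ : ∀ η, ∑ i, c.ip η (c.rsmul (ξ i) (c.ip (ξ i) η)) ≤ c.ip η η) :
    ∑ i, ENNReal.ofReal (τ (c.ip (ξ i) (c.lsmul a (ξ i)))).re ≤ c.inducedTrace τ (c.lsmul a) := by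
  have := c.multiset_sum_le_inducedTrace (τ := τ) a ((Finset.univ : Finset ι).val.map ξ)
    (fun η => by simpa [Multiset.map_map, Function.comp_def] using hξ η)
  simpa [Multiset.map_map, Function.comp_def] using this

end Trace

end CStarCorrespondence

namespace IsTracialState

variable {A : Type*} [NonUnitalCStarAlgebra A] [PartialOrder A] [StarOrderedRing A]
  {τ : A →L[ℂ] ℂ}

theorem re_mono (hτ : IsTracialState τ) {a b : A} (h : a ≤ b) : (τ a).re ≤ (τ b).re := by
  have := (hτ.nonneg _ (sub_nonneg.mpr h)).1
  rw [map_sub, Complex.sub_re] at this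
  linarith

theorem re_le_norm {A : Type*} [NonUnitalCStarAlgebra A] [PartialOrder A] {τ : A →L[ℂ] ℂ}
    (hτ : IsTracialState τ) (a : A) : (τ a).re ≤ ‖a‖ := by
  refine (Complex.re_le_norm _).trans ?_
  simpa [hτ.norm_eq_one] using τ.le_opNorm a

end IsTracialState

namespace CStarCorrespondence

variable {A : Type*} [NonUnitalCStarAlgebra A] [PartialOrder A] [StarOrderedRing A]
  {E : Type*} [NormedAddCommGroup E] [NormedSpace ℂ E] [CompleteSpace E]
  (c : CStarCorrespondence A E)
  {F : Type*} [NormedAddCommGroup F] [NormedSpace ℂ F] [CompleteSpace F]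
  (d : CStarCorrespondence A F) {τ : A →L[ℂ] ℂ}

/-- For every finite set of vectors there is a contractive family `ζ` with
`τ⟪x, x⟫ ≤ ∑ τ(⟪ζ, x⟫⟪x, ζ⟫) + ε`. -/
theorem exists_re_ip_self_le (hτ : IsTracialState τ) (s : Finset E) {ε : ℝ} (hε : 0 < ε) :
    ∃ (n : ℕ) (ζ : Fin n → E), c.IsContractiveFamily ζ ∧ ∀ x ∈ s,
      (τ (c.ip x x)).re ≤ ∑ i, (τ (c.ip (ζ i) x * c.ip x (ζ i))).re + ε := by
  obtain ⟨C, hC0, hC⟩ : ∃ C : ℝ, 0 < C ∧ ∀ x ∈ s, ‖x‖ ≤ C := by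
    refine ⟨∑ x ∈ s, ‖x‖ + 1, by positivity, fun x hx => ?_⟩
    have := Finset.single_le_sum (f := fun x : E => ‖x‖) (fun i _ => norm_nonneg i) hx
    linarith
  obtain ⟨n, ζ, hζ, h⟩ := c.exists_isContractiveFamily s (div_pos hε hC0)
  refine ⟨n, ζ, hζ, fun x hx => ?_⟩
  have h₁ : c.ip x x = c.ip x (x - ∑ i, c.rsmul (ζ i) (c.ip (ζ i) x))
      + ∑ i, c.ip x (ζ i) * c.ip (ζ i) x := by
    rw [c.ip_sub_right, c.ip_sum_right]
    simp only [c.ip_rsmul, sub_add_cancel]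
  rw [h₁, map_add, Complex.add_re, add_comm, map_sum, Complex.re_sum]
  refine add_le_add (Finset.sum_le_sum fun i _ => ?_) ?_
  · exact (congrArg Complex.re (hτ.map_mul_comm _ _)).le
  · refine (hτ.re_le_norm _).trans ((c.norm_ip_le _ _).trans ?_)
    calc _ ≤ C * (ε / C) := mul_le_mul (hC x hx) (h x hx) (norm_nonneg _) hC0.le
      _ = ε := mul_div_cancel₀ ε hC0.ne'

/-- For an adjointable map `T` from `F` to `E` with adjoint `S` and `S T = g`, and `∑ θ_{η,η} ≤ 1`,
`∑ τ⟪S η, S η⟫ ≤ Tr_τ(g)`. -/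
theorem sum_adjoint_le_inducedTrace (hτ : IsTracialState τ) {T : F → E} {S : E → F} {g : A}
    (hTS : ∀ y z, c.ip (T y) z = d.ip y (S z)) (hST : ∀ y, S (T y) = d.lsmul g y)
    (H : Finset E) (hH : ∀ η, ∑ ξ ∈ H, c.ip η (c.rsmul ξ (c.ip ξ η)) ≤ c.ip η η) :
    ENNReal.ofReal (∑ η ∈ H, (τ (d.ip (S η) (S η))).re) ≤ d.inducedTrace τ (d.lsmul g) := by
  classical
  refine ENNReal.le_of_forall_pos_le_add fun ε hε _ => ?_
  have hpos : (0 : ℝ) < ε / (H.card + 1) := by positivity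
  obtain ⟨n, ζ, hζ, h⟩ := d.exists_re_ip_self_le hτ (H.image S) hpos
  have h₁ : ∑ η ∈ H, (τ (d.ip (S η) (S η))).re
      ≤ ∑ i, (τ (d.ip (ζ i) (d.lsmul g (ζ i)))).re + ε := by
    calc ∑ η ∈ H, (τ (d.ip (S η) (S η))).re
        ≤ ∑ η ∈ H, (∑ i, (τ (d.ip (ζ i) (S η) * d.ip (S η) (ζ i))).re + ε / (H.card + 1)) :=
          Finset.sum_le_sum fun η hη => h _ (Finset.mem_image_of_mem S hη)
      _ = ∑ i, ∑ η ∈ H, (τ (d.ip (ζ i) (S η) * d.ip (S η) (ζ i))).re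
          + H.card * (ε / (H.card + 1)) := by
          rw [Finset.sum_add_distrib, Finset.sum_comm, Finset.sum_const, nsmul_eq_mul]
      _ ≤ ∑ i, (τ (d.ip (ζ i) (d.lsmul g (ζ i)))).re + ε := by
          gcongr with i
          -- Here the families exchange roles: `⟪ζ, Sη⟫ = ⟪Tζ, η⟫`, so the sum over `η ∈ H` is
          -- bounded by the hypothesis on `H` applied to the vector `Tζ`.
          · rw [← hST, ← hTS]
            refine le_trans (le_of_eq ?_) (hτ.re_mono (hH (T (ζ i))))
            rw [map_sum, Complex.re_sum]
            refine Finset.sum_congr rfl fun η _ => ?_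
            rw [c.ip_rsmul, hTS, ← c.star_ip, hTS, d.star_ip]
          · rw [mul_div_assoc', div_le_iff₀ (by positivity)]
            nlinarith [ε.2, hε]
  have h₂ : ∀ i, 0 ≤ (τ (d.ip (ζ i) (d.lsmul g (ζ i)))).re := fun i => by
    rw [← hST, ← hTS]
    exact (hτ.nonneg _ (c.ip_self_nonneg _)).1
  calc ENNReal.ofReal (∑ η ∈ H, (τ (d.ip (S η) (S η))).re)
      ≤ ENNReal.ofReal (∑ i, (τ (d.ip (ζ i) (d.lsmul g (ζ i)))).re + ε) :=
        ENNReal.ofReal_le_ofReal h₁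
    _ ≤ ENNReal.ofReal (∑ i, (τ (d.ip (ζ i) (d.lsmul g (ζ i)))).re) + ε := by
        refine ENNReal.ofReal_add_le.trans ?_
        rw [ENNReal.ofReal_coe_nnreal]
    _ ≤ _ := by
        gcongr
        rw [ENNReal.ofReal_sum_of_nonneg fun i _ => h₂ i]
        exact d.sum_le_inducedTrace g ζ hζ.sum_le

end CStarCorrespondence


/-- The suprema run over independent indices, so they can be pulled out of the sum one at a time. -/
theorem ENNReal.sum_iSup_le {ι : Type*} {κ : ι → Type*} [∀ i, Nonempty (κ i)] (s : Finset ι)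
    (f : ∀ i, κ i → ℝ≥0∞) {b : ℝ≥0∞} (h : ∀ k : ∀ i, κ i, ∑ i ∈ s, f i (k i) ≤ b) :
    ∑ i ∈ s, ⨆ k, f i k ≤ b := by
  classical
  suffices H : ∀ c : ℝ≥0∞, (∀ k : ∀ i, κ i, c + ∑ i ∈ s, f i (k i) ≤ b) →
      c + ∑ i ∈ s, ⨆ k, f i k ≤ b by simpa using H 0 (by simpa using h)
  clear h
  induction s using Finset.induction_on with
  | empty => exact fun c h => by simpa using h fun i => Classical.arbitrary _
  | insert j s hj ih =>
    intro c h
    rw [Finset.sum_insert hj, ← add_assoc, ENNReal.add_iSup, ENNReal.iSup_add]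
    refine iSup_le fun k => ih _ fun k' => ?_
    have := h (Function.update k' j k)
    rw [Finset.sum_insert hj, Function.update_self] at this
    rw [add_assoc]
    refine le_trans (le_of_eq ?_) this
    congr 2
    refine Finset.sum_congr rfl fun i hi => ?_
    rw [Function.update_of_ne (ne_of_mem_of_not_mem hi hj)]

namespace CStarCorrespondence

variable {A : Type*} [NonUnitalCStarAlgebra A] [PartialOrder A] [StarOrderedRing A]
  {E : Type*} [NormedAddCommGroup E] [NormedSpace ℂ E] [CompleteSpace E]
  (c : CStarCorrespondence A E)

theorem continuous_ip_right (x : E) : Continuous (c.ip x) :=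
  AddMonoidHomClass.continuous_of_bound (c.ipHom x) ‖x‖ (c.norm_ip_le x)

end CStarCorrespondence

/-! ### Adjoints of left multiplication in a product system -/

namespace ProductSystem

variable {P : Type*} [Monoid P] {A : Type*} [NonUnitalCStarAlgebra A] [PartialOrder A]
  [StarOrderedRing A] (X : ProductSystem P A) {p q r : P} (h : p * q = r)

/-- Linearity of the product is not an axiom. By `ip_mul` the difference of the two sides is
orthogonal to all products, hence to itself. -/
theorem mul_sub_left (ξ ξ' : X.X p) (ζ : X.X q) :
    X.mul h (ξ - ξ') ζ = X.mul h ξ ζ - X.mul h ξ' ζ := by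
  rw [← sub_eq_zero]
  have key : ∀ (η : X.X p) (ω : X.X q), (X.corr r).ip
      (X.mul h (ξ - ξ') ζ - (X.mul h ξ ζ - X.mul h ξ' ζ)) (X.mul h η ω) = 0 := fun η ω => by
    simp only [(X.corr r).ip_sub_left, X.ip_mul, (X.corr p).ip_sub_left, (X.corr q).sub_lsmul,
      (X.corr q).ip_sub_right, sub_self]
  refine (X.corr r).eq_zero_of_ip_self ?_
  conv_lhs => rw [(X.corr r).ip_sub_right, (X.corr r).ip_sub_right]
  rw [key, key, key]
  simp

/-- Multiplication on the right by `ζ`, as an additive map. -/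
def mulRightHom (ζ : X.X q) : X.X p →+ X.X r :=
  AddMonoidHom.ofMapSub (fun ξ => X.mul h ξ ζ) fun ξ ξ' => X.mul_sub_left h ξ ξ' ζ

theorem mul_sum_left {ι : Type*} (s : Finset ι) (f : ι → X.X p) (ζ : X.X q) :
    X.mul h (∑ i ∈ s, f i) ζ = ∑ i ∈ s, X.mul h (f i) ζ := map_sum (X.mulRightHom h ζ) f s

theorem lsmul_mul (a : A) (ξ : X.X p) (ζ : X.X q) :
    (X.corr r).lsmul a (X.mul h ξ ζ) = X.mul h ((X.corr p).lsmul a ξ) ζ := by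
  rw [← X.unit_mul, ← X.unit_mul]
  exact (X.mul_assoc' (one_mul p) h h (one_mul r) _ ξ ζ).symm

theorem rsmul_mul (a : A) (ξ : X.X p) (ζ : X.X q) :
    X.mul h ((X.corr p).rsmul ξ a) ζ = X.mul h ξ ((X.corr q).lsmul a ζ) := by
  rw [← X.unit_mul, ← X.mul_unit]
  exact X.mul_assoc' (mul_one p) h (one_mul q) h ξ _ ζ

theorem norm_mul_le (ξ : X.X p) (ζ : X.X q) : ‖X.mul h ξ ζ‖ ≤ ‖ξ‖ * ‖ζ‖ := by
  have h₁ : ‖X.mul h ξ ζ‖ ^ 2 ≤ (‖ξ‖ * ‖ζ‖) ^ 2 := by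
    rw [(X.corr r).norm_sq, X.ip_mul]
    calc _ ≤ ‖ζ‖ * (‖(X.corr p).ip ξ ξ‖ * ‖ζ‖) := ((X.corr q).norm_ip_le _ _).trans (by
            gcongr; exact (X.corr q).norm_lsmul_le _ _)
      _ = (‖ξ‖ * ‖ζ‖) ^ 2 := by rw [← (X.corr p).norm_sq]; ring
  exact (pow_le_pow_iff_left₀ (norm_nonneg _) (by positivity) two_ne_zero).mp h₁

/-- On a product `ξ'ζ'` the adjoint is `⟪ξ, ξ'⟫ζ'`, and it extends linearly to the span. The
estimate `‖z - z'‖ ≤ ‖ξ‖ ‖y - y'‖` and completeness of `X_q` then reach all of `X_{pq}`, the span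
being dense for `p ≠ 1`. -/
theorem exists_adjoint (hp : p ≠ 1) (ξ : X.X p) (x : X.X r) :
    ∃ z : X.X q, ∀ ζ, (X.corr r).ip (X.mul h ξ ζ) x = (X.corr q).ip ζ z := by
  have hspan : ∀ y ∈ Submodule.span ℂ {x : X.X r | ∃ ξ ζ, x = X.mul h ξ ζ},
      ∃ z : X.X q, ∀ ζ, (X.corr r).ip (X.mul h ξ ζ) y = (X.corr q).ip ζ z := fun y hy => by
    induction hy using Submodule.span_induction with
    | mem y hy =>
      obtain ⟨ξ', ζ', rfl⟩ := hy
      exact ⟨_, fun ζ => X.ip_mul h ξ ξ' ζ ζ'⟩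
    | zero => exact ⟨0, fun ζ => by rw [(X.corr r).ip_zero_right, (X.corr q).ip_zero_right]⟩
    | add y y' _ _ h₁ h₂ =>
      obtain ⟨z, hz⟩ := h₁
      obtain ⟨z', hz'⟩ := h₂
      exact ⟨z + z', fun ζ => by rw [(X.corr r).ip_add, (X.corr q).ip_add, hz, hz']⟩
    | smul a y _ h₁ =>
      obtain ⟨z, hz⟩ := h₁
      exact ⟨a • z, fun ζ => by rw [(X.corr r).ip_smul, (X.corr q).ip_smul, hz]⟩
  obtain ⟨y, hy, hlim⟩ := mem_closure_iff_seq_limit.mp (X.dense_mul h hp x)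
  choose z hz using fun n => hspan (y n) (hy n)
  have hbound : ∀ n m, ‖z n - z m‖ ≤ ‖ξ‖ * ‖y n - y m‖ := fun n m => by
    have h₁ : (X.corr q).ip (z n - z m) (z n - z m)
        = (X.corr r).ip (X.mul h ξ (z n - z m)) (y n - y m) := by
      rw [(X.corr r).ip_sub_right, hz, hz, ← (X.corr q).ip_sub_right]
    have h₂ : ‖z n - z m‖ ^ 2 ≤ (‖ξ‖ * ‖z n - z m‖) * ‖y n - y m‖ := by
      rw [(X.corr q).norm_sq, h₁]
      refine ((X.corr r).norm_ip_le _ _).trans ?_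
      gcongr
      exact X.norm_mul_le h _ _
    rcases (norm_nonneg (z n - z m)).eq_or_lt with h₃ | h₃
    · rw [← h₃]; positivity
    · nlinarith
  have hcauchy : CauchySeq z := by
    have hy' := hlim.cauchySeq
    rw [Metric.cauchySeq_iff] at hy' ⊢
    intro ε hε
    obtain ⟨N, hN⟩ := hy' (ε / (‖ξ‖ + 1)) (by positivity)
    refine ⟨N, fun m hm n hn => ?_⟩
    have h₁ := hN m hm n hn
    rw [dist_eq_norm] at h₁ ⊢
    rw [lt_div_iff₀ (by positivity)] at h₁
    nlinarith [hbound m n, norm_nonneg (y m - y n)]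
  obtain ⟨z₀, hz₀⟩ := cauchySeq_tendsto_of_complete hcauchy
  refine ⟨z₀, fun ζ => ?_⟩
  refine tendsto_nhds_unique (((X.corr r).continuous_ip_right _).tendsto x |>.comp hlim) ?_
  simpa only [Function.comp_def, hz] using ((X.corr q).continuous_ip_right ζ).tendsto z₀ |>.comp hz₀

open Classical in
/-- The adjoint of left multiplication by `ξ`. -/
noncomputable def adj (ξ : X.X p) (x : X.X r) : X.X q :=
  if hx : ∃ z : X.X q, ∀ ζ, (X.corr r).ip (X.mul h ξ ζ) x = (X.corr q).ip ζ z then hx.choose else 0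

variable {X} in
theorem ip_adj (hp : p ≠ 1) (ξ : X.X p) (ζ : X.X q) (x : X.X r) :
    (X.corr q).ip ζ (X.adj h ξ x) = (X.corr r).ip (X.mul h ξ ζ) x := by
  have hx := X.exists_adjoint h hp ξ x
  rw [adj, dif_pos hx]
  exact (hx.choose_spec ζ).symm

theorem adj_mul (hp : p ≠ 1) (ξ ξ' : X.X p) (ζ : X.X q) :
    X.adj h ξ (X.mul h ξ' ζ) = (X.corr q).lsmul ((X.corr p).ip ξ ξ') ζ :=
  (X.corr q).ext_ip fun ω => by rw [ip_adj h hp, X.ip_mul]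

theorem adj_add (hp : p ≠ 1) (ξ : X.X p) (x y : X.X r) :
    X.adj h ξ (x + y) = X.adj h ξ x + X.adj h ξ y :=
  (X.corr q).ext_ip fun ω => by simp only [ip_adj h hp, (X.corr q).ip_add, (X.corr r).ip_add]

theorem adj_sub (hp : p ≠ 1) (ξ : X.X p) (x y : X.X r) :
    X.adj h ξ (x - y) = X.adj h ξ x - X.adj h ξ y :=
  (X.corr q).ext_ip fun ω => by
    simp only [ip_adj h hp, (X.corr q).ip_sub_right, (X.corr r).ip_sub_right]

theorem adj_smul (hp : p ≠ 1) (ξ : X.X p) (z : ℂ) (x : X.X r) :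
    X.adj h ξ (z • x) = z • X.adj h ξ x :=
  (X.corr q).ext_ip fun ω => by simp only [ip_adj h hp, (X.corr q).ip_smul, (X.corr r).ip_smul]

theorem sum_ip_adj_le (hp : p ≠ 1) {n : ℕ} {ξ : Fin n → X.X p}
    (hξ : (X.corr p).IsContractiveFamily ξ) (x : X.X r) :
    ∑ i, (X.corr q).ip (X.adj h (ξ i) x) (X.adj h (ξ i) x) ≤ (X.corr r).ip x x := by
  obtain ⟨K, hK, hKG⟩ := hξ
  refine (X.corr r).sum_ip_adjoint_le (X.corr q) hK (fun i => X.mul h (ξ i))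
    (fun i => X.adj h (ξ i)) (fun i y z => ?_) (fun i j y => ?_) x
  · rw [ip_adj h hp]
  · rw [X.adj_mul h hp, hKG]

/-- If each `H i` is admissible in `X_q`, then the products `ξ_i ζ` with `ζ ∈ H i` form an
admissible family in `X_{pq}`: apply Bessel's inequality in `X_q` to the vectors `ξ_i* x`, then
`sum_ip_adj_le`. The values match because `⟪ξζ, aξζ⟫ = ⟪ζ, ⟪ξ, aξ⟫ζ⟫`. -/
theorem sum_tr_ip_le_tr {p q r : P} (h : p * q = r) (hp : p ≠ 1) (τ : A →L[ℂ] ℂ) (a : A) {n : ℕ} {ξ : Fin n → X.X p}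
    (hξ : (X.corr p).IsContractiveFamily ξ) :
    ∑ i, X.tr τ q ((X.corr p).ip (ξ i) ((X.corr p).lsmul a (ξ i))) ≤ X.tr τ r a := by
  simp only [tr, CStarCorrespondence.inducedTrace]
  simp only [iSup_subtype']
  have : Nonempty {H : Finset (X.X q) // ∀ η, ∑ ξ ∈ H, (X.corr q).ip η
      ((X.corr q).rsmul ξ ((X.corr q).ip ξ η)) ≤ (X.corr q).ip η η} :=
    ⟨⟨∅, fun η => by simpa using (X.corr q).ip_self_nonneg η⟩⟩
  refine ENNReal.sum_iSup_le _ _ fun H => ?_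
  have key := (X.corr r).sum_le_inducedTrace (τ := τ) a
    (fun k : (Σ i, {ζ // ζ ∈ (H i).1}) => X.mul h (ξ k.1) k.2.1) (fun x => ?_)
  · refine le_trans (le_of_eq ?_) (key.trans (le_of_eq ?_))
    · rw [Fintype.sum_sigma]
      refine Finset.sum_congr rfl fun i _ => ?_
      rw [← Finset.sum_coe_sort]
      refine Finset.sum_congr rfl fun ζ _ => ?_
      rw [X.lsmul_mul, X.ip_mul]
    · rw [CStarCorrespondence.inducedTrace, iSup_subtype']
  · rw [Fintype.sum_sigma]
    refine (Finset.sum_le_sum (g := fun i => (X.corr q).ip (X.adj h (ξ i) x) (X.adj h (ξ i) x))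
      fun i _ => ?_).trans (X.sum_ip_adj_le h hp hξ x)
    refine le_trans (le_of_eq ?_) ((H i).2 (X.adj h (ξ i) x))
    conv_rhs => rw [← Finset.sum_coe_sort]
    refine Finset.sum_congr rfl fun ζ _ => ?_
    rw [(X.corr r).ip_rsmul, (X.corr q).ip_rsmul, ip_adj h hp,
      ← (X.corr q).star_ip, ip_adj h hp, (X.corr r).star_ip]

end ProductSystem


theorem ENNReal.exists_forall_le_ofReal_sub {ι : Type*} [Fintype ι] {m : ι → ℝ≥0∞} {v : ι → ℝ}
    (hv : ∀ i, m i < ENNReal.ofReal (v i)) :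
    ∃ ε : ℝ, 0 < ε ∧ ∀ i, m i ≤ ENNReal.ofReal (v i - ε) := by
  have h₁ : ∀ i, ∃ ε : ℝ, 0 < ε ∧ m i ≤ ENNReal.ofReal (v i - ε) := fun i => by
    have hfin : m i ≠ ⊤ := ((hv i).trans_le le_top).ne
    refine ⟨v i - (m i).toReal, sub_pos.mpr ?_, ?_⟩
    · exact (ENNReal.lt_ofReal_iff_toReal_lt hfin).mp (hv i)
    · rw [_root_.sub_sub_cancel, ENNReal.ofReal_toReal hfin]
  choose e he hme using h₁
  rcases isEmpty_or_nonempty ι with hι | hι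
  · exact ⟨1, one_pos, fun i => (hι.false i).elim⟩
  · obtain ⟨i₀, -, hi₀⟩ := Finset.exists_min_image Finset.univ e Finset.univ_nonempty
    refine ⟨e i₀, he i₀, fun i => (hme i).trans (ENNReal.ofReal_le_ofReal ?_)⟩
    have := hi₀ i (Finset.mem_univ i)
    linarith

/-! ### Induced traces over products of fibres -/

namespace ProductSystem

variable {P : Type*} [Monoid P] {A : Type*} [NonUnitalCStarAlgebra A] [PartialOrder A]
  [StarOrderedRing A] (X : ProductSystem P A) {p q r : P} (h : p * q = r)

/-- If `∑ θ_{ξ,ξ}` almost fixes finitely many suitable vectors of `X_p`, then the corresponding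
operator on `X_{pq}` almost fixes a given vector of the span of the products. -/
theorem exists_norm_ip_sub_sum_adj_le (hp : p ≠ 1) (z : X.X r) {y : X.X r}
    (hy : y ∈ Submodule.span ℂ {x : X.X r | ∃ ξ ζ, x = X.mul h ξ ζ}) :
    ∃ (s : Finset (X.X p)) (D : ℝ), 0 ≤ D ∧ ∀ (n : ℕ) (ξ : Fin n → X.X p) (δ : ℝ),
      (∀ x ∈ s, ‖x - ∑ i, (X.corr p).rsmul (ξ i) ((X.corr p).ip (ξ i) x)‖ ≤ δ) →
      ‖(X.corr r).ip z y - ∑ i, (X.corr q).ip (X.adj h (ξ i) z) (X.adj h (ξ i) y)‖ ≤ D * δ := by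
  classical
  induction hy using Submodule.span_induction with
  | mem y hy =>
    obtain ⟨ξ', ζ', rfl⟩ := hy
    refine ⟨{ξ'}, ‖z‖ * ‖ζ'‖, by positivity, fun n ξ δ hδ => ?_⟩
    -- On a product the operator `∑ ξ_i ξ_i*` acts on the left factor only, as `∑ θ_{ξ,ξ}` on `X_p`.
    have h₁ : ∑ i, (X.corr q).ip (X.adj h (ξ i) z) (X.adj h (ξ i) (X.mul h ξ' ζ'))
        = (X.corr r).ip z
          (X.mul h (∑ i, (X.corr p).rsmul (ξ i) ((X.corr p).ip (ξ i) ξ')) ζ') := by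
      rw [X.mul_sum_left, (X.corr r).ip_sum_right]
      refine Finset.sum_congr rfl fun i _ => ?_
      rw [X.adj_mul h hp, X.rsmul_mul, ← (X.corr q).star_ip, ip_adj h hp, (X.corr r).star_ip]
    rw [h₁, ← (X.corr r).ip_sub_right, ← X.mul_sub_left]
    calc _ ≤ ‖z‖ * (‖ξ' - ∑ i, (X.corr p).rsmul (ξ i) ((X.corr p).ip (ξ i) ξ')‖ * ‖ζ'‖) :=
          ((X.corr r).norm_ip_le _ _).trans (by gcongr; exact X.norm_mul_le h _ _)
      _ ≤ ‖z‖ * (δ * ‖ζ'‖) := by gcongr; exact hδ ξ' (by simp)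
      _ = _ := by ring
  | zero =>
    refine ⟨∅, 0, le_rfl, fun n ξ δ _ => ?_⟩
    have h₁ : ∀ i, X.adj h (ξ i) 0 = 0 := fun i => by simpa using X.adj_sub h hp (ξ i) 0 0
    simp [h₁, (X.corr r).ip_zero_right, (X.corr q).ip_zero_right]
  | add y y' _ _ ih ih' =>
    obtain ⟨s, D, hD, H⟩ := ih
    obtain ⟨s', D', hD', H'⟩ := ih'
    refine ⟨s ∪ s', D + D', by positivity, fun n ξ δ hδ => ?_⟩
    have h₁ := H n ξ δ fun x hx => hδ x (Finset.mem_union_left _ hx)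
    have h₂ := H' n ξ δ fun x hx => hδ x (Finset.mem_union_right _ hx)
    simp only [X.adj_add h hp, (X.corr r).ip_add, (X.corr q).ip_add, Finset.sum_add_distrib]
    rw [add_sub_add_comm, add_mul]
    exact (norm_add_le _ _).trans (add_le_add h₁ h₂)
  | smul a y _ ih =>
    obtain ⟨s, D, hD, H⟩ := ih
    refine ⟨s, ‖a‖ * D, by positivity, fun n ξ δ hδ => ?_⟩
    simp only [X.adj_smul h hp, (X.corr r).ip_smul, (X.corr q).ip_smul, ← Finset.smul_sum,
      ← smul_sub]
    rw [norm_smul, mul_assoc]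
    gcongr
    exact H n ξ δ hδ

/-- The defect `Q(y) = τ⟪y, y⟫ - ∑ τ⟪ξ_i* y, ξ_i* y⟫` is a positive quadratic form with `Q(y) ≤
‖y‖²`, so the parallelogram law gives `Q(u + y') ≤ 2Q(u) + 2Q(y')`. This moves an estimate from a
dense subspace to all vectors, uniformly in `ξ`. -/
theorem re_ip_self_sub_sum_adj_le (hp : p ≠ 1) {τ : A →L[ℂ] ℂ} (hτ : IsTracialState τ)
    {n : ℕ} {ξ : Fin n → X.X p} (hξ : (X.corr p).IsContractiveFamily ξ) (y y' : X.X r) :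
    (τ ((X.corr r).ip y y)).re
        - ∑ i, (τ ((X.corr q).ip (X.adj h (ξ i) y) (X.adj h (ξ i) y))).re
      ≤ 2 * ‖y - y'‖ ^ 2 + 2 * ((τ ((X.corr r).ip y' y')).re
        - ∑ i, (τ ((X.corr q).ip (X.adj h (ξ i) y') (X.adj h (ξ i) y'))).re) := by
  obtain ⟨u, rfl⟩ : ∃ u, y = u + y' := ⟨y - y', by simp⟩
  rw [add_sub_cancel_right]
  have h₁ : ∑ i, (τ ((X.corr q).ip (X.adj h (ξ i) (u - y')) (X.adj h (ξ i) (u - y')))).re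
      ≤ (τ ((X.corr r).ip (u - y') (u - y'))).re := by
    have := hτ.re_mono (X.sum_ip_adj_le h hp hξ (u - y'))
    rwa [map_sum, Complex.re_sum] at this
  have h₂ : (τ ((X.corr r).ip u u)).re ≤ ‖u‖ ^ 2 := by
    rw [(X.corr r).norm_sq]
    exact hτ.re_le_norm _
  have h₃ : 0 ≤ ∑ i, (τ ((X.corr q).ip (X.adj h (ξ i) u) (X.adj h (ξ i) u))).re :=
    Finset.sum_nonneg fun i _ => (hτ.nonneg _ ((X.corr q).ip_self_nonneg _)).1
  simp only [X.adj_add h hp, X.adj_sub h hp, CStarCorrespondence.ip_add_left,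
    CStarCorrespondence.ip_add, CStarCorrespondence.ip_sub_left,
    CStarCorrespondence.ip_sub_right, map_add, map_sub, Complex.add_re, Complex.sub_re,
    Finset.sum_add_distrib, Finset.sum_sub_distrib] at h₁ ⊢
  linarith

theorem exists_re_ip_self_le_sum_adj (hp : p ≠ 1) {τ : A →L[ℂ] ℂ} (hτ : IsTracialState τ)
    {κ : Type*} [Fintype κ] (q : κ → P) (y : ∀ k, X.X (p * q k)) {ε : ℝ} (hε : 0 < ε) :
    ∃ (n : ℕ) (ξ : Fin n → X.X p), (X.corr p).IsContractiveFamily ξ ∧ ∀ k,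
      (τ ((X.corr (p * q k)).ip (y k) (y k))).re
        ≤ ∑ i, (τ ((X.corr (q k)).ip (X.adj rfl (ξ i) (y k)) (X.adj rfl (ξ i) (y k)))).re + ε := by
  classical
  -- The squared distance and the defect of `y' k` will each be at most `ε / 4`, and both enter with
  -- the factor `2`.
  have hδ : 0 < √(ε / 4) := Real.sqrt_pos.mpr (by positivity)
  have hy' : ∀ k, ∃ y' ∈ Submodule.span ℂ {x : X.X (p * q k) | ∃ ξ ζ, x = X.mul rfl ξ ζ},
      ‖y k - y'‖ < √(ε / 4) := fun k => by
    obtain ⟨y', hy', hd⟩ := Metric.mem_closure_iff.mp (X.dense_mul rfl hp (y k)) _ hδ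
    exact ⟨y', hy', by rwa [← dist_eq_norm]⟩
  choose y' hspan hdist using hy'
  choose s D hD H using fun k => X.exists_norm_ip_sub_sum_adj_le rfl hp (y' k) (hspan k)
  have hDs : 0 ≤ ∑ k, D k := Finset.sum_nonneg fun k _ => hD k
  have hδ' : 0 < ε / (4 * (∑ k, D k + 1)) := by positivity
  obtain ⟨n, ξ, hξ, hclose⟩ := (X.corr p).exists_isContractiveFamily (Finset.univ.biUnion s) hδ'
  refine ⟨n, ξ, hξ, fun k => ?_⟩
  have h₁ := X.re_ip_self_sub_sum_adj_le rfl hp hτ hξ (y k) (y' k)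
  have h₂ := H k n ξ _ fun x hx => hclose x (Finset.mem_biUnion.mpr ⟨k, Finset.mem_univ _, hx⟩)
  have h₃ := (hτ.re_le_norm _).trans h₂
  rw [map_sub, Complex.sub_re, map_sum, Complex.re_sum] at h₃
  have h₄ : ‖y k - y' k‖ ^ 2 ≤ ε / 4 := by
    calc _ ≤ √(ε / 4) ^ 2 := by gcongr; exact (hdist k).le
      _ = _ := Real.sq_sqrt (by positivity)
  have h₅ : D k * (ε / (4 * (∑ k, D k + 1))) ≤ ε / 4 := by
    have : D k ≤ ∑ k, D k := Finset.single_le_sum (fun i _ => hD i) (Finset.mem_univ k)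
    rw [mul_div_assoc', div_le_div_iff₀ (by positivity) (by norm_num)]
    nlinarith
  linarith

/-- Finitely many values `Tr_τ^{pq}(a)` are simultaneously approximated by sums
`∑ Tr_τ^q(⟪ξ, a ξ⟫)` over a contractive family in `X_p`. -/
theorem exists_le_sum_tr_ip (hp : p ≠ 1) {τ : A →L[ℂ] ℂ} (hτ : IsTracialState τ) {a : A}
    (ha : 0 ≤ a) {ι : Type*} [Fintype ι] (q : ι → P) (m : ι → ℝ≥0∞)
    (hm : ∀ i, m i < X.tr τ (p * q i) a) :
    ∃ (n : ℕ) (ξ : Fin n → X.X p), (X.corr p).IsContractiveFamily ξ ∧ ∀ i,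
      m i ≤ ∑ k, X.tr τ (q i) ((X.corr p).ip (ξ k) ((X.corr p).lsmul a (ξ k))) := by
  classical
  obtain ⟨b, hb, rfl⟩ : ∃ b : A, star b = b ∧ b * b = a :=
    ⟨CFC.sqrt a, (CFC.sqrt_nonneg a).isSelfAdjoint.star_eq, CFC.sqrt_mul_sqrt_self a⟩
  have hH : ∀ i, ∃ H : Finset (X.X (p * q i)),
      (∀ η, ∑ ξ ∈ H, (X.corr (p * q i)).ip η ((X.corr (p * q i)).rsmul ξ
        ((X.corr (p * q i)).ip ξ η)) ≤ (X.corr (p * q i)).ip η η) ∧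
      m i < ∑ ξ ∈ H, ENNReal.ofReal (τ ((X.corr (p * q i)).ip ξ
        ((X.corr (p * q i)).lsmul (b * b) ξ))).re := fun i => by
    have := hm i
    rw [tr, CStarCorrespondence.inducedTrace] at this
    simp only [lt_iSup_iff] at this
    obtain ⟨H, hH, hlt⟩ := this
    exact ⟨H, hH, hlt⟩
  choose H hH hlt using hH
  let y : ∀ k : (Σ i, {η // η ∈ H i}), X.X (p * q k.1) :=
    fun k => (X.corr (p * q k.1)).lsmul b k.2.1
  let v : ι → ℝ := fun i => ∑ η ∈ H i, (τ ((X.corr (p * q i)).ip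
    ((X.corr (p * q i)).lsmul b η) ((X.corr (p * q i)).lsmul b η))).re
  have hv : ∀ i, m i < ENNReal.ofReal (v i) := fun i => by
    rw [ENNReal.ofReal_sum_of_nonneg fun η _ =>
      (hτ.nonneg _ ((X.corr (p * q i)).ip_self_nonneg _)).1]
    refine (hlt i).trans_le (le_of_eq (Finset.sum_congr rfl fun η _ => ?_))
    rw [(X.corr (p * q i)).ip_lsmul, hb, (X.corr (p * q i)).mul_lsmul]
  obtain ⟨ε, hε, hmε⟩ : ∃ ε : ℝ, 0 < ε ∧ ∀ i, m i ≤ ENNReal.ofReal (v i - ε) :=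
    ENNReal.exists_forall_le_ofReal_sub hv
  have hcard₀ : ∀ i, (0 : ℝ) ≤ (H i).card := fun i => Nat.cast_nonneg _
  have hcard₁ : 0 < ∑ i, ((H i).card : ℝ) + 1 :=
    add_pos_of_nonneg_of_pos (Finset.sum_nonneg fun i _ => hcard₀ i) one_pos
  have hcard : 0 < ε / (∑ i, ((H i).card : ℝ) + 1) := div_pos hε hcard₁
  obtain ⟨n, ξ, hξ, happ⟩ := X.exists_re_ip_self_le_sum_adj hp hτ
    (fun k : (Σ i, {η // η ∈ H i}) => q k.1) y hcard
  refine ⟨n, ξ, hξ, fun i => (hmε i).trans ?_⟩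
  have h₁ : v i - ε ≤ ∑ k, ∑ η ∈ H i, (τ ((X.corr (q i)).ip
      (X.adj rfl (ξ k) ((X.corr (p * q i)).lsmul b η))
      (X.adj rfl (ξ k) ((X.corr (p * q i)).lsmul b η)))).re := by
    rw [Finset.sum_comm, sub_le_iff_le_add]
    calc v i ≤ ∑ η ∈ H i, (∑ k, (τ ((X.corr (q i)).ip
          (X.adj rfl (ξ k) ((X.corr (p * q i)).lsmul b η))
          (X.adj rfl (ξ k) ((X.corr (p * q i)).lsmul b η)))).re
          + ε / (∑ i, ((H i).card : ℝ) + 1)) :=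
          Finset.sum_le_sum fun η hη => happ ⟨i, η, hη⟩
      _ ≤ _ := by
          rw [Finset.sum_add_distrib, Finset.sum_const, nsmul_eq_mul]
          gcongr
          rw [mul_div_assoc', div_le_iff₀ hcard₁]
          have : ((H i).card : ℝ) ≤ ∑ i, ((H i).card : ℝ) :=
            Finset.single_le_sum (f := fun i => ((H i).card : ℝ)) (fun i _ => hcard₀ i)
              (Finset.mem_univ i)
          nlinarith
  refine (ENNReal.ofReal_le_ofReal h₁).trans ?_
  rw [ENNReal.ofReal_sum_of_nonneg fun k _ => Finset.sum_nonneg fun η _ =>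
    (hτ.nonneg _ ((X.corr (q i)).ip_self_nonneg _)).1]
  refine Finset.sum_le_sum fun k _ => ?_
  -- With `a = b²`, `T` is multiplication by `bξ_k` and `S = ξ_k* b`, so that `S T` is the left
  -- action of `⟪ξ_k, aξ_k⟫`.
  refine (X.corr (p * q i)).sum_adjoint_le_inducedTrace (X.corr (q i)) hτ
    (T := fun ζ => X.mul rfl ((X.corr p).lsmul b (ξ k)) ζ)
    (S := fun x => X.adj rfl (ξ k) ((X.corr (p * q i)).lsmul b x)) (fun ζ x => ?_) (fun ζ => ?_)
    (H i) (hH i)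
  · rw [ip_adj rfl hp, ← X.lsmul_mul, (X.corr (p * q i)).ip_lsmul, hb]
  · rw [X.lsmul_mul, X.adj_mul rfl hp, ← (X.corr p).mul_lsmul]

/-- For `a = b²` one has `⟪ξ, aξ⟫ = ⟪ξ, b⟫⟪b, ξ⟫` in `X_e = A`. By traciality the admissible sums
are `τ⟪b, (∑ θ_{ξ,ξ}) b⟫ ≤ τ(b²)`, with near equality for families that almost fix `b`. -/
theorem tr_one {τ : A →L[ℂ] ℂ} (hτ : IsTracialState τ) {a : A} (ha : 0 ≤ a) :
    X.tr τ 1 a = ENNReal.ofReal (τ a).re := by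
  classical
  obtain ⟨b, hb, rfl⟩ : ∃ b : A, star b = b ∧ b * b = a :=
    ⟨CFC.sqrt a, (CFC.sqrt_nonneg a).isSelfAdjoint.star_eq, CFC.sqrt_mul_sqrt_self a⟩
  have hx : (X.corr 1).ip (X.unitEquiv b) (X.unitEquiv b) = b * b := by rw [X.ip_unit, hb]
  have hswap : ∀ ξ : X.X 1, (X.corr 1).ip ξ (X.unitEquiv b) * (X.corr 1).ip (X.unitEquiv b) ξ
      = (X.corr 1).ip ξ ((X.corr 1).lsmul (b * b) ξ) := fun ξ => by
    obtain ⟨e, rfl⟩ := X.unitEquiv.surjective ξ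
    rw [X.lsmul_unit, X.ip_unit, X.ip_unit, X.ip_unit, hb]
    simp only [mul_assoc]
  refine le_antisymm (iSup₂_le fun H hH => ?_) ?_
  · have hnn : ∀ ξ ∈ H, 0 ≤ (τ ((X.corr 1).ip ξ ((X.corr 1).lsmul (b * b) ξ))).re := fun ξ _ => by
      rw [← hswap, ← (X.corr 1).star_ip ξ]
      exact (hτ.nonneg _ (mul_star_self_nonneg _)).1
    rw [← ENNReal.ofReal_sum_of_nonneg hnn]
    refine ENNReal.ofReal_le_ofReal ?_
    have := hτ.re_mono (hH (X.unitEquiv b))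
    rw [hx, map_sum, Complex.re_sum] at this
    refine le_trans (le_of_eq (Finset.sum_congr rfl fun ξ _ => ?_)) this
    rw [← hswap, hτ.map_mul_comm, (X.corr 1).ip_rsmul]
  · refine ENNReal.le_of_forall_pos_le_add fun ε hε _ => ?_
    obtain ⟨n, ζ, hζ, h⟩ := (X.corr 1).exists_re_ip_self_le hτ {X.unitEquiv b} (NNReal.coe_pos.mpr hε)
    have h₁ := h (X.unitEquiv b) (by simp)
    rw [hx] at h₁
    refine (ENNReal.ofReal_le_ofReal h₁).trans (ENNReal.ofReal_add_le.trans ?_)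
    rw [ENNReal.ofReal_coe_nnreal]
    gcongr
    have hnn : ∀ i, 0 ≤ (τ ((X.corr 1).ip (ζ i) (X.unitEquiv b)
        * (X.corr 1).ip (X.unitEquiv b) (ζ i))).re := fun i => by
      rw [← (X.corr 1).star_ip (ζ i)]
      exact (hτ.nonneg _ (mul_star_self_nonneg _)).1
    rw [ENNReal.ofReal_sum_of_nonneg fun i _ => hnn i]
    simp only [hswap]
    exact (X.corr 1).sum_le_inducedTrace (b * b) ζ hζ.sum_le

end ProductSystem


/-! ### Shifting the alternating sums, and reduction of positivity to atoms -/

theorem exists_altSum_eq_sum {P : Type*} (j : P → P → P) (l : List P) (r : P) :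
    ∃ (ι : Type) (_ : Fintype ι) (s : ι → ℝ) (t : ι → P),
      ∀ Φ : P → ℝ, altSum j Φ l r = ∑ i, s i * Φ (t i) := by
  induction l generalizing r with
  | nil => exact ⟨Unit, inferInstance, fun _ => 1, fun _ => r, fun Φ => by simp [altSum]⟩
  | cons x l ih =>
    obtain ⟨ι, _, s, t, h⟩ := ih r
    obtain ⟨ι', _, s', t', h'⟩ := ih (j x r)
    refine ⟨ι ⊕ ι', inferInstance, Sum.elim s (fun i => - s' i), Sum.elim t t', fun Φ => ?_⟩
    rw [altSum, h, h', Fintype.sum_sum_type]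
    simp [sub_eq_add_neg]

theorem EReal.coe_real_sum {ι : Type*} (s : Finset ι) (f : ι → ℝ) :
    ((∑ i ∈ s, f i : ℝ) : EReal) = ∑ i ∈ s, (f i : EReal) := by
  classical
  induction s using Finset.induction_on with
  | empty => simp
  | insert i s hi ih => rw [Finset.sum_insert hi, Finset.sum_insert hi, EReal.coe_add, ih]

section

variable {P : Type*} [Monoid P]

theorem exists_isRightLCM_pair (hL : HasConditionalRightLCMs P) (hD : IsRightDirected P) (x y : P) :
    ∃ r, IsRightLCM {x, y} r := hL x y (hD x y)

theorem exists_isRightLCM_finset (hL : HasConditionalRightLCMs P) (hD : IsRightDirected P)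
    (K : Finset P) : ∃ r, IsRightLCM (K : Set P) r := by
  classical
  induction K using Finset.induction_on with
  | empty => exact ⟨1, by simp [IsRightLCM]⟩
  | insert x K _ ih =>
    obtain ⟨r, hr⟩ := ih
    obtain ⟨m, hm⟩ := exists_isRightLCM_pair hL hD x r
    refine ⟨m, fun p hp => ?_, fun z hz => hm.pair_dvd_iff.mpr ⟨hz x (by simp), ?_⟩⟩
    · rw [Finset.coe_insert] at hp
      rcases hp with rfl | hp
      · exact hm.1 p (by simp)
      · exact (hr.1 p hp).trans (hm.1 r (by simp))
    · exact hr.2 z fun p hp => hz p (by rw [Finset.coe_insert]; exact Or.inr hp)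

end

theorem CStarCorrespondence.ip_lsmul_self_nonneg {A : Type*} [NonUnitalCStarAlgebra A]
    [PartialOrder A] [StarOrderedRing A] {E : Type*} [NormedAddCommGroup E] [NormedSpace ℂ E]
    [CompleteSpace E] (c : CStarCorrespondence A E) {a : A} (ha : 0 ≤ a) (x : E) :
    0 ≤ c.ip x (c.lsmul a x) := by
  obtain ⟨b, rfl⟩ := CStarAlgebra.nonneg_iff_eq_star_mul_self.mp ha
  rw [c.mul_lsmul, c.ip_lsmul_right, star_star]
  exact c.ip_self_nonneg _

namespace ProductSystem

variable {P : Type*} [Monoid P] {A : Type*} [NonUnitalCStarAlgebra A] [PartialOrder A]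
  [StarOrderedRing A] (X : ProductSystem P A) {τ : A →L[ℂ] ℂ}

/-- `Tr_τ^p` is dominated by a multiple of `τ`. -/
def TraceBounded (τ : A →L[ℂ] ℂ) (p : P) : Prop :=
  ∃ C : NNReal, ∀ a : A, 0 ≤ a → X.tr τ p a ≤ C * ENNReal.ofReal (τ a).re

variable {X}

theorem TraceBounded.ne_top {p : P} (h : X.TraceBounded τ p) {a : A} (ha : 0 ≤ a) :
    X.tr τ p a ≠ ⊤ := by
  obtain ⟨C, hC⟩ := h
  exact ((hC a ha).trans_lt (ENNReal.mul_lt_top ENNReal.coe_lt_top ENNReal.ofReal_lt_top)).ne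

/-- Approximate `Tr_τ^{pq}(a)` by `∑ Tr_τ^q(⟪ξ, aξ⟫) ≤ C' ∑ τ⟪ξ, aξ⟫ ≤ C' Tr_τ^p(a)`. -/
theorem TraceBounded.mul (hτ : IsTracialState τ) {p q : P} (hp : p ≠ 1)
    (h : X.TraceBounded τ p) (h' : X.TraceBounded τ q) : X.TraceBounded τ (p * q) := by
  obtain ⟨C, hC⟩ := h
  obtain ⟨C', hC'⟩ := h'
  refine ⟨C' * C, fun a ha => le_of_forall_lt fun m hm => ?_⟩
  obtain ⟨m', hmm', hm'⟩ := exists_between hm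
  obtain ⟨n, ξ, hξ, hle⟩ := X.exists_le_sum_tr_ip hp hτ ha (ι := Unit) (fun _ => q) (fun _ => m')
    (fun _ => hm')
  refine hmm'.trans_le ((hle ()).trans ?_)
  calc ∑ k, X.tr τ q ((X.corr p).ip (ξ k) ((X.corr p).lsmul a (ξ k)))
      ≤ ∑ k, C' * ENNReal.ofReal (τ ((X.corr p).ip (ξ k) ((X.corr p).lsmul a (ξ k)))).re :=
        Finset.sum_le_sum fun k _ => hC' _ ((X.corr p).ip_lsmul_self_nonneg ha _)
    _ = C' * ∑ k, ENNReal.ofReal (τ ((X.corr p).ip (ξ k) ((X.corr p).lsmul a (ξ k)))).re := by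
        rw [Finset.mul_sum]
    _ ≤ C' * X.tr τ p a := by
        gcongr
        exact (X.corr p).sum_le_inducedTrace a ξ hξ.sum_le
    _ ≤ C' * (C * ENNReal.ofReal (τ a).re) := by gcongr; exact hC a ha
    _ = _ := by rw [ENNReal.coe_mul, mul_assoc]

theorem traceBounded_of_isUnit (hτ : IsTracialState τ) (hinv : X.TraceUnitInvariant τ) {u : P}
    (hu : IsUnit u) : X.TraceBounded τ u := by
  refine ⟨1, fun a ha => ?_⟩
  have := hinv 1 u hu a ha
  rw [one_mul] at this
  rw [this, X.tr_one hτ ha, ENNReal.coe_one, one_mul]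

theorem tr_congr [IsLeftCancelMul P] (hinv : X.TraceUnitInvariant τ) {p q : P}
    (h : LeftAssociated p q) {a : A} (ha : 0 ≤ a) : X.tr τ p a = X.tr τ q a := by
  obtain ⟨u, hu, rfl⟩ := h.exists_isUnit
  exact (hinv p u hu a ha).symm

/-- The case `J = {p}` of positivity reads `N(p)^{-β} Tr_τ^p(a) ≤ τ(a)`; an infinite trace would
make the left-hand side of positivity `-∞`. -/
theorem traceBounded_of_positivityOn [IsLeftCancelMul P] {N : P →* ℝ} (hN : ∀ p, 0 < N p) {β : ℝ}
    (hinv : X.TraceUnitInvariant τ) {R : Set P}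
    (hR : X.PositivityOn N β τ R) {p : P} (hp : p ∈ R) : X.TraceBounded τ p := by
  classical
  have hex : ∃ r, IsRightLCM (({p} : Finset P) : Set P) r := ⟨p, by simp [IsRightLCM]⟩
  have hch := hex.choose_spec
  have hass : LeftAssociated hex.choose p := ⟨hch.2 p (by simp), hch.1 p (by simp)⟩
  have hw : 0 < N hex.choose ^ (-β) := Real.rpow_pos_of_pos (hN _) _
  refine ⟨(N hex.choose ^ (-β))⁻¹.toNNReal, fun a ha => ?_⟩
  have h₁ := hR {p} (by simpa using hp) a ha
  have h₂ : (({p} : Finset P).powerset.filter fun K => K.Nonempty) = {{p}} := by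
    ext K
    simp only [Finset.mem_filter, Finset.mem_powerset, Finset.subset_singleton_iff,
      Finset.mem_singleton]
    constructor
    · rintro ⟨rfl | h, hK⟩
      exacts [(Finset.not_nonempty_empty hK).elim, h]
    · rintro rfl
      exact ⟨Or.inr rfl, Finset.singleton_nonempty p⟩
  rw [h₂, Finset.sum_singleton, summand, dif_pos hex, Finset.card_singleton, pow_one,
    tr_congr hinv hass ha, neg_one_mul] at h₁
  have hfin : X.tr τ p a ≠ ⊤ := by
    intro htop
    rw [htop, EReal.coe_ennreal_top, EReal.coe_mul_top_of_neg (neg_neg_of_pos hw)] at h₁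
    simp at h₁
  rw [← EReal.coe_ennreal_toReal hfin, ← EReal.coe_mul, ← EReal.coe_add] at h₁
  have h₃ : 0 ≤ (τ a).re + -(N hex.choose ^ (-β)) * (X.tr τ p a).toReal := by exact_mod_cast h₁
  rw [← ENNReal.ofReal_toReal hfin]
  change _ ≤ ENNReal.ofReal _ * _
  rw [← ENNReal.ofReal_mul (by positivity)]
  refine ENNReal.ofReal_le_ofReal ?_
  rw [le_inv_mul_iff₀ hw]
  linarith

theorem traceBounded_of_irreducible (hτ : IsTracialState τ) (hinv : X.TraceUnitInvariant τ)
    (hP : IsFactorNoetherian P) (h : ∀ p, Irreducible p → X.TraceBounded τ p) (p : P) :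
    X.TraceBounded τ p := by
  induction p using hP.induction with
  | _ p ih =>
    by_cases hu : IsUnit p
    · exact traceBounded_of_isUnit hτ hinv hu
    by_cases hirr : Irreducible p
    · exact h p hirr
    obtain ⟨x, y, hx, hy, rfl⟩ : ∃ x y, ¬ IsUnit x ∧ ¬ IsUnit y ∧ p = x * y := by
      by_contra! hc
      exact hirr ⟨hu, fun {b c} h => by by_contra! h'; exact hc b c h'.1 h'.2 h⟩
    exact (ih x (.of_mul_left hy)).mul hτ (fun h => hx (h ▸ isUnit_one)) (ih y (.of_mul_right hx))

/-- The values `N(p)^{-β} Tr_τ^p(a)` for `a ∈ A_+`. -/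
noncomputable def weightedTrace (X : ProductSystem P A) (N : P →* ℝ) (β : ℝ) (τ : A →L[ℂ] ℂ)
    (p : P) (a : {a : A // 0 ≤ a}) : ℝ :=
  N p ^ (-β) * (X.tr τ p a).toReal

theorem weightedTrace_congr [IsLeftCancelMul P] {N : P →* ℝ} (hN₁ : ∀ u, IsUnit u → N u = 1)
    {β : ℝ} (hinv : X.TraceUnitInvariant τ) {p q : P} (h : LeftAssociated p q) :
    X.weightedTrace N β τ p = X.weightedTrace N β τ q := by
  funext a
  rw [weightedTrace, weightedTrace, tr_congr hinv h a.2]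
  obtain ⟨u, hu, rfl⟩ := h.exists_isUnit
  rw [map_mul, hN₁ u hu, mul_one]

/-- The bridge between the two forms of positivity. The term `K = ∅` is the trace at a unit, which
is `τ(a)` by `tr_one`; directedness excludes `∨K = ∞`. -/
theorem coe_altSum_eq [IsLeftCancelMul P] (hL : HasConditionalRightLCMs P) (hD : IsRightDirected P)
    {N : P →* ℝ} (hN₁ : ∀ u, IsUnit u → N u = 1) {β : ℝ} (hτ : IsTracialState τ)
    (hinv : X.TraceUnitInvariant τ) (hb : ∀ p, X.TraceBounded τ p) {j : P → P → P}
    (hj : ∀ x y, IsRightLCM {x, y} (j x y)) (l : List P) (J : Finset P)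
    (hJ : ∀ x, x ∈ J ↔ x ∈ l) (a : {a : A // 0 ≤ a}) :
    ((altSum j (X.weightedTrace N β τ · a) l 1 : ℝ) : EReal) =
      ((τ a).re : EReal) + ∑ K ∈ J.powerset with K.Nonempty, X.summand N β τ K a := by
  classical
  obtain rfl : J = l.toFinset := by ext x; simp [hJ]
  have hex := exists_isRightLCM_finset hL hD
  rw [altSum_eq_sum_powerset hj
    (fun x y h => by rw [weightedTrace_congr hN₁ hinv h]) l 1 (fun K => (hex K).choose)
    (fun K _ => ?_)]
  · rw [← Finset.sum_filter_add_sum_filter_not l.toFinset.powerset (fun K => K.Nonempty), add_comm]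
    have h₁ : (l.toFinset.powerset.filter fun K => ¬ K.Nonempty) = {∅} := by
      ext K
      simp only [Finset.mem_filter, Finset.mem_powerset, Finset.not_nonempty_iff_eq_empty,
        Finset.mem_singleton]
      exact ⟨fun h => h.2, fun h => ⟨by simp [h], h⟩⟩
    rw [h₁, Finset.sum_singleton, EReal.coe_add, EReal.coe_real_sum]
    congr 1
    · have h₂ : LeftAssociated (hex ∅).choose 1 := ⟨(hex ∅).choose_spec.2 1 (by simp), one_dvd _⟩
      rw [weightedTrace_congr hN₁ hinv h₂, weightedTrace, map_one, Real.one_rpow,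
        X.tr_one hτ a.2, ENNReal.toReal_ofReal (hτ.nonneg _ a.2).1]
      simp
    · refine Finset.sum_congr rfl fun K _ => ?_
      rw [summand, dif_pos (hex K), ← EReal.coe_ennreal_toReal ((hb _).ne_top a.2), ← EReal.coe_mul,
        weightedTrace, mul_assoc]
  · have h := (hex K).choose_spec
    refine ⟨fun p hp => ?_, fun z hz => h.2 z fun p hp => hz p (Or.inr hp)⟩
    rcases hp with rfl | hp
    exacts [one_dvd _, h.1 p hp]

theorem exists_contractiveFamily_toReal_close (hτ : IsTracialState τ)
    (hb : ∀ p, X.TraceBounded τ p) {p : P} (hp : p ≠ 1) {a : A} (ha : 0 ≤ a) {ι : Type*}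
    [Fintype ι] (t : ι → P) {ε : ℝ} (hε : 0 < ε) :
    ∃ (n : ℕ) (b : Fin n → {a : A // 0 ≤ a}), ∀ i,
      ∑ k, (X.tr τ (t i) (b k)).toReal ≤ (X.tr τ (p * t i) a).toReal ∧
      (X.tr τ (p * t i) a).toReal - ε ≤ ∑ k, (X.tr τ (t i) (b k)).toReal := by
  classical
  -- The lower approximation needs a value strictly below the trace, so the indices with zero trace
  -- are left out; for them the lower bound is trivial.
  obtain ⟨n, ξ, hξ, hle⟩ := X.exists_le_sum_tr_ip hp hτ ha
    (ι := {i // X.tr τ (p * t i) a ≠ 0}) (fun i => t i.1)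
    (fun i => X.tr τ (p * t i.1) a - ENNReal.ofReal ε)
    (fun i => ENNReal.sub_lt_self ((hb _).ne_top ha) i.2 (by simpa using hε))
  have hnn : ∀ k, 0 ≤ (X.corr p).ip (ξ k) ((X.corr p).lsmul a (ξ k)) :=
    fun k => (X.corr p).ip_lsmul_self_nonneg ha _
  refine ⟨n, fun k => ⟨_, hnn k⟩, fun i => ?_⟩
  have hsum : ∑ k, (X.tr τ (t i) ((X.corr p).ip (ξ k) ((X.corr p).lsmul a (ξ k)))).toReal
      = (∑ k, X.tr τ (t i) ((X.corr p).ip (ξ k) ((X.corr p).lsmul a (ξ k)))).toReal :=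
    (ENNReal.toReal_sum fun k _ => (hb _).ne_top (hnn k)).symm
  have hfin : ∑ k, X.tr τ (t i) ((X.corr p).ip (ξ k) ((X.corr p).lsmul a (ξ k))) ≠ ⊤ :=
    ENNReal.sum_ne_top.mpr fun k _ => (hb _).ne_top (hnn k)
  rw [hsum]
  refine ⟨ENNReal.toReal_mono ((hb _).ne_top ha) (X.sum_tr_ip_le_tr rfl hp τ a hξ), ?_⟩
  by_cases h0 : X.tr τ (p * t i) a = 0
  · rw [h0, ENNReal.toReal_zero, zero_sub]
    exact (neg_nonpos.mpr hε.le).trans ENNReal.toReal_nonneg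
  · rw [sub_le_iff_le_add, ← ENNReal.toReal_ofReal hε.le, ← ENNReal.toReal_add hfin
      ENNReal.ofReal_ne_top]
    exact ENNReal.toReal_mono (ENNReal.add_ne_top.mpr ⟨hfin, ENNReal.ofReal_ne_top⟩)
      (tsub_le_iff_right.mp (hle ⟨i, h0⟩))

/-- The alternating sum is a fixed linear combination of traces at finitely many `t i`. Up to an
arbitrarily small error the traces at `p * t i` on `a` are simultaneously the sums over `k` of the
traces at `t i` on positive elements `b k`, so the shifted sum is nearly `N(p)^{-β}` times a sum of
nonnegative ones. The coefficients have both signs, hence two-sided bounds are needed. -/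
theorem altSum_mul_left_nonneg {N : P →* ℝ} (hN : ∀ p, 0 < N p) {β : ℝ} (hτ : IsTracialState τ)
    (hb : ∀ p, X.TraceBounded τ p) {j : P → P → P} {p : P} (hp : p ≠ 1) (l : List P)
    (h : ∀ a, 0 ≤ altSum j (X.weightedTrace N β τ · a) l 1) (a : {a : A // 0 ≤ a}) :
    0 ≤ altSum j (fun r => X.weightedTrace N β τ (p * r) a) l 1 := by
  obtain ⟨ι, _, s, t, hsum⟩ := exists_altSum_eq_sum j l 1
  let w : ι → ℝ := fun i => s i * N (t i) ^ (-β)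
  have hW : 0 < ∑ i, |w i| + 1 :=
    add_pos_of_nonneg_of_pos (Finset.sum_nonneg fun i _ => abs_nonneg _) one_pos
  have hgoal : altSum j (fun r => X.weightedTrace N β τ (p * r) a) l 1
      = N p ^ (-β) * ∑ i, w i * (X.tr τ (p * t i) a).toReal := by
    rw [hsum, Finset.mul_sum]
    refine Finset.sum_congr rfl fun i _ => ?_
    rw [weightedTrace, map_mul, Real.mul_rpow (hN p).le (hN _).le]
    simp only [w]
    ring
  rw [hgoal]
  refine mul_nonneg (Real.rpow_nonneg (hN p).le _) (le_of_forall_pos_le_add fun δ hδ => ?_)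
  obtain ⟨n, b, hbk⟩ := exists_contractiveFamily_toReal_close hτ hb hp a.2 t (div_pos hδ hW)
  have h₁ : 0 ≤ ∑ i, w i * ∑ k, (X.tr τ (t i) (b k)).toReal := by
    have : ∑ i, w i * ∑ k, (X.tr τ (t i) (b k)).toReal
        = ∑ k, altSum j (X.weightedTrace N β τ · (b k)) l 1 := by
      simp only [hsum, Finset.mul_sum]
      rw [Finset.sum_comm]
      refine Finset.sum_congr rfl fun k _ => Finset.sum_congr rfl fun i _ => ?_
      rw [weightedTrace]
      simp only [w]
      ring
    rw [this]
    exact Finset.sum_nonneg fun k _ => h _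
  have h₂ : ∑ i, w i * ∑ k, (X.tr τ (t i) (b k)).toReal
      ≤ ∑ i, (w i * (X.tr τ (p * t i) a).toReal + |w i| * (δ / (∑ i, |w i| + 1))) := by
    refine Finset.sum_le_sum fun i _ => ?_
    obtain ⟨hb₁, hb₂⟩ := hbk i
    have h₃ : w i * (∑ k, (X.tr τ (t i) (b k)).toReal - (X.tr τ (p * t i) a).toReal)
        ≤ |w i| * (δ / (∑ i, |w i| + 1)) := by
      refine (le_abs_self _).trans ?_
      rw [abs_mul]
      gcongr
      rw [abs_le]
      constructor <;> linarith [div_pos hδ hW]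
    linarith
  rw [Finset.sum_add_distrib, ← Finset.sum_mul] at h₂
  have h₃ : (∑ i, |w i|) * (δ / (∑ i, |w i| + 1)) ≤ δ := by
    rw [mul_div_assoc', div_le_iff₀ hW]
    nlinarith
  linarith

/-- In a Noetherian right LCM monoid in which any two elements have a common right multiple,
positivity reduces to atoms. -/
theorem positivityOn_ne_one_iff [IsLeftCancelMul P] (hP : IsFactorNoetherian P)
    (hL : HasConditionalRightLCMs P) (hD : IsRightDirected P) (X : ProductSystem P A) {N : P →* ℝ}
    (hN : ∀ p, 0 < N p) (hN₁ : ∀ u, IsUnit u → N u = 1) (β : ℝ) (hτ : IsTracialState τ)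
    (hinv : X.TraceUnitInvariant τ) :
    X.PositivityOn N β τ {p | p ≠ 1} ↔ X.PositivityOn N β τ {p | Irreducible p} := by
  classical
  refine ⟨fun h J hJ => h J fun p hp => (hJ hp).ne_one, fun h => ?_⟩
  have hb := traceBounded_of_irreducible hτ hinv hP fun p hp =>
    traceBounded_of_positivityOn hN hinv h hp
  choose j hj using exists_isRightLCM_pair hL hD
  intro J _ a ha
  have key := coe_altSum_eq hL hD hN₁ (β := β) hτ hinv hb hj J.toList J (by simp) ⟨a, ha⟩
  rw [← key]
  refine EReal.coe_nonneg.mpr (altSum_nonneg_of_atoms hP hD hj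
    (fun x y h => weightedTrace_congr hN₁ hinv h) (fun p hp l hl => ?_) (fun l hl a => ?_) _ _)
  · exact altSum_mul_left_nonneg hN hτ hb (by rintro rfl; exact hp isUnit_one) l hl
  · rw [← EReal.coe_nonneg, coe_altSum_eq hL hD hN₁ hτ hinv hb hj l l.toFinset (by simp) a]
    exact h _ (fun p hp => hl p (by simpa using hp)) a a.2

end ProductSystem


/-! ### The order of the product of two simple reflections in a Coxeter group -/

namespace CoxeterMatrix

open Polynomial.Chebyshev Module

variable {B : Type*} (M : CoxeterMatrix B)

/-- The coroots `α_j ↦ -2 cos(π / m_{ij})` of the geometric representation. -/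
noncomputable def geomCoroot (i : B) : Dual ℝ (B →₀ ℝ) :=
  Finsupp.linearCombination ℝ fun j => -2 * Real.cos (Real.pi / M i j)

theorem geomCoroot_single (i j : B) :
    M.geomCoroot i (Finsupp.single j 1) = -2 * Real.cos (Real.pi / M i j) := by
  simp [geomCoroot]

theorem geomCoroot_self (i : B) : M.geomCoroot i (Finsupp.single i 1) = 2 := by
  simp [geomCoroot_single]

/-- The reflections of the geometric representation. -/
noncomputable def geomReflection (i : B) : (B →₀ ℝ) ≃ₗ[ℝ] (B →₀ ℝ) :=
  reflection (M.geomCoroot_self i)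

theorem geomCoroot_mul (i j : B) :
    2 * Real.cos (2 * Real.pi / M i j) = M.geomCoroot i (Finsupp.single j 1)
      * M.geomCoroot j (Finsupp.single i 1) - 2 := by
  rw [geomCoroot_single, geomCoroot_single, M.symmetric j i, mul_div_assoc, Real.cos_two_mul]
  ring

theorem sin_two_pi_div_ne_zero {m : ℕ} (hm : 3 ≤ m) : Real.sin (2 * Real.pi / m) ≠ 0 := by
  have hm' : (3 : ℝ) ≤ m := by exact_mod_cast hm
  refine (Real.sin_pos_of_pos_of_lt_pi (by positivity) ?_).ne'
  rw [div_lt_iff₀ (by positivity)]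
  nlinarith [Real.pi_pos]

theorem S_eval_two_mul_cos {θ : ℝ} (hθ : Real.sin θ ≠ 0) (k : ℤ) :
    (S ℝ k).eval (2 * Real.cos θ) = Real.sin ((k + 1) * θ) / Real.sin θ := by
  rw [eq_div_iff hθ, S_two_mul_real_cos]

/-- Powers of a product of two reflections are given by Chebyshev polynomials at `2 cos θ`, `θ =
2π/m`, where `S_k(2 cos θ) = sin((k+1)θ)/sin θ`. Orders below `3` are treated directly, since then
`sin θ = 0`. -/
theorem isLiftable_geomReflection : M.IsLiftable M.geomReflection := by
  intro i j
  rcases Nat.lt_or_ge (M i j) 3 with hlt | hge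
  · interval_cases hm : M i j
    · simp
    · have hij : i = j := by_contra fun h => M.off_diagonal i j h hm
      subst hij
      rw [pow_one]
      ext1 z
      exact involutive_reflection (M.geomCoroot_self i) z
    · have h₁ : M.geomCoroot i (Finsupp.single j 1) = 0 := by simp [geomCoroot_single, hm]
      have h₂ : M.geomCoroot j (Finsupp.single i 1) = 0 := by
        simp [geomCoroot_single, M.symmetric j i, hm]
      refine LinearEquiv.ext fun z => ?_
      simp only [pow_two, LinearEquiv.mul_apply, geomReflection, reflection_apply, map_sub,
        map_smul, h₁, h₂, geomCoroot_self, LinearEquiv.coe_one, id]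
      module
  · have hsin := sin_two_pi_div_ne_zero hge
    have hS := S_eval_two_mul_cos hsin
    have hm0 : (M i j : ℝ) ≠ 0 := by exact_mod_cast (by omega : M i j ≠ 0)
    refine LinearEquiv.ext fun z => ?_
    rw [geomReflection, geomReflection, reflection_mul_reflection_pow_apply
      (M.geomCoroot_self i) (M.geomCoroot_self j) (M i j) z _ (M.geomCoroot_mul i j)]
    -- The vanishing factor is `S_{n-1}` for `m = 2n`, as `nθ = π`, and `S_n + S_{n-1}` for `m = 2n
    -- + 1`, as `(n+1)θ = 2π - nθ`.
    obtain ⟨n, hn | hn⟩ := Nat.even_or_odd' (M i j)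
    · have h₁ : ((M i j : ℤ) - 2) / 2 = n - 1 := by omega
      have h₂ : ((M i j : ℤ) - 1) / 2 = n - 1 := by omega
      have h₃ : (S ℝ ((n : ℤ) - 1)).eval (2 * Real.cos (2 * Real.pi / M i j)) = 0 := by
        rw [hS]
        have : (((n : ℤ) - 1 : ℤ) + 1 : ℝ) * (2 * Real.pi / M i j) = Real.pi := by
          rw [hn] at hm0 ⊢
          push_cast at hm0 ⊢
          have hn0 : (n : ℝ) ≠ 0 := right_ne_zero_of_mul hm0
          rw [sub_add_cancel]
          field_simp
        rw [this, Real.sin_pi, zero_div]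
      rw [h₁, h₂, h₃]
      simp
    · have h₁ : ((M i j : ℤ) - 1) / 2 = n := by omega
      have h₂ : ((M i j : ℤ) - 3) / 2 = n - 1 := by omega
      have h₃ : (M i j : ℤ) / 2 = n := by omega
      have h₄ : ((M i j : ℤ) - 2) / 2 = n - 1 := by omega
      have h₅ : (S ℝ (n : ℤ)).eval (2 * Real.cos (2 * Real.pi / M i j))
          + (S ℝ ((n : ℤ) - 1)).eval (2 * Real.cos (2 * Real.pi / M i j)) = 0 := by
        rw [hS, hS, ← add_div]
        have : (((n : ℤ) : ℝ) + 1) * (2 * Real.pi / M i j)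
            = 2 * Real.pi - (((n : ℤ) - 1 : ℤ) + 1 : ℝ) * (2 * Real.pi / M i j) := by
          rw [hn] at hm0 ⊢
          push_cast at hm0 ⊢
          field_simp
          ring
        rw [this, Real.sin_two_pi_sub, neg_add_cancel, zero_div]
      rw [h₁, h₂, h₃, h₄, h₅]
      simp

end CoxeterMatrix

namespace CoxeterSystem

open Polynomial.Chebyshev Module

variable {B : Type*} {M : CoxeterMatrix B} {W : Type*} [Group W] (cs : CoxeterSystem M W)

/-- If the power fixed `α_i`, its coordinates at `α_j` and `α_i` would force `sin kθ = 0` and `cos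
kθ = 1` with `0 < kθ < 2π`. -/
theorem simple_mul_simple_pow_ne_one {i j : B} (hij : i ≠ j) {k : ℕ} (hk : 0 < k)
    (hkM : M i j ≠ 0 → k < M i j) : (cs.simple i * cs.simple j) ^ k ≠ 1 := by
  intro h
  have h₁ := congrArg (cs.lift ⟨_, M.isLiftable_geomReflection⟩) h
  rw [map_pow, map_mul, cs.lift_apply_simple, cs.lift_apply_simple, map_one] at h₁
  have h₂ := congrArg (fun e : (B →₀ ℝ) ≃ₗ[ℝ] (B →₀ ℝ) => e (Finsupp.single i 1)) h₁
  simp only [CoxeterMatrix.geomReflection] at h₂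
  rw [reflection_mul_reflection_pow_apply_self (M.geomCoroot_self i) (M.geomCoroot_self j) k _
    (M.geomCoroot_mul i j)] at h₂
  have hi := DFunLike.congr_fun h₂ i
  have hj := DFunLike.congr_fun h₂ j
  simp only [Finsupp.add_apply, Finsupp.smul_apply, Finsupp.single_eq_same, ne_eq, hij, hij.symm,
    not_false_eq_true, Finsupp.single_eq_of_ne, smul_eq_mul, mul_one, mul_zero, add_zero, zero_add,
    LinearEquiv.coe_one, id] at hi hj
  have hone : M i j ≠ 1 := M.off_diagonal i j hij
  rcases Nat.lt_or_ge (M i j) 3 with hlt | hge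
  · interval_cases hm : M i j
    -- The convention `π / 0 = 0` gives the coroot value `-2`, which is the right one for `m = ∞`.
    -- The coordinate at `α_i` is then `2k + 1`.
    · simp only [CharP.cast_eq_zero, div_zero, Real.cos_zero, mul_one, S_eval_two] at hi
      push_cast at hi
      have : (0 : ℝ) < k := by exact_mod_cast hk
      linarith
    · exact hone rfl
    · obtain rfl : k = 1 := by have := hkM two_ne_zero; omega
      norm_num at hi
  · have hsin := CoxeterMatrix.sin_two_pi_div_ne_zero hge
    have hS := CoxeterMatrix.S_eval_two_mul_cos hsin
    have hm3 : (3 : ℝ) ≤ M i j := by exact_mod_cast hge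
    have hkm : (k : ℝ) < M i j := by exact_mod_cast hkM (by omega)
    have hk' : (0 : ℝ) < k := by exact_mod_cast hk
    have hcos : Real.cos (Real.pi / M i j) ≠ 0 := by
      refine (Real.cos_pos_of_mem_Ioo ⟨?_, ?_⟩).ne'
      · have : 0 < Real.pi / M i j := by positivity
        linarith [Real.pi_pos]
      · rw [div_lt_div_iff_of_pos_left Real.pi_pos (by positivity) two_pos]
        linarith
    have hgx : M.geomCoroot j (Finsupp.single i 1) = -2 * Real.cos (Real.pi / M i j) := by
      rw [M.geomCoroot_single, M.symmetric j i]
    rw [hgx] at hj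
    have hS₁ : (S ℝ ((k : ℤ) - 1)).eval (2 * Real.cos (2 * Real.pi / M i j)) = 0 := by
      rcases mul_eq_zero.mp hj with h | h
      · exact h
      · exact (hcos (by linarith)).elim
    rw [hS₁, add_zero, hS, div_eq_one_iff_eq hsin] at hi
    rw [hS, div_eq_zero_iff, or_iff_left hsin] at hS₁
    push_cast at hS₁ hi
    rw [sub_add_cancel] at hS₁
    rw [add_mul, one_mul, Real.sin_add, hS₁, zero_mul, zero_add] at hi
    have hc1 : Real.cos (k * (2 * Real.pi / M i j)) = 1 := mul_right_cancel₀ hsin (by rw [hi, one_mul])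
    have hpos : 0 < k * (2 * Real.pi / M i j) := by have := Real.pi_pos; positivity
    have hlt : k * (2 * Real.pi / M i j) < 2 * Real.pi := by
      rw [mul_div_assoc', div_lt_iff₀ (by positivity)]
      nlinarith [Real.pi_pos]
    have := (Real.cos_eq_one_iff_of_lt_of_lt (by linarith [Real.pi_pos]) hlt).mp hc1
    exact hpos.ne' this

end CoxeterSystem


/-! ### The strong exchange property -/

namespace CoxeterSystem

variable {B : Type*} {M : CoxeterMatrix B} {W : Type*} [Group W] (cs : CoxeterSystem M W)

theorem leftInvSeq_append (ω ω' : List B) :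
    cs.leftInvSeq (ω ++ ω') =
      cs.leftInvSeq ω ++ (cs.leftInvSeq ω').map (MulAut.conj (cs.wordProd ω)) := by
  induction ω with
  | nil => simp
  | cons i ω ih =>
    simp only [List.cons_append, leftInvSeq, ih, List.map_append, List.map_map, wordProd_cons,
      map_mul]
    rfl

theorem leftInvSeq_alternatingFrom (i j : B) (k : ℕ) :
    cs.leftInvSeq (alternatingFrom i j k) =
      (List.range k).map fun l => (cs.simple i * cs.simple j) ^ l * cs.simple i := by
  induction k generalizing i j with
  | zero => rfl
  | succ k ih =>
    rw [alternatingFrom, leftInvSeq, ih, List.range_succ_eq_map, List.map_cons, List.map_map,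
      List.map_map]
    simp only [pow_zero, one_mul, List.cons.injEq, true_and]
    refine List.map_congr_left fun l _ => ?_
    have h : SemiconjBy (cs.simple i) (cs.simple j * cs.simple i) (cs.simple i * cs.simple j) := by
      simp [SemiconjBy, mul_assoc]
    have h' := (h.pow_right l).eq
    simp only [Function.comp_apply, MulAut.conj_apply, inv_simple, Nat.succ_eq_add_one, pow_succ]
    simp only [← mul_assoc] at h' ⊢
    rw [h']

theorem wordProd_alternatingFrom_two_mul (i j : B) (k : ℕ) :
    cs.wordProd (alternatingFrom i j (2 * k)) = (cs.simple i * cs.simple j) ^ k := by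
  induction k with
  | zero => simp [alternatingFrom]
  | succ k ih =>
    rw [mul_add, mul_one, alternatingFrom, alternatingFrom, wordProd_cons, wordProd_cons, ih,
      pow_succ', mul_assoc]

open Classical in
/-- The action of a simple reflection on pairs of a reflection and a sign. -/
noncomputable def signedConj (i : B) : Function.End (W × ZMod 2) := fun x =>
  (cs.simple i * x.1 * cs.simple i, x.2 + if x.1 = cs.simple i then 1 else 0)

-- The sign changes exactly when the current conjugate of `r` equals the letter read, i.e. once for
-- each occurrence of `r` among the left inversions of the word.
open Classical in
theorem prod_signedConj_reverse (ω : List B) (r : W) (ε : ZMod 2) :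
    (ω.reverse.map cs.signedConj).prod (r, ε) =
      ((cs.wordProd ω)⁻¹ * r * cs.wordProd ω, ε + (cs.leftInvSeq ω).count r) := by
  induction ω generalizing r ε with
  | nil =>
    simp only [List.reverse_nil, List.map_nil, List.prod_nil, wordProd_nil, leftInvSeq_nil,
      List.count_nil, Nat.cast_zero, add_zero, inv_one, one_mul, mul_one]
    rfl
  | cons i ω ih =>
    have hinj : Function.Injective (MulAut.conj (cs.simple i)) := (MulAut.conj _).injective
    have hr : r = MulAut.conj (cs.simple i) (cs.simple i * r * cs.simple i) := by
      simp [MulAut.conj_apply, mul_assoc]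
    have hc : ((cs.leftInvSeq ω).map (MulAut.conj (cs.simple i))).count r =
        (cs.leftInvSeq ω).count (cs.simple i * r * cs.simple i) := by
      conv_lhs => rw [hr]
      exact List.count_map_of_injective _ _ hinj _
    rw [List.reverse_cons, List.map_append, List.prod_append]
    simp only [List.map_cons, List.map_nil, List.prod_singleton]
    change (ω.reverse.map cs.signedConj).prod (cs.signedConj i (r, ε)) = _
    rw [signedConj, ih, leftInvSeq, List.count_cons, hc, wordProd_cons]
    refine Prod.ext ?_ ?_
    · simp [mul_assoc]
    · by_cases h : r = cs.simple i
      · simp only [h, if_true, beq_self_eq_true]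
        push_cast
        ring
      · have h' : ¬ (cs.simple i = r) := fun e => h e.symm
        simp [h, h']

/-- The inversion sequence of the alternating word of length `2m` is one block of length `m`
repeated twice, so all multiplicities are even. -/
theorem isLiftable_signedConj : M.IsLiftable cs.signedConj := by
  classical
  intro i j
  have hpow : ∀ k, (cs.signedConj i * cs.signedConj j) ^ k =
      ((alternatingFrom j i (2 * k)).reverse.map cs.signedConj).prod := by
    intro k
    induction k with
    | zero => rfl
    | succ k ih =>
      rw [pow_succ, ih, mul_add, mul_one, alternatingFrom, alternatingFrom]
      simp
  have h1 : (cs.simple j * cs.simple i) ^ M i j = 1 := cs.simple_mul_simple_pow' i j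
  rw [hpow]
  funext ⟨r, ε⟩
  rw [prod_signedConj_reverse, wordProd_alternatingFrom_two_mul, h1, leftInvSeq_alternatingFrom,
    two_mul, List.range_add, List.map_append, List.count_append, List.map_map]
  have : ((fun l => (cs.simple j * cs.simple i) ^ l * cs.simple j) ∘ fun x => M i j + x) =
      fun l => (cs.simple j * cs.simple i) ^ l * cs.simple j := by
    funext l
    simp [pow_add, h1]
  rw [this]
  push_cast
  rw [CharTwo.add_self_eq_zero, inv_one, one_mul, mul_one, add_zero]
  rfl

/-- The action of the Coxeter group on pairs of a group element and a sign. -/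
noncomputable def signedConjHom : W →* Function.End (W × ZMod 2) :=
  cs.lift ⟨cs.signedConj, cs.isLiftable_signedConj⟩

-- Consequently the parity of the multiplicity of `r` in the inversion sequence depends only on the
-- group element, not on the word.
open Classical in
theorem signedConjHom_inv_wordProd (ω : List B) (r : W) (ε : ZMod 2) :
    cs.signedConjHom (cs.wordProd ω)⁻¹ (r, ε) =
      ((cs.wordProd ω)⁻¹ * r * cs.wordProd ω, ε + (cs.leftInvSeq ω).count r) := by
  rw [← prod_signedConj_reverse, ← wordProd_reverse, wordProd, map_list_prod, List.map_map]
  have : (cs.signedConjHom : W → _) ∘ cs.simple = cs.signedConj :=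
    funext fun i => cs.lift_apply_simple _ i
  rw [this]

theorem signedConjHom_add (w r : W) (ε δ : ZMod 2) :
    cs.signedConjHom w (r, ε + δ) =
      ((cs.signedConjHom w (r, ε)).1, (cs.signedConjHom w (r, ε)).2 + δ) := by
  classical
  obtain ⟨ω, hω⟩ := cs.wordProd_surjective w⁻¹
  obtain rfl : w = (cs.wordProd ω)⁻¹ := by rw [hω, inv_inv]
  rw [signedConjHom_inv_wordProd, signedConjHom_inv_wordProd, add_right_comm]

/-- A simple reflection flips its own sign. For `t = v s v⁻¹` the sign changes caused by `v` and
`v⁻¹` cancel. -/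
theorem IsReflection.signedConjHom_self {t : W} (ht : cs.IsReflection t) :
    cs.signedConjHom t (t, 0) = (t, 1) := by
  classical
  obtain ⟨v, i, rfl⟩ := ht
  set t := v * cs.simple i * v⁻¹ with ht
  obtain ⟨ω, rfl⟩ := cs.wordProd_surjective v
  obtain ⟨a, ha⟩ : ∃ a, cs.signedConjHom (cs.wordProd ω)⁻¹ (t, 0) = (cs.simple i, a) :=
    ⟨_, by
      rw [signedConjHom_inv_wordProd]
      refine Prod.ext ?_ rfl
      simp [ht, mul_assoc]⟩
  have hback : cs.signedConjHom (cs.wordProd ω) (cs.simple i, a) = (t, 0) := by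
    rw [← ha]
    change (cs.signedConjHom (cs.wordProd ω) * cs.signedConjHom (cs.wordProd ω)⁻¹) (t, 0) = _
    rw [← map_mul, mul_inv_cancel, map_one]
    rfl
  have hs : cs.signedConjHom (cs.simple i) (cs.simple i, a) = (cs.simple i, a + 1) := by
    have : cs.signedConjHom (cs.simple i) = cs.signedConj i := cs.lift_apply_simple _ i
    rw [this, signedConj]
    simp
  calc cs.signedConjHom t (t, 0)
      = cs.signedConjHom (cs.wordProd ω) (cs.signedConjHom (cs.simple i)
          (cs.signedConjHom (cs.wordProd ω)⁻¹ (t, 0))) := by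
        have : cs.signedConjHom t = cs.signedConjHom (cs.wordProd ω) *
            cs.signedConjHom (cs.simple i) * cs.signedConjHom (cs.wordProd ω)⁻¹ := by
          rw [ht, map_mul, map_mul]
        rw [this]
        rfl
    _ = (t, 1) := by rw [ha, hs, signedConjHom_add, hback]; simp

/-- The strong exchange property. -/
theorem mem_leftInvSeq_of_isLeftInversion {ω : List B} {t : W}
    (h : cs.IsLeftInversion (cs.wordProd ω) t) : t ∈ cs.leftInvSeq ω := by
  classical
  by_contra hmem
  obtain ⟨ht, hlt⟩ := h
  obtain ⟨ω', hω', he⟩ := cs.exists_isReduced (t * cs.wordProd ω)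
  have h1 := cs.signedConjHom_inv_wordProd ω' t 0
  have h2 : cs.signedConjHom (cs.wordProd ω')⁻¹ (t, 0) =
      cs.signedConjHom (cs.wordProd ω)⁻¹ (cs.signedConjHom t (t, 0)) := by
    rw [← he, mul_inv_rev, ht.inv, map_mul]
    rfl
  rw [ht.signedConjHom_self, h1] at h2
  have h4 := cs.signedConjHom_inv_wordProd ω t 1
  rw [List.count_eq_zero_of_not_mem hmem] at h4
  replace h2 := h2.trans h4
  have h3 : ((cs.leftInvSeq ω').count t : ZMod 2) = 1 := by simpa using congrArg Prod.snd h2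
  -- The parities of `t` for `w` and `tw` differ by one. If `t` were absent from `ω`, it would be a
  -- left inversion of `tw`, contradicting that `w = t(tw)` is longer.
  have hmem' : t ∈ cs.leftInvSeq ω' := by
    by_contra hn
    rw [List.count_eq_zero_of_not_mem hn] at h3
    simp at h3
  have := (cs.isLeftInversion_of_mem_leftInvSeq hω' hmem').2
  rw [← he, ← mul_assoc, ht.mul_self, one_mul] at this
  omega

/-- Each entry has odd multiplicity, so it also occurs in the sequence of a reduced word for the
same element; that word is therefore at least as long. -/
theorem isReduced_of_nodup_leftInvSeq {ω : List B} (h : (cs.leftInvSeq ω).Nodup) :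
    cs.IsReduced ω := by
  classical
  obtain ⟨ω', hω', he⟩ := cs.exists_isReduced (cs.wordProd ω)
  have hsub : cs.leftInvSeq ω ⊆ cs.leftInvSeq ω' := by
    intro t ht
    by_contra hn
    have h1 := cs.signedConjHom_inv_wordProd ω t 0
    rw [he, signedConjHom_inv_wordProd, List.count_eq_zero_of_not_mem hn,
      List.count_eq_one_of_mem h ht] at h1
    simpa using congrArg Prod.snd h1
  have hle := (h.subperm hsub).length_le
  rw [length_leftInvSeq, length_leftInvSeq, ← hω'.eq, ← he] at hle
  exact le_antisymm (cs.length_wordProd_le ω) hle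

theorem length_alternatingFrom (i j : B) (k : ℕ) : (alternatingFrom i j k).length = k := by
  induction k generalizing i j with
  | zero => rfl
  | succ k ih => simp [alternatingFrom, ih]

theorem isReduced_alternatingFrom {i j : B} (hij : i ≠ j) {k : ℕ} (hk : M i j ≠ 0 → k ≤ M i j) :
    cs.IsReduced (alternatingFrom i j k) := by
  refine cs.isReduced_of_nodup_leftInvSeq ?_
  rw [leftInvSeq_alternatingFrom]
  refine List.Nodup.map_on ?_ List.nodup_range
  have key : ∀ a b, a < b → b < k → (cs.simple i * cs.simple j) ^ a * cs.simple i ≠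
      (cs.simple i * cs.simple j) ^ b * cs.simple i := by
    intro a b hab hb he
    have he' := mul_right_cancel he
    obtain ⟨c, rfl⟩ := Nat.exists_eq_add_of_lt hab
    rw [add_assoc, pow_add, left_eq_mul] at he'
    exact cs.simple_mul_simple_pow_ne_one hij (Nat.succ_pos c)
      (fun h => lt_of_lt_of_le (by omega) (hk h)) he'
  intro a ha b hb he
  rw [List.mem_range] at ha hb
  rcases lt_trichotomy a b with h | h | h
  · exact absurd he (key a b h hb)
  · exact h
  · exact absurd he.symm (key b a h ha)

/-- By strong exchange `t` occurs in the inversion sequence of a concatenated word, either in the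
part of `u` or in the conjugated part of `x`. -/
theorem IsReflection.length_lt_or {t : W} (ht : cs.IsReflection t) {u x : W}
    (h : cs.length (t * (u * x)) < cs.length (u * x)) :
    cs.length (t * u) < cs.length u ∨ cs.length (u⁻¹ * t * u * x) < cs.length x := by
  obtain ⟨ω, hω, rfl⟩ := cs.exists_isReduced u
  obtain ⟨ω', hω', rfl⟩ := cs.exists_isReduced x
  rw [← wordProd_append] at h
  have hmem := cs.mem_leftInvSeq_of_isLeftInversion ⟨ht, h⟩
  rw [leftInvSeq_append, List.mem_append, List.mem_map] at hmem
  rcases hmem with hmem | ⟨r, hr, rfl⟩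
  · exact Or.inl (cs.isLeftInversion_of_mem_leftInvSeq hω hmem).2
  · refine Or.inr ?_
    simpa [MulAut.conj_apply, mul_assoc] using (cs.isLeftInversion_of_mem_leftInvSeq hω' hr).2

end CoxeterSystem


/-! ### The weak order of a Coxeter group -/

/-- Joins of two covers of the same element, below a bound, suffice for joins of bounded pairs, by
induction on the rank distance from `x` to `w`. It serves both for the weak order and for
divisibility in the Artin monoid, so antisymmetry is not required. -/
theorem exists_lub_of_covers {α : Type*} {r C : α → α → Prop} (hrefl : ∀ a, r a a)
    (htrans : ∀ {a b c}, r a b → r b c → r a c) (rank : α → ℕ)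
    (hrank : ∀ {a b}, r a b → rank a ≤ rank b)
    (hC : ∀ {x y}, C x y → r x y ∧ rank x < rank y)
    (hcov : ∀ {x a}, r x a → r a x ∨ ∃ y, C x y ∧ r y a)
    (hjoin : ∀ {x y y' w}, C x y → C x y' → r y w → r y' w →
      ∃ d, r y d ∧ r y' d ∧ ∀ z, r y z → r y' z → r d z)
    {x a b w : α} (ha : r x a) (hb : r x b) (haw : r a w) (hbw : r b w) :
    ∃ d, r a d ∧ r b d ∧ ∀ z, r a z → r b z → r d z := by
  induction hn : rank w - rank x using Nat.strong_induction_on generalizing x a b with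
  | _ n ih =>
  rcases hcov ha with hax | ⟨y, hy, hya⟩
  · exact ⟨b, htrans hax hb, hrefl b, fun z _ h => h⟩
  rcases hcov hb with hbx | ⟨y', hy', hyb⟩
  · exact ⟨a, hrefl a, htrans hbx ha, fun z h _ => h⟩
  have hyw := htrans hya haw
  have hyw' := htrans hyb hbw
  obtain ⟨d, hd1, hd2, hd3⟩ := hjoin hy hy' hyw hyw'
  have hdw := hd3 w hyw hyw'
  have r1 := (hC hy).2
  have r2 := (hC hy').2
  have r3 := hrank hd1
  have r4 := hrank hdw
  have r5 := hrank hd2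
  -- Here `e = a ∨ d` is formed above `y`, `f = b ∨ d` above `y'`, and `g = e ∨ f` above `d`; each
  -- base point has larger rank than `x`.
  obtain ⟨e, he1, he2, he3⟩ := ih _ (by omega) hya hd1 haw hdw rfl
  obtain ⟨f, hf1, hf2, hf3⟩ := ih _ (by omega) hyb hd2 hbw hdw rfl
  obtain ⟨g, hg1, hg2, hg3⟩ := ih _ (by omega) he2 hf2 (he3 w haw hdw) (hf3 w hbw hdw) rfl
  refine ⟨g, htrans he1 hg1, htrans hf1 hg2, fun z hza hzb => ?_⟩
  have hdz := hd3 z (htrans hya hza) (htrans hyb hzb)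
  exact hg3 z (he3 z hza hdz) (hf3 z hzb hdz)

namespace CoxeterSystem

variable {B : Type*} {M : CoxeterMatrix B} {W : Type*} [Group W] (cs : CoxeterSystem M W)

/-- The (right) weak order: `u` is a left factor of `w`. -/
def WeakLE (u w : W) : Prop := cs.length u + cs.length (u⁻¹ * w) = cs.length w

theorem WeakLE.refl (u : W) : cs.WeakLE u u := by simp [WeakLE]

theorem WeakLE.one_le (u : W) : cs.WeakLE 1 u := by simp [WeakLE]

theorem weakLE_mul_iff {u v : W} :
    cs.WeakLE u (u * v) ↔ cs.length (u * v) = cs.length u + cs.length v := by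
  rw [WeakLE, inv_mul_cancel_left, eq_comm]

variable {cs}

theorem WeakLE.trans {u v w : W} (h : cs.WeakLE u v) (h' : cs.WeakLE v w) : cs.WeakLE u w := by
  have h1 := cs.length_mul_le u (u⁻¹ * w)
  have h2 := cs.length_mul_le (u⁻¹ * v) (v⁻¹ * w)
  rw [mul_inv_cancel_left] at h1
  rw [mul_assoc, mul_inv_cancel_left] at h2
  unfold WeakLE at *
  omega

theorem WeakLE.length_le {u w : W} (h : cs.WeakLE u w) : cs.length u ≤ cs.length w := by
  unfold WeakLE at h
  omega

theorem WeakLE.antisymm {u w : W} (h : cs.WeakLE u w) (h' : cs.WeakLE w u) : u = w := by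
  have h1 := h'.length_le
  unfold WeakLE at h
  have h2 : cs.length (u⁻¹ * w) = 0 := by omega
  rw [cs.length_eq_zero_iff, inv_mul_eq_one] at h2
  exact h2

/-- Left division by a common left factor preserves the weak order. -/
theorem WeakLE.inv_mul {u v w : W} (h : cs.WeakLE u v) (h' : cs.WeakLE v w) :
    cs.WeakLE (u⁻¹ * v) (u⁻¹ * w) := by
  have h1 := h.trans h'
  unfold WeakLE at *
  rw [mul_inv_rev, inv_inv, mul_assoc, mul_inv_cancel_left]
  omega

theorem WeakLE.mul_left {u v w : W} (h : cs.WeakLE u (u * w)) (h' : cs.WeakLE v w) :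
    cs.WeakLE u (u * v) ∧ cs.WeakLE (u * v) (u * w) := by
  have h1 := cs.length_mul_le u v
  have h2 := cs.length_mul_le (u * v) (v⁻¹ * w)
  rw [mul_assoc, mul_inv_cancel_left] at h2
  unfold WeakLE at *
  rw [inv_mul_cancel_left] at *
  rw [mul_inv_rev, mul_assoc, inv_mul_cancel_left]
  omega

theorem WeakLE.mul_left_of_inv_mul {u v w : W} (h : cs.WeakLE u w) (h' : cs.WeakLE v (u⁻¹ * w)) :
    cs.WeakLE u (u * v) ∧ cs.WeakLE (u * v) w := by
  have := WeakLE.mul_left (u := u) (v := v) (w := u⁻¹ * w) (by simpa using h) h'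
  simpa using this

variable (cs)

theorem weakLE_simple_iff {w : W} {i : B} :
    cs.WeakLE (cs.simple i) w ↔ cs.IsLeftDescent w i := by
  rw [isLeftDescent_iff, WeakLE, inv_simple, length_simple, add_comm]

theorem isReduced_append_iff {ω ω' : List B} :
    cs.IsReduced (ω ++ ω') ↔ cs.IsReduced ω ∧ cs.IsReduced ω' ∧
      cs.WeakLE (cs.wordProd ω) (cs.wordProd (ω ++ ω')) := by
  have h1 := cs.length_wordProd_le ω
  have h2 := cs.length_wordProd_le ω'
  have h3 := cs.length_mul_le (cs.wordProd ω) (cs.wordProd ω')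
  rw [wordProd_append, weakLE_mul_iff]
  unfold IsReduced
  rw [wordProd_append, List.length_append]
  omega

theorem isReduced_cons_iff {i : B} {ω : List B} :
    cs.IsReduced (i :: ω) ↔ cs.IsReduced ω ∧ cs.IsLeftDescent (cs.wordProd (i :: ω)) i := by
  have := cs.isReduced_append_iff (ω := [i]) (ω' := ω)
  rw [wordProd_singleton, weakLE_simple_iff] at this
  rw [← List.singleton_append, this]
  have h : cs.IsReduced [i] := by simp [IsReduced]
  tauto

theorem alternatingFrom_eq_reverse (i j : B) (k : ℕ) :
    alternatingFrom i j k = (alternatingWord j i k).reverse := by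
  induction k generalizing i j with
  | zero => rfl
  | succ k ih => rw [alternatingFrom, alternatingWord_succ, ih]; simp

theorem wordProd_alternatingFrom_braid (i j : B) :
    cs.wordProd (alternatingFrom i j (M i j)) = cs.wordProd (alternatingFrom j i (M i j)) := by
  have h := cs.wordProd_braidWord_eq i j
  rw [braidWord, braidWord, M.symmetric j i] at h
  rw [alternatingFrom_eq_reverse, alternatingFrom_eq_reverse, wordProd_reverse, wordProd_reverse, h]

theorem wordProd_alternatingFrom_mem (H : Subgroup W) {i j : B} (hi : cs.simple i ∈ H)
    (hj : cs.simple j ∈ H) (k : ℕ) : cs.wordProd (alternatingFrom i j k) ∈ H := by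
  induction k generalizing i j with
  | zero => simp [alternatingFrom]
  | succ k ih =>
    rw [alternatingFrom, wordProd_cons]
    exact H.mul_mem hi (ih hj hi)

/-- Multiplying an alternating word by a generator on the left removes or adds a letter. At length
`m` the braid relation first changes the initial letter, so no longer word is needed. -/
theorem exists_alternatingFrom_of_mem_closure {i j : B} {q : W}
    (hq : q ∈ Subgroup.closure {cs.simple i, cs.simple j}) :
    ∃ k, (M i j ≠ 0 → k ≤ M i j) ∧
      (q = cs.wordProd (alternatingFrom i j k) ∨ q = cs.wordProd (alternatingFrom j i k)) := by
  have key : ∀ (i j : B) (k : ℕ), (M i j ≠ 0 → k ≤ M i j) →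
      ∃ l, (M i j ≠ 0 → l ≤ M i j) ∧
        (cs.simple i * cs.wordProd (alternatingFrom i j k) = cs.wordProd (alternatingFrom i j l) ∨
        cs.simple i * cs.wordProd (alternatingFrom i j k) = cs.wordProd (alternatingFrom j i l)) := by
    intro i j k hk
    rcases k with _ | k
    · exact ⟨1, fun h => Nat.one_le_iff_ne_zero.mpr h, Or.inl (by simp [alternatingFrom])⟩
    · exact ⟨k, fun h => (Nat.le_succ k).trans (hk h), Or.inr (by simp [alternatingFrom, wordProd_cons])⟩
  have key' : ∀ (i j : B) (k : ℕ), (M i j ≠ 0 → k ≤ M i j) →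
      ∃ l, (M i j ≠ 0 → l ≤ M i j) ∧
        (cs.simple i * cs.wordProd (alternatingFrom j i k) = cs.wordProd (alternatingFrom i j l) ∨
        cs.simple i * cs.wordProd (alternatingFrom j i k) = cs.wordProd (alternatingFrom j i l)) := by
    intro i j k hk
    by_cases hkM : M i j ≠ 0 ∧ k = M i j
    · rw [hkM.2, ← wordProd_alternatingFrom_braid]
      exact key i j (M i j) fun _ => le_rfl
    · refine ⟨k + 1, fun h => ?_, Or.inl (by simp [alternatingFrom, wordProd_cons])⟩
      have := hk h
      omega
  induction hq using Subgroup.closure_induction_left with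
  | one => exact ⟨0, fun _ => Nat.zero_le _, Or.inl (by simp [alternatingFrom])⟩
  | mul_left x hx y _ ih =>
    obtain ⟨k, hk, hy⟩ := ih
    rcases hx with rfl | rfl <;> rcases hy with rfl | rfl
    · exact key i j k hk
    · exact key' i j k hk
    · obtain ⟨l, hl, h⟩ := key' j i k (by rwa [M.symmetric j i])
      exact ⟨l, by rwa [M.symmetric i j], h.symm⟩
    · obtain ⟨l, hl, h⟩ := key j i k (by rwa [M.symmetric j i])
      exact ⟨l, by rwa [M.symmetric i j], h.symm⟩
  | inv_mul_cancel x hx y _ ih =>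
    obtain ⟨k, hk, hy⟩ := ih
    rcases hx with rfl | rfl <;> rcases hy with rfl | rfl <;> rw [inv_simple]
    · exact key i j k hk
    · exact key' i j k hk
    · obtain ⟨l, hl, h⟩ := key' j i k (by rwa [M.symmetric j i])
      exact ⟨l, by rwa [M.symmetric i j], h.symm⟩
    · obtain ⟨l, hl, h⟩ := key j i k (by rwa [M.symmetric j i])
      exact ⟨l, by rwa [M.symmetric i j], h.symm⟩

/-- Suppose a new letter `s_i` shortened `qx`. By exchange it would shorten the alternating word
`q`, against reducedness, or its conjugate in the dihedral subgroup would shorten the minimal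
representative `x`. -/
theorem length_alternatingFrom_mul {i j : B} (hij : i ≠ j) {x : W}
    (hx : ∀ q ∈ Subgroup.closure {cs.simple i, cs.simple j}, cs.length x ≤ cs.length (q * x))
    {k : ℕ} (hk : M i j ≠ 0 → k ≤ M i j) :
    cs.length (cs.wordProd (alternatingFrom i j k) * x) = k + cs.length x := by
  induction k generalizing i j with
  | zero => simp [alternatingFrom]
  | succ k ih =>
    have hk' : M j i ≠ 0 → k ≤ M j i := by
      rw [M.symmetric j i]
      exact fun h => (Nat.le_succ k).trans (hk h)
    have ih' := ih hij.symm (by rwa [Set.pair_comm]) hk'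
    have hi : cs.simple i ∈ Subgroup.closure {cs.simple i, cs.simple j} :=
      Subgroup.subset_closure (by simp)
    have hj : cs.simple j ∈ Subgroup.closure {cs.simple i, cs.simple j} :=
      Subgroup.subset_closure (by simp)
    have hq := cs.wordProd_alternatingFrom_mem _ hj hi k
    have hred := cs.isReduced_alternatingFrom hij hk
    have hred' := cs.isReduced_alternatingFrom hij.symm hk'
    unfold IsReduced at hred hred'
    rw [length_alternatingFrom] at hred hred'
    rw [alternatingFrom, wordProd_cons] at hred ⊢
    rw [mul_assoc]
    rcases cs.length_simple_mul (cs.wordProd (alternatingFrom j i k) * x) i with h | h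
    · omega
    · rcases (cs.isReflection_simple i).length_lt_or cs
          (u := cs.wordProd (alternatingFrom j i k)) (x := x) (by omega) with h' | h'
      · omega
      · exact absurd (hx _ (Subgroup.mul_mem _ (Subgroup.mul_mem _ (Subgroup.inv_mem _ hq) hi) hq))
          (not_le.mpr h')

/-- Two distinct left descents of `w` generate a finite dihedral group, whose longest element is
a left factor of `w`. -/
theorem weakLE_of_isLeftDescent {i j : B} (hij : i ≠ j) {w : W} (hi : cs.IsLeftDescent w i)
    (hj : cs.IsLeftDescent w j) :
    M i j ≠ 0 ∧ cs.WeakLE (cs.wordProd (alternatingFrom i j (M i j))) w := by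
  set H := Subgroup.closure {cs.simple i, cs.simple j} with hH
  obtain ⟨h, hh⟩ : ∃ h : H, ∀ h' : H, cs.length (h * w) ≤ cs.length (h' * w) :=
    ⟨_, fun h' => Function.argmin_le (fun h : H => cs.length (h * w)) h'⟩
  set x := (h : W) * w with hx
  have hmin : ∀ q ∈ H, cs.length x ≤ cs.length (q * x) := fun q hq => by
    simpa [hx, mul_assoc] using hh (⟨q, hq⟩ * h)
  have hw : w = (h : W)⁻¹ * x := by simp [hx]
  have key : ∀ {i j : B} {k : ℕ}, i ≠ j → cs.IsLeftDescent w j →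
      (∀ q ∈ Subgroup.closure {cs.simple i, cs.simple j}, cs.length x ≤ cs.length (q * x)) →
      (M i j ≠ 0 → k ≤ M i j) → w = cs.wordProd (alternatingFrom i j k) * x →
      M i j ≠ 0 ∧ k = M i j ∧ cs.WeakLE (cs.wordProd (alternatingFrom i j (M i j))) w := by
    intro i j k hij hj hmin hk hw
    have h1 := cs.length_alternatingFrom_mul hij hmin hk
    by_cases hkM : M i j ≠ 0 ∧ k = M i j
    · refine ⟨hkM.1, hkM.2, ?_⟩
      rw [hw, ← hkM.2, weakLE_mul_iff, h1, (cs.isReduced_alternatingFrom hij hk).eq,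
        length_alternatingFrom]
    · have h2 := cs.length_alternatingFrom_mul hij.symm (x := x) (k := k + 1)
        (by rwa [Set.pair_comm]) (fun h => by
          rw [M.symmetric j i] at h ⊢
          have := hk h
          omega)
      rw [alternatingFrom, wordProd_cons, mul_assoc, ← hw] at h2
      rw [← hw] at h1
      unfold IsLeftDescent at hj
      omega
  obtain ⟨k, hk, hq | hq⟩ := cs.exists_alternatingFrom_of_mem_closure (H.inv_mem h.2)
  · have := key hij hj hmin hk (hq ▸ hw)
    exact ⟨this.1, this.2.2⟩
  · have := key hij.symm hi (by rwa [Set.pair_comm]) (by rwa [M.symmetric j i]) (hq ▸ hw)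
    rw [M.symmetric j i, ← wordProd_alternatingFrom_braid] at this
    exact ⟨this.1, this.2.2⟩

theorem simple_weakLE_alternatingFrom {i j : B} (hij : i ≠ j) (hM : M i j ≠ 0) :
    cs.WeakLE (cs.simple i) (cs.wordProd (alternatingFrom i j (M i j))) := by
  have hred := cs.isReduced_alternatingFrom hij (k := M i j) fun _ => le_rfl
  obtain ⟨m, hm⟩ := Nat.exists_eq_succ_of_ne_zero hM
  rw [hm, alternatingFrom] at hred ⊢
  rw [weakLE_simple_iff]
  exact (cs.isReduced_cons_iff.mp hred).2

/-- Two elements with a common left factor `x` of colength one and a common upper bound have a least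
upper bound. -/
theorem exists_lub_of_mul_simple {x w : W} {i j : B} (hi : cs.WeakLE x (x * cs.simple i))
    (hj : cs.WeakLE x (x * cs.simple j)) (hiw : cs.WeakLE (x * cs.simple i) w)
    (hjw : cs.WeakLE (x * cs.simple j) w) :
    ∃ d, cs.WeakLE (x * cs.simple i) d ∧ cs.WeakLE (x * cs.simple j) d ∧
      ∀ z, cs.WeakLE (x * cs.simple i) z → cs.WeakLE (x * cs.simple j) z → cs.WeakLE d z := by
  by_cases hij : i = j
  · subst hij
    exact ⟨_, WeakLE.refl cs _, WeakLE.refl cs _, fun z h _ => h⟩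
  have key : ∀ z, cs.WeakLE (x * cs.simple i) z → cs.WeakLE (x * cs.simple j) z →
      M i j ≠ 0 ∧ cs.WeakLE (cs.wordProd (alternatingFrom i j (M i j))) (x⁻¹ * z) := by
    intro z hiz hjz
    have h1 := hi.inv_mul hiz
    have h2 := hj.inv_mul hjz
    rw [inv_mul_cancel_left, weakLE_simple_iff] at h1 h2
    exact cs.weakLE_of_isLeftDescent hij h1 h2
  obtain ⟨hM, hw⟩ := key w hiw hjw
  have hx := (hi.trans hiw).mul_left_of_inv_mul hw
  refine ⟨x * cs.wordProd (alternatingFrom i j (M i j)), ?_, ?_, fun z hiz hjz => ?_⟩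
  · exact (hx.1.mul_left (cs.simple_weakLE_alternatingFrom hij hM)).2
  · refine (hx.1.mul_left ?_).2
    rw [wordProd_alternatingFrom_braid, M.symmetric i j]
    exact cs.simple_weakLE_alternatingFrom (Ne.symm hij) (by rwa [M.symmetric j i])
  · exact ((hi.trans hiz).mul_left_of_inv_mul (key z hiz hjz).2).2

/-- Let `w₀` have maximal length and `u = vs` with `v ≤ w₀` already known. The reflection `vsv⁻¹`
shortens `w₀ = v(v⁻¹w₀)`; it does not shorten `v`, so `s` is a left descent of `v⁻¹w₀`, whence `vs ≤
w₀`. -/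
theorem exists_weakLE_top [Finite W] : ∃ w₀, ∀ u, cs.WeakLE u w₀ := by
  obtain ⟨w₀, h₀⟩ := Finite.exists_max cs.length
  refine ⟨w₀, fun u => ?_⟩
  induction hn : cs.length u generalizing u with
  | zero =>
    rw [cs.length_eq_zero_iff.mp hn]
    exact WeakLE.one_le cs _
  | succ n ih =>
    have hu : u ≠ 1 := fun h => by simp [h] at hn
    obtain ⟨i, hi⟩ := cs.exists_rightDescent_of_ne_one hu
    rw [isRightDescent_iff] at hi
    have hle := ih (u * cs.simple i) (by omega)
    set v := u * cs.simple i with hv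
    have huv : u = v * cs.simple i := by simp [hv]
    have ht : cs.IsReflection (v * cs.simple i * v⁻¹) := ⟨v, i, rfl⟩
    have hlt := lt_of_le_of_ne (h₀ _) (ht.length_mul_right_ne w₀)
    have hw : w₀ = v * (v⁻¹ * w₀) := by simp
    rw [hw] at hlt
    rcases ht.length_lt_or cs hlt with h | h
    · rw [inv_mul_cancel_right, ← huv] at h
      omega
    · have h' : v⁻¹ * (v * cs.simple i * v⁻¹) * v * (v⁻¹ * w₀) = cs.simple i * (v⁻¹ * w₀) := by
        group
      rw [h'] at h
      rw [huv]
      exact (hle.mul_left_of_inv_mul (cs.weakLE_simple_iff.mpr h)).2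

theorem exists_weakLE_lub [Finite W] (u v : W) :
    ∃ d, cs.WeakLE u d ∧ cs.WeakLE v d ∧ ∀ z, cs.WeakLE u z → cs.WeakLE v z → cs.WeakLE d z := by
  obtain ⟨w₀, h₀⟩ := cs.exists_weakLE_top
  refine exists_lub_of_covers (r := cs.WeakLE)
    (C := fun x y => ∃ i, y = x * cs.simple i ∧ cs.WeakLE x y) (WeakLE.refl cs)
    (fun h h' => h.trans h') cs.length (fun h => h.length_le) ?_ ?_ ?_
    (WeakLE.one_le cs u) (WeakLE.one_le cs v) (h₀ u) (h₀ v)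
  · rintro x y ⟨i, rfl, h⟩
    refine ⟨h, ?_⟩
    rw [weakLE_mul_iff, length_simple] at h
    omega
  · intro x a h
    by_cases hxa : x⁻¹ * a = 1
    · rw [inv_mul_eq_one] at hxa
      exact Or.inl (hxa ▸ WeakLE.refl cs x)
    · obtain ⟨i, hi⟩ := cs.exists_leftDescent_of_ne_one hxa
      have := h.mul_left_of_inv_mul (cs.weakLE_simple_iff.mpr hi)
      exact Or.inr ⟨_, ⟨i, rfl, this.1⟩, this.2⟩
  · rintro x y y' w ⟨i, rfl, hi⟩ ⟨j, rfl, hj⟩ hyw hyw'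
    exact cs.exists_lub_of_mul_simple hi hj hyw hyw'

end CoxeterSystem


/-! ### The lift of a Coxeter group to its Artin monoid -/

namespace CoxeterSystem

variable {B : Type*} {M : CoxeterMatrix B} {W : Type*} [Group W] (cs : CoxeterSystem M W)

/-- The element of the Artin monoid represented by a word. -/
def _root_.CoxeterMatrix.artinWord (M : CoxeterMatrix B) (ω : List B) : M.ArtinMonoid :=
  PresentedMonoid.mk M.artinRel (FreeMonoid.ofList ω)

theorem _root_.CoxeterMatrix.artinWord_nil : M.artinWord [] = 1 := rfl

theorem _root_.CoxeterMatrix.artinWord_append (ω ω' : List B) :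
    M.artinWord (ω ++ ω') = M.artinWord ω * M.artinWord ω' := rfl

theorem _root_.CoxeterMatrix.artinWord_singleton (i : B) :
    M.artinWord [i] = PresentedMonoid.of M.artinRel i := rfl

theorem _root_.CoxeterMatrix.artinWord_cons (i : B) (ω : List B) :
    M.artinWord (i :: ω) = PresentedMonoid.of M.artinRel i * M.artinWord ω := rfl

theorem _root_.CoxeterMatrix.artinWord_surjective : Function.Surjective M.artinWord :=
  fun a => by
    obtain ⟨ω, rfl⟩ := PresentedMonoid.surjective_mk (rels := M.artinRel) a
    exact ⟨FreeMonoid.toList ω, rfl⟩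

theorem _root_.CoxeterMatrix.artinWord_braid {i j : B} (h : M i j ≠ 0) :
    M.artinWord (alternatingFrom i j (M i j)) = M.artinWord (alternatingFrom j i (M j i)) :=
  Quotient.sound (ConGen.Rel.of _ _ ⟨i, j, h, rfl, rfl⟩)

/-- **Matsumoto's theorem**. -/
theorem artinWord_eq_of_isReduced {ω ω' : List B} (hω : cs.IsReduced ω) (hω' : cs.IsReduced ω')
    (h : cs.wordProd ω = cs.wordProd ω') : M.artinWord ω = M.artinWord ω' := by
  induction hn : ω.length generalizing ω ω' with
  | zero =>
    have hl : ω'.length = 0 := by rw [← hω'.eq, ← h, hω.eq, hn]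
    rw [List.length_eq_zero_iff.mp hn, List.length_eq_zero_iff.mp hl]
  | succ n ih =>
    have hl : ω'.length = n + 1 := by rw [← hω'.eq, ← h, hω.eq, hn]
    have same : ∀ {i : B} {ω ω' : List B}, cs.IsReduced (i :: ω) → cs.IsReduced (i :: ω') →
        cs.wordProd (i :: ω) = cs.wordProd (i :: ω') → (i :: ω).length = n + 1 →
        M.artinWord (i :: ω) = M.artinWord (i :: ω') := by
      intro i ω ω' h1 h2 h3 h4
      rw [wordProd_cons, wordProd_cons, mul_right_inj] at h3
      rw [M.artinWord_cons, M.artinWord_cons, ih (cs.isReduced_cons_iff.mp h1).1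
        (cs.isReduced_cons_iff.mp h2).1 h3 (by simpa using h4)]
    obtain ⟨i, ω, rfl⟩ := List.exists_cons_of_length_eq_add_one hn
    obtain ⟨j, ω', rfl⟩ := List.exists_cons_of_length_eq_add_one hl
    by_cases hij : i = j
    · subst hij
      exact same hω hω' h hn
    have hi := (cs.isReduced_cons_iff.mp hω).2
    have hj := (cs.isReduced_cons_iff.mp hω').2
    rw [← h] at hj
    -- With different first letters, both words are compared to reduced words beginning with the two
    -- sides of the braid relation; each comparison has a common first letter.
    obtain ⟨hM, hle⟩ := cs.weakLE_of_isLeftDescent hij hi hj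
    obtain ⟨x, hx, hxe⟩ := cs.exists_isReduced
      ((cs.wordProd (alternatingFrom i j (M i j)))⁻¹ * cs.wordProd (i :: ω))
    have e1 : cs.wordProd (i :: ω) = cs.wordProd (alternatingFrom i j (M i j) ++ x) := by
      rw [wordProd_append, ← hxe, mul_inv_cancel_left]
    have e2 : cs.wordProd (i :: ω) = cs.wordProd (alternatingFrom j i (M j i) ++ x) := by
      rw [e1, wordProd_append, wordProd_append, wordProd_alternatingFrom_braid, M.symmetric j i]
    have hM' : M j i ≠ 0 := by rwa [M.symmetric j i]
    have r1 : cs.IsReduced (alternatingFrom i j (M i j) ++ x) := by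
      rw [isReduced_append_iff, ← e1]
      exact ⟨cs.isReduced_alternatingFrom hij fun _ => le_rfl, hx, hle⟩
    have r2 : cs.IsReduced (alternatingFrom j i (M j i) ++ x) := by
      unfold IsReduced at r1 ⊢
      rw [← e2, e1, r1]
      simp [length_alternatingFrom, M.symmetric j i]
    have b : M.artinWord (alternatingFrom i j (M i j) ++ x) =
        M.artinWord (alternatingFrom j i (M j i) ++ x) := by
      rw [M.artinWord_append, M.artinWord_append, M.artinWord_braid hM]
    rw [h] at e2
    obtain ⟨m, hm⟩ := Nat.exists_eq_succ_of_ne_zero hM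
    obtain ⟨m', hm'⟩ := Nat.exists_eq_succ_of_ne_zero hM'
    rw [hm, hm', alternatingFrom, alternatingFrom, List.cons_append, List.cons_append] at b
    rw [hm, alternatingFrom, List.cons_append] at e1 r1
    rw [hm', alternatingFrom, List.cons_append] at e2 r2
    rw [same hω r1 e1 hn, same hω' r2 e2 hl, b]

/-- The canonical section of the Coxeter group in the Artin monoid. -/
noncomputable def artinLift (w : W) : M.ArtinMonoid :=
  M.artinWord (cs.exists_isReduced w).choose

theorem artinLift_wordProd {ω : List B} (hω : cs.IsReduced ω) :
    cs.artinLift (cs.wordProd ω) = M.artinWord ω :=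
  cs.artinWord_eq_of_isReduced (cs.exists_isReduced _).choose_spec.1 hω
    (cs.exists_isReduced _).choose_spec.2.symm

theorem artinLift_one : cs.artinLift 1 = 1 := by
  have : cs.IsReduced [] := by simp [IsReduced]
  simpa [M.artinWord_nil] using cs.artinLift_wordProd this

theorem artinLift_simple (i : B) :
    cs.artinLift (cs.simple i) = PresentedMonoid.of M.artinRel i := by
  have : cs.IsReduced [i] := by simp [IsReduced]
  simpa [M.artinWord_singleton] using cs.artinLift_wordProd this

variable {cs} in
theorem WeakLE.artinLift_mul {u v : W} (h : cs.WeakLE u (u * v)) :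
    cs.artinLift (u * v) = cs.artinLift u * cs.artinLift v := by
  obtain ⟨ω, hω, rfl⟩ := cs.exists_isReduced u
  obtain ⟨ω', hω', rfl⟩ := cs.exists_isReduced v
  rw [← wordProd_append] at h ⊢
  rw [cs.artinLift_wordProd hω, cs.artinLift_wordProd hω',
    cs.artinLift_wordProd (cs.isReduced_append_iff.mpr ⟨hω, hω', h⟩), M.artinWord_append]

/-! ### Joins in the weak order of a finite Coxeter group -/

variable [Finite W]

/-- The join in the weak order of a finite Coxeter group. -/
noncomputable def join (u v : W) : W := (cs.exists_weakLE_lub u v).choose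

theorem weakLE_join_left (u v : W) : cs.WeakLE u (cs.join u v) :=
  (cs.exists_weakLE_lub u v).choose_spec.1

theorem weakLE_join_right (u v : W) : cs.WeakLE v (cs.join u v) :=
  (cs.exists_weakLE_lub u v).choose_spec.2.1

variable {cs} in
theorem WeakLE.join_le {u v z : W} (hu : cs.WeakLE u z) (hv : cs.WeakLE v z) :
    cs.WeakLE (cs.join u v) z :=
  (cs.exists_weakLE_lub u v).choose_spec.2.2 z hu hv

theorem join_comm (u v : W) : cs.join u v = cs.join v u :=
  (WeakLE.join_le (cs.weakLE_join_right v u) (cs.weakLE_join_left v u)).antisymm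
    (WeakLE.join_le (cs.weakLE_join_right u v) (cs.weakLE_join_left u v))

/-- The complement `u⁻¹ (u ∨ v)` of `v` after `u`. -/
noncomputable def residue (u v : W) : W := u⁻¹ * cs.join u v

theorem mul_residue (u v : W) : u * cs.residue u v = cs.join u v := mul_inv_cancel_left u _

theorem residue_self (u : W) : cs.residue u u = 1 := by
  have : cs.join u u = u :=
    (WeakLE.join_le (WeakLE.refl cs u) (WeakLE.refl cs u)).antisymm (cs.weakLE_join_left u u)
  rw [residue, this, inv_mul_cancel]

theorem join_one_left (u : W) : cs.join 1 u = u :=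
  (WeakLE.join_le (WeakLE.one_le cs u) (WeakLE.refl cs u)).antisymm (cs.weakLE_join_right 1 u)

theorem residue_one_left (u : W) : cs.residue 1 u = u := by
  rw [residue, join_one_left, inv_one, one_mul]

theorem residue_one_right (u : W) : cs.residue u 1 = 1 := by
  rw [residue, join_comm, join_one_left, inv_mul_cancel]

theorem artinLift_join (u v : W) :
    cs.artinLift (cs.join u v) = cs.artinLift u * cs.artinLift (cs.residue u v) := by
  have h := cs.weakLE_join_left u v
  rw [← mul_residue] at h ⊢
  exact h.artinLift_mul

-- The rule `vv' ∨ u = v(v' ∨ v⁻¹(v ∨ u))`, from which both composition laws for complements follow.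
variable {cs} in
theorem WeakLE.join_mul {v v' : W} (h : cs.WeakLE v (v * v')) (u : W) :
    cs.join (v * v') u = v * cs.join v' (cs.residue v u) := by
  have h1 := cs.weakLE_join_left (v * v') u
  have h2 := cs.weakLE_join_right (v * v') u
  have h3 : cs.WeakLE (cs.join v u) (cs.join (v * v') u) := WeakLE.join_le (h.trans h1) h2
  have h4 : cs.WeakLE (cs.join v' (cs.residue v u)) (v⁻¹ * cs.join (v * v') u) := by
    refine WeakLE.join_le ?_ ((cs.weakLE_join_left v u).inv_mul h3)
    simpa using h.inv_mul h1
  have h5 := (h.trans h1).mul_left_of_inv_mul h4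
  refine WeakLE.antisymm (WeakLE.join_le ?_ ?_) h5.2
  · exact (h5.1.mul_left (cs.weakLE_join_left _ _)).2
  · refine (cs.weakLE_join_right v u).trans ?_
    rw [← mul_residue]
    exact (h5.1.mul_left (cs.weakLE_join_right _ _)).2

variable {cs} in
theorem WeakLE.residue_mul_left {v v' : W} (h : cs.WeakLE v (v * v')) (u : W) :
    cs.residue (v * v') u = cs.residue v' (cs.residue v u) := by
  rw [residue, h.join_mul, mul_inv_rev, mul_assoc, inv_mul_cancel_left]
  rfl

variable {cs} in
theorem WeakLE.artinLift_residue_mul {v v' : W} (h : cs.WeakLE v (v * v')) (u : W) :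
    cs.artinLift (cs.residue u (v * v')) =
      cs.artinLift (cs.residue u v) * cs.artinLift (cs.residue (cs.residue v u) v') := by
  have h1 : cs.residue u (v * v') = cs.residue u v * cs.residue (cs.residue v u) v' := by
    rw [residue, join_comm, h.join_mul, cs.join_comm v', ← cs.mul_residue _ v', ← mul_assoc v,
      mul_residue, ← mul_assoc, cs.join_comm v u]
    rfl
  rw [h1]
  refine WeakLE.artinLift_mul ?_
  rw [← h1]
  refine (cs.weakLE_join_left u v).inv_mul (WeakLE.join_le (cs.weakLE_join_left _ _) ?_)
  exact h.trans (cs.weakLE_join_right _ _)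

end CoxeterSystem


/-! ### Artin monoids of finite type are lattices -/

namespace CoxeterSystem

variable {B : Type*} {M : CoxeterMatrix B} {W : Type*} [Group W] (cs : CoxeterSystem M W)
  [Finite W]

/-- One step of the transducer that computes right complements in the Artin monoid: in state `u`,
it reads `v`, appends the lift of the complement `u⁻¹ (u ∨ v)` to the output and moves to the
state `v⁻¹ (u ∨ v)`. -/
noncomputable def residueStep (v : W) : Function.End (W × M.ArtinMonoid) := fun x =>
  (cs.residue v x.1, x.2 * cs.artinLift (cs.residue x.1 v))

theorem residueStep_one : cs.residueStep 1 = 1 := by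
  funext x
  simp only [residueStep, residue_one_left, residue_one_right, artinLift_one, mul_one]
  rfl

variable {cs} in
theorem WeakLE.residueStep_mul {v v' : W} (h : cs.WeakLE v (v * v')) :
    cs.residueStep (v * v') = cs.residueStep v' * cs.residueStep v := by
  funext x
  change _ = cs.residueStep v' (cs.residueStep v x)
  simp only [residueStep, h.residue_mul_left, h.artinLift_residue_mul, mul_assoc]

theorem prod_residueStep {ω : List B} (hω : cs.IsReduced ω) :
    (ω.map fun i => MulOpposite.op (cs.residueStep (cs.simple i))).prod =
      MulOpposite.op (cs.residueStep (cs.wordProd ω)) := by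
  induction ω with
  | nil => simp [residueStep_one]
  | cons i ω ih =>
    obtain ⟨h1, h2⟩ := cs.isReduced_cons_iff.mp hω
    rw [← weakLE_simple_iff, wordProd_cons] at h2
    rw [List.map_cons, List.prod_cons, ih h1, wordProd_cons, h2.residueStep_mul,
      MulOpposite.op_mul]

/-- The right action of the Artin monoid on the states and outputs of the transducer. -/
noncomputable def residueHom : M.ArtinMonoid →* (Function.End (W × M.ArtinMonoid))ᵐᵒᵖ :=
  PresentedMonoid.lift (fun i => MulOpposite.op (cs.residueStep (cs.simple i))) <| by
    rintro _ _ ⟨i, j, hM, rfl, rfl⟩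
    rw [FreeMonoid.lift_ofList, FreeMonoid.lift_ofList]
    -- For `i = j` the relation is trivial. Otherwise both sides are reduced words for the same
    -- group element, and `prod_residueStep` depends only on that element.
    by_cases hij : i = j
    · subst hij
      rfl
    · rw [cs.prod_residueStep (cs.isReduced_alternatingFrom hij fun _ => le_rfl),
        cs.prod_residueStep (cs.isReduced_alternatingFrom (Ne.symm hij) fun _ => le_rfl),
        wordProd_alternatingFrom_braid, M.symmetric j i]

/-- The result of reading `b` in the state `u`, with the output appended to `c`. -/
noncomputable def residueAct (b : M.ArtinMonoid) (x : W × M.ArtinMonoid) : W × M.ArtinMonoid :=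
  (cs.residueHom b).unop x

theorem residueAct_one (x : W × M.ArtinMonoid) : cs.residueAct 1 x = x := by
  rw [residueAct, map_one]
  rfl

theorem residueAct_mul (a b : M.ArtinMonoid) (x : W × M.ArtinMonoid) :
    cs.residueAct (a * b) x = cs.residueAct b (cs.residueAct a x) := by
  rw [residueAct, map_mul]
  rfl

theorem residueAct_of (i : B) (u : W) (c : M.ArtinMonoid) :
    cs.residueAct (PresentedMonoid.of M.artinRel i) (u, c) =
      (cs.residue (cs.simple i) u, c * cs.artinLift (cs.residue u (cs.simple i))) := rfl

/-- The invariant of the transducer: reading `b` from state `u` completes a square `u d = b v`,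
whose sides are common right multiples of `u` and `b`. -/
theorem exists_residueAct_eq (b : M.ArtinMonoid) (u : W) :
    ∃ (v : W) (d : M.ArtinMonoid), (∀ c, cs.residueAct b (u, c) = (v, c * d)) ∧
      cs.artinLift u * d = b * cs.artinLift v := by
  obtain ⟨ω, rfl⟩ := M.artinWord_surjective b
  induction ω generalizing u with
  | nil => exact ⟨u, 1, fun c => by rw [M.artinWord_nil, residueAct_one, mul_one],
      by rw [M.artinWord_nil, one_mul, mul_one]⟩
  | cons i ω ih =>
    obtain ⟨v, d, h1, h2⟩ := ih (cs.residue (cs.simple i) u)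
    refine ⟨v, cs.artinLift (cs.residue u (cs.simple i)) * d, fun c => ?_, ?_⟩
    · rw [M.artinWord_cons, residueAct_mul, residueAct_of, h1, mul_assoc]
    · rw [← mul_assoc, ← artinLift_join, join_comm, artinLift_join, mul_assoc, h2,
        M.artinWord_cons, mul_assoc, artinLift_simple]

theorem residueAct_one_state (b c : M.ArtinMonoid) : cs.residueAct b (1, c) = (1, c * b) := by
  obtain ⟨ω, rfl⟩ := M.artinWord_surjective b
  induction ω generalizing c with
  | nil => rw [M.artinWord_nil, residueAct_one, mul_one]
  | cons i ω ih =>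
    rw [M.artinWord_cons, residueAct_mul, residueAct_of, residue_one_right, residue_one_left, ih,
      artinLift_simple, mul_assoc]

/-- Reading `s_i` in state `s_i` outputs nothing and leads to state `1`, which copies its input.
Thus the transducer divides by `s_i` on the left, which yields left cancellation. -/
theorem residueAct_of_mul (i : B) (b : M.ArtinMonoid) :
    cs.residueAct (PresentedMonoid.of M.artinRel i * b) (cs.simple i, 1) = (1, b) := by
  rw [residueAct_mul, residueAct_of, residue_self, artinLift_one, residueAct_one_state, mul_one,
    one_mul]

theorem _root_.CoxeterMatrix.isLeftCancelMul_artinMonoid (cs : CoxeterSystem M W) :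
    IsLeftCancelMul M.ArtinMonoid where
  mul_left_cancel a b c h := by
    obtain ⟨ω, rfl⟩ := M.artinWord_surjective a
    induction ω with
    | nil => simpa [M.artinWord_nil] using h
    | cons i ω ih =>
      refine ih ?_
      have h' := congrArg (fun x => cs.residueAct x (cs.simple i, 1)) h
      simp only [M.artinWord_cons, mul_assoc, residueAct_of_mul] at h'
      exact congrArg Prod.snd h'

/-- If `s_i x = s_j y`, run the transducer from state `s_i`. On the left-hand side it outputs `x`;
on the other, the output begins with the complement of `s_j` after `s_i`, which therefore divides
`x`. -/
theorem isRightLCM_artinLift_join (i j : B) :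
    IsRightLCM {PresentedMonoid.of M.artinRel i, PresentedMonoid.of M.artinRel j}
      (cs.artinLift (cs.join (cs.simple i) (cs.simple j))) := by
  constructor
  · rintro _ (rfl | rfl)
    · rw [artinLift_join, artinLift_simple]
      exact dvd_mul_right _ _
    · rw [join_comm, artinLift_join, artinLift_simple]
      exact dvd_mul_right _ _
  · intro r hr
    obtain ⟨x, rfl⟩ := hr _ (Or.inl rfl)
    obtain ⟨y, hy⟩ := hr _ (Or.inr rfl)
    obtain ⟨v, d, h1, -⟩ := cs.exists_residueAct_eq y (cs.residue (cs.simple j) (cs.simple i))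
    have h2 := cs.residueAct_of_mul i x
    rw [hy, residueAct_mul, residueAct_of, h1, one_mul] at h2
    have hx : x = cs.artinLift (cs.residue (cs.simple i) (cs.simple j)) * d :=
      (congrArg Prod.snd h2).symm
    rw [hx, ← artinLift_simple cs i, ← mul_assoc, ← artinLift_join]
    exact dvd_mul_right _ _

/-- For `a = s_i a'`, the transducer gives `s_i d = b v`; if `z` is a common multiple of `a'` and
`d`, then `s_i z` is one of `a` and `b`. -/
theorem _root_.CoxeterMatrix.isRightDirected_artinMonoid (cs : CoxeterSystem M W) :
    IsRightDirected M.ArtinMonoid := by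
  intro a b
  obtain ⟨ω, rfl⟩ := M.artinWord_surjective a
  induction ω generalizing b with
  | nil => exact ⟨b, by rw [M.artinWord_nil]; exact one_dvd b, dvd_rfl⟩
  | cons i ω ih =>
    obtain ⟨v, d, -, h⟩ := cs.exists_residueAct_eq b (cs.simple i)
    obtain ⟨z, ⟨x, hx⟩, ⟨y, hy⟩⟩ := ih d
    refine ⟨PresentedMonoid.of M.artinRel i * z, ?_, ?_⟩
    · rw [M.artinWord_cons, hx]
      exact ⟨x, by rw [mul_assoc]⟩
    · rw [hy, ← artinLift_simple cs i, ← mul_assoc, h, mul_assoc]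
      exact dvd_mul_right _ _

end CoxeterSystem

/-! ### Word length, atoms and right LCMs in Artin monoids -/

namespace CoxeterMatrix

variable {B : Type*} (M : CoxeterMatrix B)

/-- The word length on the Artin monoid. -/
def artinLength : M.ArtinMonoid →* Multiplicative ℕ :=
  PresentedMonoid.lift (fun _ => Multiplicative.ofAdd 1) <| by
    rintro _ _ ⟨i, j, hM, rfl, rfl⟩
    rw [FreeMonoid.lift_ofList, FreeMonoid.lift_ofList, M.symmetric j i]
    simp [CoxeterSystem.length_alternatingFrom]

theorem artinLength_artinWord (ω : List B) :
    (M.artinLength (M.artinWord ω)).toAdd = ω.length := by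
  induction ω with
  | nil => rfl
  | cons i ω ih =>
    rw [artinWord_cons, map_mul, toAdd_mul, ih, List.length_cons, add_comm]
    rfl

theorem artinLength_eq_zero_iff {a : M.ArtinMonoid} : (M.artinLength a).toAdd = 0 ↔ a = 1 := by
  refine ⟨fun h => ?_, fun h => by rw [h, map_one]; rfl⟩
  obtain ⟨ω, rfl⟩ := M.artinWord_surjective a
  rw [artinLength_artinWord, List.length_eq_zero_iff] at h
  rw [h, artinWord_nil]

theorem isUnit_artinMonoid_iff {a : M.ArtinMonoid} : IsUnit a ↔ a = 1 := by
  refine ⟨fun h => ?_, fun h => h ▸ isUnit_one⟩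
  obtain ⟨b, hb⟩ := h.exists_right_inv
  have := congrArg (fun x => (M.artinLength x).toAdd) hb
  simp only [map_mul, toAdd_mul, map_one, toAdd_one] at this
  exact M.artinLength_eq_zero_iff.mp (by omega)

theorem isFactorNoetherian_artinMonoid : IsFactorNoetherian M.ArtinMonoid := by
  refine Subrelation.wf ?_ (measure fun a : M.ArtinMonoid => (M.artinLength a).toAdd).wf
  rintro f g ⟨x, y, rfl, h⟩
  change (M.artinLength f).toAdd < (M.artinLength (x * f * y)).toAdd
  rw [isUnit_artinMonoid_iff, isUnit_artinMonoid_iff, ← artinLength_eq_zero_iff,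
    ← artinLength_eq_zero_iff] at h
  rw [map_mul M.artinLength, map_mul M.artinLength, toAdd_mul, toAdd_mul]
  omega

theorem irreducible_artinMonoid_eq : {p : M.ArtinMonoid | Irreducible p} = M.artinGenerators := by
  ext p
  constructor
  · intro (hp : Irreducible p)
    obtain ⟨ω, rfl⟩ := M.artinWord_surjective p
    rcases ω with _ | ⟨i, ω⟩
    · exact absurd isUnit_one hp.not_isUnit
    · refine ⟨i, ?_⟩
      have := hp.isUnit_or_isUnit (M.artinWord_cons i ω)
      rw [isUnit_artinMonoid_iff, isUnit_artinMonoid_iff] at this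
      rcases this with h | h
      · exact absurd (congrArg (fun x => (M.artinLength x).toAdd) h) one_ne_zero
      · rw [artinWord_cons, h, mul_one]
  · rintro ⟨i, rfl⟩
    have hi : (M.artinLength (PresentedMonoid.of M.artinRel i)).toAdd = 1 := rfl
    refine ⟨fun h => ?_, fun x y h => ?_⟩
    · rw [isUnit_artinMonoid_iff, ← artinLength_eq_zero_iff] at h
      omega
    · rw [isUnit_artinMonoid_iff, isUnit_artinMonoid_iff, ← artinLength_eq_zero_iff,
        ← artinLength_eq_zero_iff]
      rw [h, map_mul, toAdd_mul] at hi
      omega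

/-- The covers of `x` are the elements `x s_i`. By left cancellation two of them have the join `x
(s_i ∨ s_j)`, and length is the rank. -/
theorem hasConditionalRightLCMs_artinMonoid {W : Type*} [Group W] [Finite W]
    (cs : CoxeterSystem M W) : HasConditionalRightLCMs M.ArtinMonoid := by
  have := isLeftCancelMul_artinMonoid cs
  rintro a b ⟨w, haw, hbw⟩
  suffices h : ∃ d, a ∣ d ∧ b ∣ d ∧ ∀ z, a ∣ z → b ∣ z → d ∣ z by
    obtain ⟨d, had, hbd, hd⟩ := h
    refine ⟨d, ?_, fun r' hr' => hd r' (hr' a (Or.inl rfl)) (hr' b (Or.inr rfl))⟩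
    rintro _ (rfl | rfl)
    exacts [had, hbd]
  refine exists_lub_of_covers (α := M.ArtinMonoid) (r := (· ∣ ·))
    (C := fun x y => ∃ i, y = x * PresentedMonoid.of M.artinRel i) dvd_refl dvd_trans
    (fun a => (M.artinLength a).toAdd) ?_ ?_ ?_ ?_ (one_dvd a) (one_dvd b) haw hbw
  · rintro a _ ⟨c, rfl⟩
    rw [map_mul, toAdd_mul]
    omega
  · rintro x _ ⟨i, rfl⟩
    refine ⟨dvd_mul_right _ _, ?_⟩
    rw [map_mul, toAdd_mul]
    exact Nat.lt_succ_self _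
  · rintro x _ ⟨c, rfl⟩
    obtain ⟨ω, rfl⟩ := M.artinWord_surjective c
    rcases ω with _ | ⟨i, ω⟩
    · exact Or.inl (by rw [artinWord_nil, mul_one])
    · exact Or.inr ⟨_, ⟨i, rfl⟩, by rw [artinWord_cons, ← mul_assoc]; exact dvd_mul_right _ _⟩
  · rintro x _ _ w ⟨i, rfl⟩ ⟨j, rfl⟩ - -
    have h := cs.isRightLCM_artinLift_join i j
    refine ⟨_, mul_dvd_mul_left x (h.1 _ (Or.inl rfl)), mul_dvd_mul_left x (h.1 _ (Or.inr rfl)),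
      ?_⟩
    rintro z ⟨c, rfl⟩ ⟨c', hc'⟩
    rw [mul_assoc, mul_assoc] at hc'
    rw [mul_assoc]
    refine mul_dvd_mul_left x (h.2 _ ?_)
    rintro _ (rfl | rfl)
    · exact dvd_mul_right _ _
    · rw [mul_left_cancel hc']
      exact dvd_mul_right _ _

end CoxeterMatrix

theorem mainTheorem4 :
    -- Noetherian directed right LCM monoids: trees are finite, and positivity reduces to atoms
    (∀ (P : Type*) [Monoid P] [IsLeftCancelMul P],
      IsFactorNoetherian P → HasConditionalRightLCMs P → IsRightDirected P →
      (∀ (n : ℕ) (l : ExtList P n),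
        (∃ Λ, IsListTree l Λ) ∧ ∀ Λ, IsListTree l Λ → (treeNodes Λ).Finite) ∧
      (∀ (A : Type*) [NonUnitalCStarAlgebra A] [PartialOrder A] [StarOrderedRing A]
        (X : ProductSystem P A) (N : P →* ℝ), (∀ p, 0 < N p) → (∀ u, IsUnit u → N u = 1) →
        ∀ (β : ℝ) (τ : A →L[ℂ] ℂ), IsTracialState τ → X.TraceUnitInvariant τ →
        (X.PositivityOn N β τ {p | p ≠ 1} ↔ X.PositivityOn N β τ {p | Irreducible p}))) ∧
    -- Artin monoids of finite type: positivity reduces to the canonical generators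
    (∀ (B : Type*) (M : CoxeterMatrix B), Finite M.Group →
      ∀ (A : Type*) [NonUnitalCStarAlgebra A] [PartialOrder A] [StarOrderedRing A]
        (X : ProductSystem M.ArtinMonoid A) (N : M.ArtinMonoid →* ℝ), (∀ p, 0 < N p) →
        ∀ (β : ℝ) (τ : A →L[ℂ] ℂ), IsTracialState τ →
        (X.PositivityOn N β τ {p | p ≠ 1} ↔ X.PositivityOn N β τ M.artinGenerators)) := by
  refine ⟨fun P _ _ hN hL hD => ⟨fun n l => ⟨exists_isListTree l, fun Λ hΛ =>
    treeNodes_finite hN hD l Λ hΛ⟩, fun A _ _ _ X N hN₀ hN₁ β τ hτ hinv =>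
    X.positivityOn_ne_one_iff hN hL hD hN₀ hN₁ β hτ hinv⟩, ?_⟩
  intro B M _ A _ _ _ X N hN β τ hτ
  have := CoxeterMatrix.isLeftCancelMul_artinMonoid M.toCoxeterSystem
  rw [← M.irreducible_artinMonoid_eq]
  refine X.positivityOn_ne_one_iff M.isFactorNoetherian_artinMonoid
    (M.hasConditionalRightLCMs_artinMonoid M.toCoxeterSystem)
    (CoxeterMatrix.isRightDirected_artinMonoid M.toCoxeterSystem) hN (fun u hu => ?_) β hτ
    (fun p u hu a _ => ?_)
  · rw [M.isUnit_artinMonoid_iff.mp hu, map_one]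
  · rw [M.isUnit_artinMonoid_iff.mp hu, mul_one]
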